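/- **Setting.** Let $Q$ be an $n$-dimensional smooth manifold, $k\ge 1$, let $T^rQ=J^r_0(\mathbb R,Q)$ be its tangent bundle of order $r$ with natural coordinates $(q_0^i,\dots,q_r^i)$ (the derivatives at $0$ of the coordinate expression of a curve), and let $L\in C^\infty(T^kQ\times\mathbb R)$, with $z$ the coordinate of $\mathbb R$. Put $$D_LF=\sum_\alpha q^i_{\alpha+1}\frac{\partial F}{\partial q^i_\alpha}+L\frac{\partial F}{\partial z}-\frac{\partial L}{\partial z}F,\qquad \hat p_i^{\,r}=\sum_{\alpha=0}^{k-1-r}(-1)^\alpha D_L^\alpha\Big(\frac{\partial L}{\partial q^i_{r+1+\alpha}}\Big)\quad(0\le r\le k-1),$$ and on $T^{2k-1}Q\times\mathbb R$ $$\eta_L=dz-\sum_{r=0}^{k-1}\hat p^{\,r}_i\,dq^i_r,\qquad E_L=\sum_{r=0}^{k-1}\hat p^{\,r}_i q^i_{r+1}-L .$$ The Legendre map $\mathcal{FL}\colon T^{2k-1}Q\times\mathbb R\to T^*(T^{k-1}Q)\times\mathbb R$ is $(q_0,\dots,q_{2k-1},z)\mapsto(q_0,\dots,q_{k-1},\hat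 p^{\,0},\dots,\hat p^{\,k-1},z)$, and $P_0$ denotes its image. On $T^*(T^{k-1}Q)\times\mathbb R$ we use the contact form $\eta_{k-1}=dz-\sum_{r}p^r_i\,dq^i_r$. The unified bundle is $\mathcal W=T^{2k-1}Q\times_{T^{k-1}Q}T^*(T^{k-1}Q)\times\mathbb R$, with projections $\varrho_1$ to $T^{2k-1}Q\times\mathbb R$, $\varrho_2$ to $T^*(T^{k-1}Q)\times\mathbb R$ and $\varrho_0$ to $Q\times\mathbb R$, precontact form $\eta_{\mathcal W}=\varrho_2^*\eta_{k-1}$ and Hamiltonian function $\mathcal H=\sum_{\alpha=0}^{k-1}p^\alpha_iq^i_{\alpha+1}-L$; $\mathcal W_1=\{(x,\mathcal{FL}(x))\}$ is the graph of $\mathcal{FL}$. For a manifold with a one-form $\eta$ and a function $H$, a curve $c$ *solves the contact Hamiltonian equations of $(\eta,H)$* if $$i(c')\,d\eta=\big(dH-\mathcal R(H)\,\eta\big)\circ c,\qquad i(c')\,\eta=-H\circ c, \tag{1}$$ where $\mathcal R$ is a Reeb vector, $i(\mathcal R)d\eta=0$, $i(\mathcal R)\eta=1$, at the points of the curve (Reeb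 vectors are not unique in general; below, a hypothesis asks for (1) with some choice of them, a conclusion asserts that they exist and that (1) holds with every choice). The *unified equations* are (1) for $(\mathcal W,\eta_{\mathcal W},\mathcal H)$. The *Herglotz equations* for a holonomic curve are (1) for $(T^{2k-1}Q\times\mathbb R,\eta_L,E_L)$; a curve in $T^{2k-1}Q\times\mathbb R$ is *holonomic* if it is the prolongation $t\mapsto(\text{jet of order }2k-1\text{ of }c\text{ at }t,\,z(t))$ of its projection $(c,z)$ to $Q\times\mathbb R$. The *contact Hamilton equations* are (1) on $\mathcal{FL}(U)$ for the form induced by $\eta_{k-1}$ and the function $H$ with $H\circ\mathcal{FL}=E_L$ on $U$; here, if $L$ is regular, $U$ is any open set on which $\mathcal{FL}$ is injective and that contains the point of $T^{2k-1}Q\times\mathbb R$ considered (such sets exist around every point of the curves below; $U$ is the whole space if $\mathcal{FL}$ is a diffeomorphism), and, if $L$ is almost-regular, $U=T^{2k-1}Q\times\mathbb R$ and $\mathcal{FL}(U)=P_0$; in both cases it is part of the assertion that $H$ exists. $L$ is *regular* if $\big(\partial^2L/\partial q^i_k\partial q^j_k\big)$ is nonsingular everywhere; it is *almost-regular* if $P_0$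 is a closed submanifold, $\mathcal{FL}$ is a submersion onto $P_0$, and the sets $\mathcal{FL}^{-1}(\mathcal{FL}(x))$ are connected. Curves are smooth and defined on an open set $I\subseteq\mathbb R$ (for instance $I=\mathbb R$). **Theorem.** (a) Every curve $\sigma\colon I\to\mathcal W$ with values in $\mathcal W_1$ is $\sigma=(\sigma_L,\sigma_H)$ with $\sigma_L=\varrho_1\circ\sigma$ and $\sigma_H=\varrho_2\circ\sigma=\mathcal{FL}\circ\sigma_L\colon I\to P_0$. (b) Let $L$ be regular. If $\sigma\colon I\to\mathcal W$ has values in $\mathcal W_1$ and solves the unified equations, then $\sigma_L$ is holonomic, i.e. it is the prolongation of $\varrho_0\circ\sigma$, and solves the Herglotz equations, and $\mathcal{FL}\circ\sigma_L$ solves the contact Hamilton equations. Conversely, if the prolongation $\sigma_L$ to $T^{2k-1}Q\times\mathbb R$ of a curve in $Q\times\mathbb R$ solves the Herglotz equations, then $(\sigma_L,\mathcal{FL}\circ\sigma_L)$ is a smooth curve solving the unified equations, and $\mathcal{FL}\circ\sigma_L$ solves the contact Hamilton equations. (c) Let $L$ be almost-regular, let $\mathcal W_f\subseteq\mathcal W_1$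 be any subset (in particular, the final constraint submanifold), $S_f=\varrho_1(\mathcal W_f)$ and $P_f=\varrho_2(\mathcal W_f)$, and assume that $\eta_L$ has a Reeb vector at each point of $S_f$. Then $P_f=\mathcal{FL}(S_f)$. If $\sigma\colon I\to\mathcal W$ has values in $\mathcal W_f$, solves the unified equations and satisfies $dq^i_\alpha/dt=q^i_{\alpha+1}$ for $k\le\alpha\le 2k-2$ (no condition if $k=1$), then $\sigma_L$ has values in $S_f$, is holonomic and solves the Herglotz equations, and $\mathcal{FL}\circ\sigma_L$ has values in $P_f$ and solves the contact Hamilton equations. Conversely, if the prolongation $\sigma_L$ to $T^{2k-1}Q\times\mathbb R$ of a curve in $Q\times\mathbb R$ has values in $S_f$ and solves the Herglotz equations, then $(\sigma_L,\mathcal{FL}\circ\sigma_L)$ is a smooth curve in $\mathcal W_f$ solving the unified equations, and $\mathcal{FL}\circ\sigma_L$ has values in $P_f$ and solves the contact Hamilton equations. -/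

import Mathlib

open scoped ContDiff Manifold Topology

noncomputable section

namespace HOContact

/-! ### Coordinate spaces -/

/-- The model space of an `n`-dimensional manifold. -/
abbrev E (n : ℕ) := EuclideanSpace ℝ (Fin n)

/-- Natural coordinates `(q_0, …, q_r)` of the tangent bundle of order `r`. -/
abbrev JetCoord (n r : ℕ) := Fin (r + 1) → E n

/-- The coordinate `q_α` as a linear map (zero when `α > r`). -/
def cmp (n r α : ℕ) : JetCoord n r →L[ℝ] E n :=
  if h : α < r + 1 then ContinuousLinearMap.proj ⟨α, h⟩ else 0

/-- The inclusion of `E n` as the `α`-th factor (zero when `α > r`). -/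
def ins (n r α : ℕ) : E n →L[ℝ] JetCoord n r :=
  if h : α < r + 1 then ContinuousLinearMap.single ℝ (fun _ => E n) ⟨α, h⟩ else 0

/-- `(q_0, …, q_r) ↦ (q_0, …, q_s)`. -/
def trunc (n r s : ℕ) : JetCoord n r →L[ℝ] JetCoord n s :=
  ContinuousLinearMap.pi fun α => cmp n r α

/-- `(q_0, …, q_r) ↦ (q_1, …, q_{s+1})`, with `q_α` read as zero for `α > r`. -/
def shift (n r s : ℕ) : JetCoord n r →L[ℝ] JetCoord n s :=
  ContinuousLinearMap.pi fun α => cmp n r (α + 1)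

/-- Natural coordinates `(q_0, …, q_{2k-1}, z)` of `T^{2k-1}Q × ℝ`. -/
abbrev LagCoord (n k : ℕ) := JetCoord n (2 * k - 1) × ℝ

/-- Natural coordinates `(q_0, …, q_{k-1}, p, z)` of `T^*(T^{k-1}Q) × ℝ`; the momenta
`p = (p^0, …, p^{k-1})` are written as one linear form `v ↦ ∑ p^α(v_α)`. -/
abbrev HamCoord (n k : ℕ) := JetCoord n (k - 1) × (JetCoord n (k - 1) →L[ℝ] ℝ) × ℝ

/-- Natural coordinates `(q_0, …, q_{2k-1}, p, z)` of the unified bundle. -/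
abbrev UniCoord (n k : ℕ) := JetCoord n (2 * k - 1) × (JetCoord n (k - 1) →L[ℝ] ℝ) × ℝ

/-! ### Contact Hamiltonian equations in coordinates -/

section Contact

variable {V : Type*} [NormedAddCommGroup V] [NormedSpace ℝ V]

/-- The exterior derivative `dη(u, v)` at `x` of a one-form `η`
(convention `d(f dg) = df ∧ dg`, `(α ∧ β)(u, v) = α(u) β(v) - α(v) β(u)`). -/
def dForm (η : V → V →L[ℝ] ℝ) (x u v : V) : ℝ := fderiv ℝ η x u v - fderiv ℝ η x v u

/-- `R` is a Reeb vector of `η` at `x`: `i(R)dη = 0` and `i(R)η = 1`. -/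
def IsReeb (η : V → V →L[ℝ] ℝ) (x R : V) : Prop :=
  (∀ u, dForm η x R u = 0) ∧ η x R = 1

/-- `i(w)dη = dH - R(H)η` and `i(w)η = -H` at the point `x`. -/
def ContactEq (η : V → V →L[ℝ] ℝ) (H : V → ℝ) (R x w : V) : Prop :=
  (∀ u, dForm η x w u = fderiv ℝ H x u - fderiv ℝ H x R * η x u) ∧ η x w = - H x

/-- The contact Hamiltonian equations hold at `x` for the velocity `w`, with some Reeb vector. -/
def SolvesSome (η : V → V →L[ℝ] ℝ) (H : V → ℝ) (x w : V) : Prop :=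
  ∃ R, IsReeb η x R ∧ ContactEq η H R x w

/-- Reeb vectors exist at `x`, and the contact Hamiltonian equations hold at `x` for the
velocity `w` whichever Reeb vector is used. -/
def SolvesAll (η : V → V →L[ℝ] ℝ) (H : V → ℝ) (x w : V) : Prop :=
  (∃ R, IsReeb η x R) ∧ ∀ R, IsReeb η x R → ContactEq η H R x w

end Contact

/-! ### The Lagrangian in coordinates

Here `ℓ` is the coordinate expression of a Lagrangian of order `k`, as a function of
`(q_0, …, q_{2k-1}, z)`. -/

section Local

variable {n k : ℕ} (ℓ : LagCoord n k → ℝ)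

/-- `∂ℓ/∂q_α`. -/
def dLdq (α : ℕ) (x : LagCoord n k) : E n →L[ℝ] ℝ :=
  (fderiv ℝ ℓ x).comp ((ContinuousLinearMap.inl ℝ _ ℝ).comp (ins n (2 * k - 1) α))

/-- `∂ℓ/∂z`. -/
def dLdz (x : LagCoord n k) : ℝ := fderiv ℝ ℓ x (0, 1)

/-- The Lagrangian total derivative
`D_L F = ∑ q_{α+1} ∂F/∂q_α + ℓ ∂F/∂z - (∂ℓ/∂z) F`. It is only ever used for `F` that does not
depend on `q_{2k-1}`, for which the sum stops at `α = 2k-2`. -/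
def totalD {G : Type*} [NormedAddCommGroup G] [NormedSpace ℝ G]
    (F : LagCoord n k → G) (x : LagCoord n k) : G :=
  fderiv ℝ F x (shift n (2 * k - 1) (2 * k - 1) x.1, ℓ x) - dLdz ℓ x • F x

/-- The Jacobi–Ostrogradskii momentum
`p̂^r = ∑_{α=0}^{k-1-r} (-1)^α D_L^α (∂ℓ/∂q_{r+1+α})`, for `0 ≤ r ≤ k-1`. -/
def momentum (r : ℕ) (x : LagCoord n k) : E n →L[ℝ] ℝ :=
  ∑ α ∈ Finset.range (k - r), (-1 : ℝ) ^ α • (totalD ℓ)^[α] (dLdq ℓ (r + 1 + α)) x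

/-- All momenta together, as the linear form `v ↦ ∑_{r<k} p̂^r(v_r)`. -/
def momenta (x : LagCoord n k) : JetCoord n (k - 1) →L[ℝ] ℝ :=
  ∑ r ∈ Finset.range k, (momentum ℓ r x).comp (cmp n (k - 1) r)

/-- The Cartan one-form `θ_L = ∑_{r<k} p̂^r dq_r`. -/
def thetaL (x : LagCoord n k) : LagCoord n k →L[ℝ] ℝ :=
  (momenta ℓ x).comp ((trunc n (2 * k - 1) (k - 1)).comp (ContinuousLinearMap.fst ℝ _ ℝ))

/-- The contact Lagrangian form `η_L = dz - θ_L`. -/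
def etaL (x : LagCoord n k) : LagCoord n k →L[ℝ] ℝ :=
  ContinuousLinearMap.snd ℝ _ ℝ - thetaL ℓ x

/-- The Lagrangian energy `E_L = ∑_{r<k} p̂^r(q_{r+1}) - ℓ`. -/
def energyLoc (x : LagCoord n k) : ℝ :=
  (∑ r ∈ Finset.range k, momentum ℓ r x (cmp n (2 * k - 1) (r + 1) x.1)) - ℓ x

/-- The coordinate expression `(q, z) ↦ (q_0, …, q_{k-1}, p̂(q, z), z)` of the Legendre map. -/
def legLoc (x : LagCoord n k) : HamCoord n k :=
  (trunc n (2 * k - 1) (k - 1) x.1, momenta ℓ x, x.2)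

/-- The canonical contact form `dz - p dq` of `T^*(T^{k-1}Q) × ℝ`. -/
def etaH (y : HamCoord n k) : HamCoord n k →L[ℝ] ℝ :=
  (ContinuousLinearMap.snd ℝ _ ℝ).comp (ContinuousLinearMap.snd ℝ _ _)
    - y.2.1.comp (ContinuousLinearMap.fst ℝ _ _)

/-- The projection of the unified bundle to `T^*(T^{k-1}Q) × ℝ`, in coordinates. -/
def projHLoc (n k : ℕ) : UniCoord n k →L[ℝ] HamCoord n k :=
  ((trunc n (2 * k - 1) (k - 1)).comp (ContinuousLinearMap.fst ℝ _ _)).prod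
    (ContinuousLinearMap.snd ℝ _ _)

/-- The canonical precontact form of the unified bundle, the pull-back of `etaH`. -/
def etaW (w : UniCoord n k) : UniCoord n k →L[ℝ] ℝ :=
  (etaH (projHLoc n k w)).comp (projHLoc n k)

/-- The Hamiltonian function `∑_{α<k} p^α(q_{α+1}) - ℓ` of the unified bundle. -/
def hamW (w : UniCoord n k) : ℝ :=
  w.2.1 (shift n (2 * k - 1) (k - 1) w.1) - ℓ (w.1, w.2.2)

end Local

/-! ### Higher-order tangent bundles -/

section Manifold

variable (n : ℕ) (Q : Type*) [TopologicalSpace Q] [ChartedSpace (E n) Q]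

/-- All smooth charts of `Q`. -/
abbrev charts : Set (OpenPartialHomeomorph Q (E n)) :=
  IsManifold.maximalAtlas 𝓘(ℝ, E n) ∞ Q

/-- Curves in `Q` that are smooth at `0`. -/
def Germ : Type _ := {γ : ℝ → Q // ContMDiffAt 𝓘(ℝ, ℝ) 𝓘(ℝ, E n) ∞ γ 0}

/-- Equality of `r`-jets at `0`. -/
def jetSetoid (r : ℕ) : Setoid (Germ n Q) where
  r γ δ := γ.1 0 = δ.1 0 ∧ ∀ e ∈ charts n Q, γ.1 0 ∈ e.source →
    ∀ α ≤ r, iteratedDeriv α (e ∘ γ.1) 0 = iteratedDeriv α (e ∘ δ.1) 0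
  iseqv :=
    { refl := fun _ => ⟨rfl, fun _ _ _ _ _ => rfl⟩
      symm := by
        rintro γ δ ⟨h, h'⟩
        exact ⟨h.symm, fun e he hs α hα => (h' e he (h ▸ hs) α hα).symm⟩
      trans := by
        rintro γ δ ε ⟨h, h'⟩ ⟨g, g'⟩
        exact ⟨h.trans g, fun e he hs α hα => (h' e he hs α hα).trans (g' e he (h ▸ hs) α hα)⟩ }

/-- The tangent bundle of order `r`, `T^rQ = J_0^r(ℝ, Q)`. -/
def Jet (r : ℕ) : Type _ := Quotient (jetSetoid n Q r)

variable {n Q}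

open Classical in
/-- The `r`-jet at `t` of a curve that is smooth at `t` (for other curves: the constant jet). -/
def jetAt (r : ℕ) (c : ℝ → Q) (t : ℝ) : Jet n Q r :=
  if h : ContMDiffAt 𝓘(ℝ, ℝ) 𝓘(ℝ, E n) ∞ (fun s => c (s + t)) 0 then
    Quotient.mk (jetSetoid n Q r) ⟨fun s => c (s + t), h⟩
  else Quotient.mk (jetSetoid n Q r) ⟨fun _ => c t, contMDiffAt_const⟩

namespace Jet

variable {r : ℕ}

/-- The base point. -/
def base (x : Jet n Q r) : Q :=
  Quotient.lift (s := jetSetoid n Q r) (fun γ : Germ n Q => γ.1 0) (fun _ _ h => And.left h) x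

/-- The projection `T^rQ → T^sQ`, for `s ≤ r`. -/
def proj (s : ℕ) (x : Jet n Q r) : Jet n Q s := Quotient.mk (jetSetoid n Q s) (Quotient.out x)

/-- The natural coordinates `q_α = d^α(e ∘ γ)/dt^α (0)` induced by a chart `e` of `Q` around the
base point. -/
def coord (e : OpenPartialHomeomorph Q (E n)) (x : Jet n Q r) : JetCoord n r :=
  fun α => iteratedDeriv α (e ∘ (Quotient.out x : Germ n Q).1) 0

/-- The inverse of the natural coordinates, for `q_0` in the image of the chart `e`: the jet of
`t ↦ e⁻¹(∑ q_α t^α / α!)`. -/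
def ofCoord (e : OpenPartialHomeomorph Q (E n)) (v : JetCoord n r) : Jet n Q r :=
  jetAt r (fun t => e.symm (∑ α : Fin (r + 1), (t ^ (α : ℕ) / (Nat.factorial α : ℝ)) • v α)) 0

end Jet

/-- The manifold topology of `T^rQ`: a set is open when it is so in all natural charts. -/
instance (r : ℕ) : TopologicalSpace (Jet n Q r) :=
  ⨆ e ∈ charts n Q, TopologicalSpace.coinduced
    (fun v : {v : JetCoord n r // v 0 ∈ e.target} => Jet.ofCoord e v.1) inferInstance

variable (n Q) in
/-- The cotangent bundle of `T^rQ`. As for Mathlib's tangent spaces, a covector at `pt` is given by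
its components in the preferred natural chart at `pt`, the one induced by `chartAt` at the base
point. -/
structure CotJet (r : ℕ) where
  /-- the point of `T^rQ` -/
  pt : Jet n Q r
  /-- the covector at that point -/
  cov : JetCoord n r →L[ℝ] ℝ

namespace CotJet

variable {r : ℕ}

/-- The momentum coordinates of a covector in the natural chart induced by `e`. -/
def coord (e : OpenPartialHomeomorph Q (E n)) (ξ : CotJet n Q r) : JetCoord n r →L[ℝ] ℝ :=
  ξ.cov.comp (fderiv ℝ (fun v : JetCoord n r =>
    Jet.coord (chartAt (E n) ξ.pt.base) (Jet.ofCoord e v)) (Jet.coord e ξ.pt))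

/-- The inverse of the natural coordinates. -/
def ofCoord (e : OpenPartialHomeomorph Q (E n))
    (v : JetCoord n r × (JetCoord n r →L[ℝ] ℝ)) : CotJet n Q r :=
  let x : Jet n Q r := Jet.ofCoord e v.1
  ⟨x, v.2.comp (fderiv ℝ (fun u : JetCoord n r => Jet.coord e (Jet.ofCoord (chartAt (E n) x.base) u))
    (Jet.coord (chartAt (E n) x.base) x))⟩

end CotJet

/-- The manifold topology of the cotangent bundle of `T^rQ`. -/
instance (r : ℕ) : TopologicalSpace (CotJet n Q r) :=
  ⨆ e ∈ charts n Q, TopologicalSpace.coinduced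
    (fun v : {v : JetCoord n r × (JetCoord n r →L[ℝ] ℝ) // v.1 0 ∈ e.target} =>
      CotJet.ofCoord e v.1) inferInstance

variable (n Q) in
/-- `T^{2k-1}Q × ℝ`. -/
abbrev LagSpace (k : ℕ) := Jet n Q (2 * k - 1) × ℝ

variable (n Q) in
/-- `T^*(T^{k-1}Q) × ℝ`. -/
abbrev HamSpace (k : ℕ) := CotJet n Q (k - 1) × ℝ

variable (n Q) in
/-- The unified bundle `T^{2k-1}Q ×_{T^{k-1}Q} T^*(T^{k-1}Q) × ℝ`. -/
structure UniSpace (k : ℕ) where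
  /-- the jet -/
  jet : Jet n Q (2 * k - 1)
  /-- the covector -/
  mom : CotJet n Q (k - 1)
  /-- the action variable -/
  z : ℝ
  /-- both lie over the same point of `T^{k-1}Q` -/
  compat : mom.pt = jet.proj (k - 1)

variable {k : ℕ}

/-- The projection of the unified bundle to `T^{2k-1}Q × ℝ`. -/
def projL (w : UniSpace n Q k) : LagSpace n Q k := (w.jet, w.z)

/-- The projection of the unified bundle to `T^*(T^{k-1}Q) × ℝ`. -/
def projH (w : UniSpace n Q k) : HamSpace n Q k := (w.mom, w.z)

/-- Natural coordinates of `T^{2k-1}Q × ℝ`. -/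
def coordL (e : OpenPartialHomeomorph Q (E n)) (x : LagSpace n Q k) : LagCoord n k :=
  (x.1.coord e, x.2)

/-- Natural coordinates of `T^*(T^{k-1}Q) × ℝ`. -/
def coordH (e : OpenPartialHomeomorph Q (E n)) (y : HamSpace n Q k) : HamCoord n k :=
  (y.1.pt.coord e, y.1.coord e, y.2)

/-- Natural coordinates of the unified bundle. -/
def coordW (e : OpenPartialHomeomorph Q (E n)) (w : UniSpace n Q k) : UniCoord n k :=
  (w.jet.coord e, w.mom.coord e, w.z)

/-! ### Curves -/

/-- A curve over the base curve `b` is smooth on `I`, where `φ e` is its expression in the natural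
chart induced by `e`. -/
def SmoothOn {V : Type*} [NormedAddCommGroup V] [NormedSpace ℝ V] (I : Set ℝ) (b : ℝ → Q)
    (φ : OpenPartialHomeomorph Q (E n) → ℝ → V) : Prop :=
  ContinuousOn b I ∧ ∀ e ∈ charts n Q, ContDiffOn ℝ ∞ (φ e) (I ∩ b ⁻¹' e.source)

/-- The prolongation to `T^{2k-1}Q × ℝ` of the curve `(c, z)` in `Q × ℝ`. -/
def prolong (k : ℕ) (c : ℝ → Q) (z : ℝ → ℝ) (t : ℝ) : LagSpace n Q k :=
  (jetAt (2 * k - 1) c t, z t)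

/-- A curve in `T^{2k-1}Q × ℝ` is holonomic: it is the prolongation of its (smooth) projection
to `Q × ℝ`. -/
def IsHolonomic (I : Set ℝ) (σ : ℝ → LagSpace n Q k) : Prop :=
  ContMDiffOn 𝓘(ℝ, ℝ) 𝓘(ℝ, E n) ∞ (fun t => (σ t).1.base) I ∧
  ContDiffOn ℝ ∞ (fun t => (σ t).2) I ∧
  ∀ t ∈ I, σ t = prolong k (fun s => (σ s).1.base) (fun s => (σ s).2) t

/-- The part `dq_α/dt = q_{α+1}`, `k ≤ α ≤ 2k-2`, of the holonomy condition for a curve in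
`T^{2k-1}Q × ℝ`, in all natural charts (no condition when `k = 1`). -/
def UpperHolonomic (I : Set ℝ) (σ : ℝ → LagSpace n Q k) : Prop :=
  ∀ t ∈ I, ∀ e ∈ charts n Q, (σ t).1.base ∈ e.source → ∀ α, k ≤ α → α ≤ 2 * k - 2 →
    deriv (fun s => cmp n (2 * k - 1) α ((σ s).1.coord e)) t
      = cmp n (2 * k - 1) (α + 1) ((σ t).1.coord e)

/-! ### Lagrangians -/

/-- Smoothness of a Lagrangian on `T^kQ × ℝ`, in natural charts. -/
def IsSmoothLagrangian (L : Jet n Q k × ℝ → ℝ) : Prop :=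
  ∀ e ∈ charts n Q, ContDiffOn ℝ ∞ (fun x : JetCoord n k × ℝ => L (Jet.ofCoord e x.1, x.2))
    {x | x.1 0 ∈ e.target}

/-- The pull-back of a Lagrangian to `T^{2k-1}Q × ℝ`, in the natural chart induced by `e`. -/
def locL (L : Jet n Q k × ℝ → ℝ) (e : OpenPartialHomeomorph Q (E n)) (x : LagCoord n k) : ℝ :=
  L (Jet.ofCoord e (trunc n (2 * k - 1) k x.1), x.2)

/-- The Lagrangian energy on `T^{2k-1}Q × ℝ`. -/
def energy (L : Jet n Q k × ℝ → ℝ) (x : LagSpace n Q k) : ℝ :=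
  energyLoc (locL L (chartAt (E n) x.1.base)) (coordL (chartAt (E n) x.1.base) x)

/-- The generalized Legendre map `T^{2k-1}Q × ℝ → T^*(T^{k-1}Q) × ℝ`. -/
def Leg (L : Jet n Q k × ℝ → ℝ) (x : LagSpace n Q k) : HamSpace n Q k :=
  (⟨x.1.proj (k - 1),
    momenta (locL L (chartAt (E n) x.1.base)) (coordL (chartAt (E n) x.1.base) x)⟩, x.2)

/-- The point `(x, Leg x)` of the unified bundle. -/
def graphPt (L : Jet n Q k × ℝ → ℝ) (x : LagSpace n Q k) : UniSpace n Q k :=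
  ⟨x.1, (Leg L x).1, x.2, rfl⟩

/-- The submanifold `W_1 = graph(Leg)` of the unified bundle. -/
def W1 (L : Jet n Q k × ℝ → ℝ) : Set (UniSpace n Q k) := Set.range (graphPt L)

/-- `L` is regular: the Hessian with respect to `q_k` is everywhere nonsingular. -/
def IsRegularLagrangian (L : Jet n Q k × ℝ → ℝ) : Prop :=
  ∀ e ∈ charts n Q, ∀ x : LagCoord n k, x.1 0 ∈ e.target → ∀ u : E n,
    (∀ v, fderiv ℝ (dLdq (locL L e) k) x (ins n (2 * k - 1) k u, 0) v = 0) → u = 0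

/-- `η_L` has a Reeb vector at `x`. -/
def HasReeb (L : Jet n Q k × ℝ → ℝ) (x : LagSpace n Q k) : Prop :=
  ∀ e ∈ charts n Q, x.1.base ∈ e.source → ∃ R, IsReeb (etaL (locL L e)) (coordL e x) R

/-! ### Subsets of `T^*(T^{k-1}Q) × ℝ` -/

/-- Curves through `y` in the subset `P` of `T^*(T^{k-1}Q) × ℝ`, smooth at `0`. -/
def IsCurveIn (P : Set (HamSpace n Q k)) (e : OpenPartialHomeomorph Q (E n)) (y : HamSpace n Q k)
    (γ : ℝ → HamSpace n Q k) : Prop :=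
  γ 0 = y ∧ (∀ᶠ s in 𝓝 (0 : ℝ), γ s ∈ P ∧ (γ s).1.pt.base ∈ e.source) ∧
    ContDiffAt ℝ ∞ (fun s => coordH e (γ s)) 0

/-- The tangent space of `P` at `y`, in natural coordinates: the velocities of curves in `P`. -/
def tangentTo (P : Set (HamSpace n Q k)) (e : OpenPartialHomeomorph Q (E n))
    (y : HamSpace n Q k) : Set (HamCoord n k) :=
  {u | ∃ γ, IsCurveIn P e y γ ∧ deriv (fun s => coordH e (γ s)) 0 = u}

/-- `P` is an embedded submanifold of `T^*(T^{k-1}Q) × ℝ`: in natural charts, it is locally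
straightened to a linear subspace by a diffeomorphism of open sets. -/
def IsSubmanifold (P : Set (HamSpace n Q k)) : Prop :=
  ∀ y ∈ P, ∀ e ∈ charts n Q, y.1.pt.base ∈ e.source →
    ∃ (F : Submodule ℝ (HamCoord n k)) (Φ : OpenPartialHomeomorph (HamCoord n k) (HamCoord n k)),
      coordH e y ∈ Φ.source ∧ ContDiffOn ℝ ∞ Φ Φ.source ∧ ContDiffOn ℝ ∞ Φ.symm Φ.target ∧
      ∀ v ∈ Φ.source, v.1 0 ∈ e.target ∧
        ((∃ y' ∈ P, y'.1.pt.base ∈ e.source ∧ coordH e y' = v) ↔ Φ v ∈ F)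

/-- `L` is almost-regular: `P_0 = Leg(T^{2k-1}Q × ℝ)` is a closed submanifold, `Leg` is a submersion
onto `P_0`, and the fibres of `Leg` are connected. -/
def IsAlmostRegularLagrangian (L : Jet n Q k × ℝ → ℝ) : Prop :=
  IsClosed (Set.range (Leg L)) ∧ IsSubmanifold (Set.range (Leg L)) ∧
  (∀ x : LagSpace n Q k, ∀ e ∈ charts n Q, x.1.base ∈ e.source →
    ∀ u ∈ tangentTo (Set.range (Leg L)) e (Leg L x),
      ∃ v, fderiv ℝ (legLoc (locL L e)) (coordL e x) v = u) ∧
  ∀ x : LagSpace n Q k, IsConnected (Leg L ⁻¹' {Leg L x})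

/-- Reeb vectors at `y` of the restriction of the canonical contact form to `P`. -/
def IsReebOn (P : Set (HamSpace n Q k)) (e : OpenPartialHomeomorph Q (E n)) (y : HamSpace n Q k)
    (R : HamCoord n k) : Prop :=
  R ∈ tangentTo P e y ∧ (∀ u ∈ tangentTo P e y, dForm etaH (coordH e y) R u = 0) ∧
    etaH (coordH e y) R = 1

/-- The contact Hamiltonian equations, at `y` and for the velocity `w`, of the submanifold `P` with
the form `η_0` induced by the canonical contact form, and the function `H` on `P`: `w` is tangent
to `P`, `H` has a differential `dH` at `y` along `P`, Reeb vectors exist, and for each of them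
`i(w)dη_0 = dH - R(H)η_0` on the tangent space of `P`, and `i(w)η_0 = -H`. -/
def SolvesOn (P : Set (HamSpace n Q k)) (H : HamSpace n Q k → ℝ)
    (e : OpenPartialHomeomorph Q (E n)) (y : HamSpace n Q k) (w : HamCoord n k) : Prop :=
  w ∈ tangentTo P e y ∧
  ∃ dH : HamCoord n k →L[ℝ] ℝ,
    (∀ γ, IsCurveIn P e y γ →
      HasDerivAt (fun s => H (γ s)) (dH (deriv (fun s => coordH e (γ s)) 0)) 0) ∧
    (∃ R, IsReebOn P e y R) ∧
    (∀ R, IsReebOn P e y R → ∀ u ∈ tangentTo P e y,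
      dForm etaH (coordH e y) w u = dH u - dH R * etaH (coordH e y) u) ∧
    etaH (coordH e y) w = - H y

/-! ### The equations for curves -/

/-- The base curve of a curve in the unified bundle. -/
def baseW (σ : ℝ → UniSpace n Q k) (t : ℝ) : Q := (σ t).jet.base

/-- `σ` is a smooth curve in the unified bundle. -/
def IsSmoothCurve (I : Set ℝ) (σ : ℝ → UniSpace n Q k) : Prop :=
  SmoothOn I (baseW σ) (fun e t => coordW e (σ t))

/-- The precontact Hamiltonian equations of the unified bundle, for some choice of Reeb vectors. -/
def SolvesUnified (L : Jet n Q k × ℝ → ℝ) (I : Set ℝ) (σ : ℝ → UniSpace n Q k) : Prop :=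
  ∀ t ∈ I, ∀ e ∈ charts n Q, baseW σ t ∈ e.source →
    SolvesSome etaW (hamW (locL L e)) (coordW e (σ t)) (deriv (fun s => coordW e (σ s)) t)

/-- The precontact Hamiltonian equations of the unified bundle, for every choice of Reeb vectors. -/
def SolvesUnifiedAll (L : Jet n Q k × ℝ → ℝ) (I : Set ℝ) (σ : ℝ → UniSpace n Q k) : Prop :=
  ∀ t ∈ I, ∀ e ∈ charts n Q, baseW σ t ∈ e.source →
    SolvesAll etaW (hamW (locL L e)) (coordW e (σ t)) (deriv (fun s => coordW e (σ s)) t)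

/-- The Herglotz equations (for a holonomic curve), for some choice of Reeb vectors of `η_L`. -/
def SolvesHerglotz (L : Jet n Q k × ℝ → ℝ) (I : Set ℝ) (σ : ℝ → LagSpace n Q k) : Prop :=
  ∀ t ∈ I, ∀ e ∈ charts n Q, (σ t).1.base ∈ e.source →
    SolvesSome (etaL (locL L e)) (energyLoc (locL L e)) (coordL e (σ t))
      (deriv (fun s => coordL e (σ s)) t)

/-- The Herglotz equations (for a holonomic curve), for every choice of Reeb vectors of `η_L`. -/
def SolvesHerglotzAll (L : Jet n Q k × ℝ → ℝ) (I : Set ℝ) (σ : ℝ → LagSpace n Q k) : Prop :=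
  ∀ t ∈ I, ∀ e ∈ charts n Q, (σ t).1.base ∈ e.source →
    SolvesAll (etaL (locL L e)) (energyLoc (locL L e)) (coordL e (σ t))
      (deriv (fun s => coordL e (σ s)) t)

/-- `H` is the Hamiltonian function on `Leg(U)`: `H ∘ Leg = E_L` on `U`. -/
def IsHamiltonianOn (L : Jet n Q k × ℝ → ℝ) (U : Set (LagSpace n Q k))
    (H : HamSpace n Q k → ℝ) : Prop :=
  ∀ x ∈ U, H (Leg L x) = energy L x

/-- The contact Hamilton equations at time `t` for the curve `σ` in `Leg(U)`: the Hamiltonian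
function of `Leg(U)` exists, and the equations hold at `t`. -/
def SolvesHamilton (L : Jet n Q k × ℝ → ℝ) (U : Set (LagSpace n Q k))
    (σ : ℝ → HamSpace n Q k) (t : ℝ) : Prop :=
  (∃ H, IsHamiltonianOn L U H) ∧ ∀ H, IsHamiltonianOn L U H →
    ∀ e ∈ charts n Q, (σ t).1.pt.base ∈ e.source →
      SolvesOn (Leg L '' U) H e (σ t) (deriv (fun s => coordH e (σ s)) t)

/-- For a regular Lagrangian: the contact Hamilton equations for `Leg ∘ σ`, where the Hamiltonian
function lives on the images of the open sets on which `Leg` is injective (on all of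
`T^*(T^{k-1}Q) × ℝ` when `Leg` is a diffeomorphism). -/
def SolvesHamiltonReg (L : Jet n Q k × ℝ → ℝ) (I : Set ℝ) (σ : ℝ → LagSpace n Q k) : Prop :=
  ∀ t ∈ I,
    (∃ U : Set (LagSpace n Q k), IsOpen U ∧ σ t ∈ U ∧ Set.InjOn (Leg L) U) ∧
    ∀ U : Set (LagSpace n Q k), IsOpen U → σ t ∈ U → Set.InjOn (Leg L) U →
      SolvesHamilton L U (fun s => Leg L (σ s)) t

/-- For an almost-regular Lagrangian: the contact Hamilton equations for `Leg ∘ σ` on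
`P_0 = Leg(T^{2k-1}Q × ℝ)`. -/
def SolvesHamiltonSing (L : Jet n Q k × ℝ → ℝ) (I : Set ℝ) (σ : ℝ → LagSpace n Q k) : Prop :=
  ∀ t ∈ I, SolvesHamilton L Set.univ (fun s => Leg L (σ s)) t

end Manifold

end HOContact

end

open HOContact

/-! All equations reduce to one condition on a velocity `a` at a point `x` of the jet space,
`GraphEq`: $\dot q_\alpha=q_{\alpha+1}$ for $\alpha\le k-1$, $\dot z=L$, and $\dot{\hat
p}^{\,r}=\partial L/\partial q_r-\hat p^{\,r-1}+L_z\hat p^{\,r}$ (without the term $\hat p^{\,r-1}$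
for $r=0$).

A curve in the graph of the Legendre map has velocity tangent to the graph. There the unified
equations say exactly `GraphEq` (`contactEq_etaW_iff`), because $\mathcal R(\mathcal H)=-L_z$ for
every Reeb vector (`fderiv_hamW_reeb`). In turn `GraphEq` gives $i(a)d\eta_L=dE_L+L_z\,\eta_L$;
pairing with a Reeb vector gives $\mathcal R(E_L)=-L_z$, so the Herglotz equations hold for every
choice (`contactEq_etaL`). Conversely the Herglotz equations give back `GraphEq` once $\dot
q_\alpha=q_{\alpha+1}$ holds for $\alpha\le k-1$ (`graphEq_of_contactEq`).

For regular $L$ the rest of holonomy is forced (`graphEq_holonomic`). The momentum equations agree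
with the recursion $\hat p^{\,r-1}=\partial L/\partial q_r-D_L\hat p^{\,r}$, and the derivative of
$\hat p^{\,r}$ in its highest variable $q_{2k-1-r}$ is plus or minus the Hessian, so the system for
the missing components is triangular. The same triangularity makes $\mathcal{FL}$ a local
diffeomorphism.

For the Hamilton equations, $\mathcal{FL}$ pulls $\eta_{k-1}$ back to $\eta_L$ and $H$ back to
$E_L$; a local section of $\mathcal{FL}$ over its image carries Reeb vectors and equations across
(`solvesOn_of_section`). In the almost-regular case $H$ exists since $dE_L$ vanishes on $\ker
d\mathcal{FL}$, so $E_L$ is locally constant on the connected fibres (`exists_hamiltonian`).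

The Legendre map and the energy are defined through a preferred chart; `momentum_eq_pullTheta` shows
that the momenta are the components of a one-form, which makes the coordinate formulas valid in
every natural chart. -/

noncomputable section

namespace HOContact

/-! ### Functions invariant under translations by a subspace -/

section Invariance

variable {V G : Type*} [NormedAddCommGroup V] [NormedSpace ℝ V]

/-- On `D`, the function `F` is invariant under translations by the subspace `K`. -/
def InvOn (D : Set V) (K : Submodule ℝ V) (F : V → G) : Prop :=
  ∀ x ∈ D, ∀ v ∈ K, F (x + v) = F x

variable [NormedAddCommGroup G] [NormedSpace ℝ G] {D : Set V} {K K' : Submodule ℝ V} {F : V → G}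

theorem InvOn.differential (hD : IsOpen D) (h : InvOn D K F) : InvOn D K (fderiv ℝ F) := by
  intro x hx v hv
  rw [← fderiv_comp_add_right]
  apply Filter.EventuallyEq.fderiv_eq
  filter_upwards [hD.mem_nhds hx] with y hy using h y hy v hv

theorem InvOn.differential_apply (h : InvOn D K F) {x v : V} (hx : x ∈ D) (hv : v ∈ K) :
    fderiv ℝ F x v = 0 := by
  by_cases hF : DifferentiableAt ℝ F x
  · have h1 := hF.hasFDerivAt.hasLineDerivAt v
    have h2 : HasLineDerivAt ℝ F 0 x v := by
      have : (fun t : ℝ => F (x + t • v)) = fun _ => F x := by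
        funext t
        exact h x hx _ (K.smul_mem t hv)
      unfold HasLineDerivAt
      rw [this]
      exact hasDerivAt_const _ _
    exact h1.unique h2
  · rw [fderiv_zero_of_not_differentiableAt hF]; rfl

theorem InvOn.differential_congr (h : InvOn D K F) {x u v : V} (hx : x ∈ D) (huv : u - v ∈ K) :
    fderiv ℝ F x u = fderiv ℝ F x v := by
  rw [← sub_eq_zero, ← map_sub, h.differential_apply hx huv]

/-- A translation by `K'` changes `X` only within `K`, which the differential of `F` annihilates,
and the differential itself is `K`-invariant. For the total derivative, `K'` is one order smaller
than `K`. -/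
theorem InvOn.differential_field (hD : IsOpen D) (h : InvOn D K F) {X : V → V} (hK : K' ≤ K)
    (hX : ∀ x ∈ D, ∀ v ∈ K', X (x + v) - X x ∈ K) :
    InvOn D K' (fun x => fderiv ℝ F x (X x)) := by
  intro x hx v hv
  simp only
  rw [h.differential hD x hx v (hK hv), h.differential_congr hx (hX x hx v hv)]

/-- On the line `x + t • v` the differential of `F` is constant while `X` moves by `t • w` modulo
`K`, so the function is affine in `t` with slope the derivative of `F` along `w`. -/
theorem InvOn.differential_fderiv_field (hD : IsOpen D) (h : InvOn D K F) {X : V → V} {x v w : V}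
    (hx : x ∈ D) (hv : v ∈ K) (hX : ∀ t : ℝ, X (x + t • v) - (X x + t • w) ∈ K)
    (hd : DifferentiableAt ℝ (fun y => fderiv ℝ F y (X y)) x) :
    fderiv ℝ (fun y => fderiv ℝ F y (X y)) x v = fderiv ℝ F x w := by
  have h1 := hd.hasFDerivAt.hasLineDerivAt v
  refine h1.unique ?_
  unfold HasLineDerivAt
  have : (fun t : ℝ => fderiv ℝ F (x + t • v) (X (x + t • v)))
      = fun t => fderiv ℝ F x (X x) + t • fderiv ℝ F x w := by
    funext t
    rw [h.differential hD x hx _ (K.smul_mem t hv), h.differential_congr hx (hX t)]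
    simp
  rw [this]
  simpa using ((hasDerivAt_id (0 : ℝ)).smul_const (fderiv ℝ F x w)).const_add
    (fderiv ℝ F x (X x))

end Invariance

/-! ### Linear algebra of jet coordinates -/

section Coordinates

variable {n r s α β : ℕ}

theorem cmp_apply (h : α < r + 1) (v : JetCoord n r) : cmp n r α v = v ⟨α, h⟩ := by
  simp [cmp, h]

theorem cmp_eq_zero (h : r < α) : cmp n r α = 0 := by
  simp [cmp, show ¬ α < r + 1 by omega]

theorem jet_ext {v w : JetCoord n r} (h : ∀ α ≤ r, cmp n r α v = cmp n r α w) : v = w := by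
  funext ⟨a, ha⟩
  have := h a (by omega)
  rwa [cmp_apply ha, cmp_apply ha] at this

theorem cmp_ins_self (h : α ≤ r) (u : E n) : cmp n r α (ins n r α u) = u := by
  have h' : α < r + 1 := by omega
  rw [cmp_apply h']
  simp [ins, h']

theorem cmp_ins_ne (h : α ≠ β) (u : E n) : cmp n r α (ins n r β u) = 0 := by
  by_cases h1 : α < r + 1
  · rw [cmp_apply h1]
    by_cases h2 : β < r + 1
    · simp [ins, h2, h]
    · simp [ins, h2]
  · rw [cmp_eq_zero (by omega)]; rfl

theorem cmp_trunc (h : α ≤ s) (v : JetCoord n r) : cmp n s α (trunc n r s v) = cmp n r α v := by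
  rw [cmp_apply (by omega)]; rfl

theorem cmp_shift (h : α ≤ s) (v : JetCoord n r) :
    cmp n s α (shift n r s v) = cmp n r (α + 1) v := by
  rw [cmp_apply (by omega)]; rfl

theorem shift_ins (h : β + 1 ≤ r) (u : E n) :
    shift n r s (ins n r (β + 1) u) = ins n s β u := by
  refine jet_ext fun a ha => ?_
  rw [cmp_shift ha]
  by_cases hab : a = β
  · subst hab
    rw [cmp_ins_self h, cmp_ins_self ha]
  · rw [cmp_ins_ne (by omega), cmp_ins_ne hab]

theorem trunc_ins (h : β ≤ r) (u : E n) : trunc n r s (ins n r β u) = ins n s β u := by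
  refine jet_ext fun a ha => ?_
  rw [cmp_trunc ha]
  by_cases hab : a = β
  · subst hab
    rw [cmp_ins_self h, cmp_ins_self ha]
  · rw [cmp_ins_ne hab, cmp_ins_ne hab]

theorem sum_ins_cmp (v : JetCoord n r) :
    ∑ β ∈ Finset.range (r + 1), ins n r β (cmp n r β v) = v := by
  refine jet_ext fun a ha => ?_
  rw [map_sum, Finset.sum_eq_single_of_mem a (by simp; omega)]
  · rw [cmp_ins_self ha]
  · intro b _ hb
    rw [cmp_ins_ne hb.symm]

/-- Every jet of order `s` is the truncation of one of order `r ≥ s`. -/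
theorem trunc_trunc_of_le (h : s ≤ r) (v : JetCoord n s) : trunc n r s (trunc n s r v) = v :=
  jet_ext fun a ha => by rw [cmp_trunc ha, cmp_trunc (by omega)]

variable (n r s) in
/-- Jets whose components of order at most `s` vanish. -/
def jetKer : Submodule ℝ (JetCoord n r) where
  carrier := {v | ∀ α ≤ s, cmp n r α v = 0}
  add_mem' ha hb α hα := by rw [map_add, ha α hα, hb α hα, add_zero]
  zero_mem' α _ := map_zero _
  smul_mem' c v hv α hα := by rw [map_smul, hv α hα, smul_zero]

theorem jetKer_anti {s' : ℕ} (h : s ≤ s') : jetKer n r s' ≤ jetKer n r s :=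
  fun _ hv α hα => hv α (hα.trans h)

theorem ins_mem_jetKer (h : s < β) (u : E n) : ins n r β u ∈ jetKer n r s :=
  fun _ hα => cmp_ins_ne (by omega) u

theorem shift_mem_jetKer {v : JetCoord n r} (hv : v ∈ jetKer n r (s + 1)) :
    shift n r r v ∈ jetKer n r s := by
  intro α hα
  by_cases h : α ≤ r
  · rw [cmp_shift h, hv _ (by omega)]
  · rw [cmp_eq_zero (by omega)]; rfl

variable (n r s) in
/-- `jetKer`, for functions that depend on the action variable too. -/
def lagKer : Submodule ℝ (JetCoord n r × ℝ) := (jetKer n r s).prod ⊥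

theorem mem_lagKer {v : JetCoord n r × ℝ} :
    v ∈ lagKer n r s ↔ v.1 ∈ jetKer n r s ∧ v.2 = 0 := by
  simp [lagKer, Submodule.mem_prod]

theorem lagKer_anti {s' : ℕ} (h : s ≤ s') : lagKer n r s' ≤ lagKer n r s :=
  fun _ hv => mem_lagKer.2 ⟨jetKer_anti h (mem_lagKer.1 hv).1, (mem_lagKer.1 hv).2⟩

end Coordinates

end HOContact

end

noncomputable section

namespace HOContact

/-! ### Prolongation of maps to jets, in coordinates -/

section JetMap

variable {n r : ℕ}

theorem cmp_zero_apply (v : JetCoord n r) : cmp n r 0 v = v 0 := cmp_apply (by omega) v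

theorem trunc_zero {s : ℕ} (v : JetCoord n r) : trunc n r s v 0 = v 0 := by
  rw [← cmp_zero_apply (trunc n r s v), cmp_trunc (by omega), cmp_zero_apply]

theorem contDiffAt_iteratedDeriv {F : Type*} [NormedAddCommGroup F] [NormedSpace ℝ F] {t : ℝ}
    {m : ℕ∞} {a : ℕ} {g : ℝ → F} (h : ContDiffAt ℝ ((m + a : ℕ∞) : WithTop ℕ∞) g t) :
    ContDiffAt ℝ m (iteratedDeriv a g) t := by
  induction a generalizing g with
  | zero => simpa using h
  | succ a ih =>
    rw [iteratedDeriv_succ']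
    refine ih (ContDiffAt.derivWithin h ?_)
    push_cast
    rw [add_assoc]

/-- The total derivative of a function on `T^rQ` that does not depend on `q_r`, in coordinates. -/
def jetD {G : Type*} [NormedAddCommGroup G] [NormedSpace ℝ G] (F : JetCoord n r → G)
    (v : JetCoord n r) : G :=
  fderiv ℝ F v (shift n r r v)

/-- The `α`-th component of the prolongation of `φ : E n → E n` to jets. -/
def jetMap (r : ℕ) (φ : E n → E n) (α : ℕ) : JetCoord n r → E n :=
  jetD^[α] fun v => φ (v 0)

theorem jetMap_succ (φ : E n → E n) (α : ℕ) (v : JetCoord n r) :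
    jetMap r φ (α + 1) v = fderiv ℝ (jetMap r φ α) v (shift n r r v) := by
  unfold jetMap
  rw [Function.iterate_succ_apply']
  rfl

variable {O : Set (E n)} {φ : E n → E n}

theorem isOpen_jetDom (hO : IsOpen O) : IsOpen {v : JetCoord n r | v 0 ∈ O} :=
  hO.preimage (continuous_apply 0)

theorem contDiffOn_jetMap (hO : IsOpen O) (hφ : ContDiffOn ℝ ∞ φ O) (α : ℕ) :
    ContDiffOn ℝ ∞ (jetMap r φ α) {v | v 0 ∈ O} := by
  induction α with
  | zero => exact hφ.comp (contDiff_apply ℝ (E n) (0 : Fin (r + 1))).contDiffOn (fun v hv => hv)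
  | succ α ih =>
    have h1 := ih.fderiv_of_isOpen (m := ∞) (isOpen_jetDom hO) le_rfl
    exact (h1.clm_apply (shift n r r).contDiff.contDiffOn).congr fun v _ => jetMap_succ φ α v

/-- Each total derivative brings in one more variable, so `jetMap r φ α` depends on
$q_0,\dots,q_\alpha$ only. -/
theorem invOn_jetMap (hO : IsOpen O) (α : ℕ) :
    InvOn {v : JetCoord n r | v 0 ∈ O} (jetKer n r α) (jetMap r φ α) := by
  induction α with
  | zero =>
    intro x hx v hv
    have : v 0 = 0 := (cmp_zero_apply v).symm.trans (hv 0 le_rfl)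
    simp [jetMap, this]
  | succ α ih =>
    have := ih.differential_field (isOpen_jetDom hO) (K' := jetKer n r (α + 1))
      (X := shift n r r) (jetKer_anti (by omega)) (by
        intro x hx v hv
        rw [map_add, add_sub_cancel_left]
        exact shift_mem_jetKer hv)
    intro x hx v hv
    rw [jetMap_succ, jetMap_succ]
    exact this x hx v hv

/-- This is the higher-order chain rule without explicit formulas: differentiating along a curve of
jets is applying the total derivative. -/
theorem jetMap_curve (hO : IsOpen O) (hφ : ContDiffOn ℝ ∞ φ O) {J : Set ℝ} (hJ : IsOpen J)
    {g : ℝ → E n} (hg : ContDiffOn ℝ ((r + 1 : ℕ) : WithTop ℕ∞) g J) (hgO : ∀ t ∈ J, g t ∈ O)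
    {α : ℕ} (hα : α ≤ r) : ∀ t ∈ J, iteratedDeriv α (φ ∘ g) t
      = jetMap r φ α (fun β => iteratedDeriv β g t) := by
  induction α with
  | zero =>
    intro t _
    simp [jetMap]
  | succ α ih =>
    intro t ht
    have h0 : iteratedDeriv α (φ ∘ g) =ᶠ[𝓝 t]
        fun s => jetMap r φ α (fun β => iteratedDeriv β g s) := by
      filter_upwards [hJ.mem_nhds ht] with s hs using ih (by omega) s hs
    have hd : HasDerivAt (fun s => fun β : Fin (r + 1) => iteratedDeriv β g s)
        (fun β : Fin (r + 1) => iteratedDeriv (β + 1) g t) t := by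
      refine hasDerivAt_pi.2 fun β => ?_
      rw [iteratedDeriv_succ]
      refine DifferentiableAt.hasDerivAt ?_
      have h2 : ContDiffAt ℝ ((1 + (β : ℕ) : ℕ∞) : WithTop ℕ∞) g t := by
        refine (hg.contDiffAt (hJ.mem_nhds ht)).of_le ?_
        have : 1 + (β : ℕ) ≤ r + 1 := by omega
        exact_mod_cast this
      exact (contDiffAt_iteratedDeriv h2).differentiableAt (by simp)
    have hv : (fun β : Fin (r + 1) => iteratedDeriv β g t) ∈ {v : JetCoord n r | v 0 ∈ O} := by
      simpa using hgO t ht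
    have hF : DifferentiableAt ℝ (jetMap r φ α) (fun β : Fin (r + 1) => iteratedDeriv β g t) :=
      ((contDiffOn_jetMap hO hφ α).contDiffAt ((isOpen_jetDom hO).mem_nhds hv)).differentiableAt
        (by simp)
    rw [iteratedDeriv_succ, h0.deriv_eq, jetMap_succ]
    refine (hF.hasFDerivAt.comp_hasDerivAt t hd).deriv.trans ?_
    -- The velocity of the jet curve and `shift` can differ only in the top component, where `shift`
    -- puts zero; since `α < r`, `jetMap r φ α` does not see it.
    refine (invOn_jetMap hO α).differential_congr hv fun β hβ => ?_
    rw [map_sub, cmp_shift (by omega), cmp_apply (by omega), cmp_apply (by omega)]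
    simp

/-- The polynomial curve with prescribed derivatives at `0`. -/
def jetPoly (v : JetCoord n r) (t : ℝ) : E n :=
  ∑ α : Fin (r + 1), (t ^ (α : ℕ) / (Nat.factorial α : ℝ)) • v α

theorem contDiff_jetPoly (v : JetCoord n r) : ContDiff ℝ ∞ (jetPoly v) := by
  unfold jetPoly
  fun_prop

theorem iteratedDeriv_jetPoly (v : JetCoord n r) (β : Fin (r + 1)) :
    iteratedDeriv β (jetPoly v) 0 = v β := by
  unfold jetPoly
  rw [iteratedDeriv_fun_sum (fun i _ => by fun_prop), Finset.sum_eq_single β]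
  · rw [iteratedDeriv_smul_const (by fun_prop), iteratedDeriv_div_const,
      iteratedDeriv_fun_pow_zero]
    simp [Nat.factorial_ne_zero]
  · intro b _ hb
    rw [iteratedDeriv_smul_const (by fun_prop), iteratedDeriv_div_const,
      iteratedDeriv_fun_pow_zero, if_neg (by
        intro h; exact hb (Fin.ext h.symm))]
    simp
  · simp

theorem jetPoly_zero (v : JetCoord n r) : jetPoly v 0 = v 0 := by
  simpa using iteratedDeriv_jetPoly v 0

end JetMap

/-! ### Natural charts of the jet spaces and their transitions -/

section Jets

section Overlap

variable {n : ℕ} {Q : Type*} [TopologicalSpace Q] {e e' : OpenPartialHomeomorph Q (E n)}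

/-- The overlap of two charts, seen in the first one. -/
def overlap (e e' : OpenPartialHomeomorph Q (E n)) : Set (E n) := (e.symm.trans e').source

theorem mem_overlap {u : E n} : u ∈ overlap e e' ↔ u ∈ e.target ∧ e.symm u ∈ e'.source := by
  simp [overlap]

theorem isOpen_overlap : IsOpen (overlap e e') := (e.symm.trans e').open_source

theorem overlap_subset : overlap e e' ⊆ e.target := fun _ hu => (mem_overlap.1 hu).1

end Overlap

variable {n r : ℕ} {Q : Type*} [TopologicalSpace Q] [ChartedSpace (E n) Q]
  {e e' : OpenPartialHomeomorph Q (E n)}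

theorem contDiffAt_chart_comp (he : e ∈ charts n Q) {c : ℝ → Q} {t : ℝ}
    (hc : ContMDiffAt 𝓘(ℝ, ℝ) 𝓘(ℝ, E n) ∞ c t) (ht : c t ∈ e.source) :
    ContDiffAt ℝ ∞ (e ∘ c) t :=
  contMDiffAt_iff_contDiffAt.1 ((contMDiffAt_of_mem_maximalAtlas he ht).comp t hc)

theorem contMDiffAt_of_chart_comp (he : e ∈ charts n Q) {c : ℝ → Q} {t : ℝ}
    (hc : ContinuousAt c t) (ht : c t ∈ e.source) (h : ContDiffAt ℝ ∞ (e ∘ c) t) :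
    ContMDiffAt 𝓘(ℝ, ℝ) 𝓘(ℝ, E n) ∞ c t := by
  have h1 := (contMDiffAt_symm_of_mem_maximalAtlas he (e.map_source ht)).comp t
    (contMDiffAt_iff_contDiffAt.2 h)
  refine h1.congr_of_eventuallyEq ?_
  filter_upwards [hc.preimage_mem_nhds (e.open_source.mem_nhds ht)] with s hs
  exact (e.left_inv hs).symm

theorem contDiffOn_transition (he : e ∈ charts n Q) (he' : e' ∈ charts n Q) :
    ContDiffOn ℝ ∞ (e' ∘ e.symm) (overlap e e') := by
  intro u hu
  rw [mem_overlap] at hu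
  exact (contMDiffAt_iff_contDiffAt.1 ((contMDiffAt_of_mem_maximalAtlas he' hu.2).comp u
    (contMDiffAt_symm_of_mem_maximalAtlas he hu.1))).contDiffWithinAt

namespace Jet

theorem base_mk (γ : Germ n Q) : base (Quotient.mk (jetSetoid n Q r) γ) = γ.1 0 := rfl

/-- `coord` is read off a chosen representative; equality of jets makes the choice harmless for
charts around the base point. -/
theorem coord_mk (he : e ∈ charts n Q) (γ : Germ n Q) (h : γ.1 0 ∈ e.source) (α : Fin (r + 1)) :
    coord e (Quotient.mk (jetSetoid n Q r) γ) α = iteratedDeriv α (e ∘ γ.1) 0 := by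
  have h1 := Quotient.mk_out (s := jetSetoid n Q r) γ
  exact h1.2 e he (by rw [h1.1]; exact h) α (by omega)

theorem contMDiffAt_shift {c : ℝ → Q} {t : ℝ} (hc : ContMDiffAt 𝓘(ℝ, ℝ) 𝓘(ℝ, E n) ∞ c t) :
    ContMDiffAt 𝓘(ℝ, ℝ) 𝓘(ℝ, E n) ∞ (fun s => c (s + t)) 0 := by
  have h : ContMDiffAt 𝓘(ℝ, ℝ) 𝓘(ℝ, ℝ) ∞ (fun s : ℝ => s + t) 0 := by
    rw [contMDiffAt_iff_contDiffAt]; fun_prop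
  exact ContMDiffAt.comp (0 : ℝ) (by simpa using hc) h

theorem jetAt_eq {c : ℝ → Q} {t : ℝ} (hc : ContMDiffAt 𝓘(ℝ, ℝ) 𝓘(ℝ, E n) ∞ c t) :
    jetAt r c t = Quotient.mk (jetSetoid n Q r) ⟨fun s => c (s + t), contMDiffAt_shift hc⟩ :=
  dif_pos (contMDiffAt_shift hc)

theorem base_jetAt (c : ℝ → Q) (t : ℝ) : (jetAt r c t : Jet n Q r).base = c t := by
  by_cases h : ContMDiffAt 𝓘(ℝ, ℝ) 𝓘(ℝ, E n) ∞ (fun s => c (s + t)) 0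
  · have : jetAt r c t = Quotient.mk (jetSetoid n Q r) ⟨fun s => c (s + t), h⟩ := dif_pos h
    rw [this]
    exact congrArg c (zero_add t)
  · have : jetAt r c t = Quotient.mk (jetSetoid n Q r) ⟨fun _ => c t, contMDiffAt_const⟩ :=
      dif_neg h
    rw [this]
    rfl

theorem coord_jetAt (he : e ∈ charts n Q) {c : ℝ → Q} {t : ℝ}
    (hc : ContMDiffAt 𝓘(ℝ, ℝ) 𝓘(ℝ, E n) ∞ c t) (ht : c t ∈ e.source) (α : Fin (r + 1)) :
    coord e (jetAt r c t) α = iteratedDeriv α (e ∘ c) t := by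
  rw [jetAt_eq hc]
  refine (coord_mk he _ (by simpa using ht) α).trans ?_
  have := iteratedDeriv_comp_add_const (α : ℕ) (e ∘ c) t
  have h2 := congrFun this 0
  simpa [Function.comp_def] using h2

theorem coord_transition (he : e ∈ charts n Q) (he' : e' ∈ charts n Q) (x : Jet n Q r)
    (h : x.base ∈ e.source) (h' : x.base ∈ e'.source) (α : Fin (r + 1)) :
    coord e' x α = jetMap r (e' ∘ e.symm) α (coord e x) := by
  induction x using Quotient.inductionOn with | _ γ
  rw [base_mk] at h h'
  have hco : coord e (Quotient.mk (jetSetoid n Q r) γ) =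
      fun β : Fin (r + 1) => iteratedDeriv β (e ∘ γ.1) 0 :=
    funext fun β => coord_mk he γ h β
  rw [coord_mk he' γ h', hco]
  have hs := contDiffAt_chart_comp he γ.2 h
  -- Smoothness at a single point gives no common neighbourhood for all orders; a finite order does
  -- persist nearby, and `r + 1` is what `jetMap_curve` needs.
  have hs' : ContDiffAt ℝ ((r + 1 : ℕ) : WithTop ℕ∞) (e ∘ γ.1) 0 := hs.of_le (by exact_mod_cast le_top)
  have hc : ContinuousAt γ.1 0 := γ.2.continuousAt
  have hov : (e ∘ γ.1) 0 ∈ overlap e e' :=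
    mem_overlap.2 ⟨e.map_source h, by simpa [e.left_inv h] using h'⟩
  have hev : ∀ᶠ t in 𝓝 (0 : ℝ), ContDiffAt ℝ ((r + 1 : ℕ) : WithTop ℕ∞) (e ∘ γ.1) t ∧
      (e ∘ γ.1) t ∈ overlap e e' :=
    (hs'.eventually (by simp)).and (hs'.continuousAt.eventually (isOpen_overlap.mem_nhds hov))
  obtain ⟨J, hJ, hJo, h0⟩ := eventually_nhds_iff.1 hev
  have key := jetMap_curve (r := r) isOpen_overlap (contDiffOn_transition he he') hJo
    (fun t ht => (hJ t ht).1.contDiffWithinAt) (fun t ht => (hJ t ht).2)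
    (α := α) (by omega) 0 h0
  rw [← key]
  apply Filter.EventuallyEq.iteratedDeriv_eq
  filter_upwards [hc.preimage_mem_nhds (e.open_source.mem_nhds h)] with t ht
  simp [e.left_inv ht]

theorem base_eq (x : Jet n Q r) (h : x.base ∈ e.source) : e.symm (coord e x 0) = x.base := by
  induction x using Quotient.inductionOn with | _ γ
  have h1 := Quotient.mk_out (s := jetSetoid n Q r) γ
  simp only [coord, Fin.val_zero, iteratedDeriv_zero, Function.comp_apply]
  rw [h1.1]
  exact e.left_inv h

theorem coord_zero (x : Jet n Q r) : coord e x 0 = e x.base := by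
  induction x using Quotient.inductionOn with | _ γ
  have h1 := Quotient.mk_out (s := jetSetoid n Q r) γ
  simp only [coord, Fin.val_zero, iteratedDeriv_zero, Function.comp_apply]
  rw [h1.1]; rfl

/-- Equality of jets asks for agreement in every chart around the base point, and the coordinates in
`e` determine those in any other chart by `coord_transition`. -/
theorem coord_injective (he : e ∈ charts n Q) {x y : Jet n Q r} (hx : x.base ∈ e.source)
    (hy : y.base ∈ e.source) (h : coord e x = coord e y) : x = y := by
  have hb : x.base = y.base := by rw [← base_eq x hx, ← base_eq y hy, h]
  induction x using Quotient.inductionOn with | _ γ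
  induction y using Quotient.inductionOn with | _ δ
  refine Quotient.sound ⟨hb, fun e' he' hs α hα => ?_⟩
  have h1 := coord_mk (r := r) he' γ hs ⟨α, by omega⟩
  have h2 := coord_mk (r := r) he' δ (by rw [base_mk, base_mk] at hb; rwa [← hb]) ⟨α, by omega⟩
  simp only at h1 h2
  rw [← h1, ← h2, coord_transition he he' _ hx hs, coord_transition he he' _ hy (hb ▸ hs), h]

theorem contMDiffAt_ofCoord (he : e ∈ charts n Q) {v : JetCoord n r} (hv : v 0 ∈ e.target) :
    ContMDiffAt 𝓘(ℝ, ℝ) 𝓘(ℝ, E n) ∞ (fun t => e.symm (jetPoly v t)) 0 := by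
  have h : ContMDiffAt 𝓘(ℝ, ℝ) 𝓘(ℝ, E n) ∞ (jetPoly v) 0 :=
    contMDiffAt_iff_contDiffAt.2 (contDiff_jetPoly v).contDiffAt
  exact ContMDiffAt.comp (0 : ℝ)
    (contMDiffAt_symm_of_mem_maximalAtlas he (by rwa [jetPoly_zero])) h

theorem base_ofCoord (v : JetCoord n r) : (ofCoord e v : Jet n Q r).base = e.symm (v 0) := by
  unfold ofCoord
  rw [base_jetAt]
  exact congrArg e.symm (jetPoly_zero v)

theorem base_ofCoord_mem {v : JetCoord n r} (hv : v 0 ∈ e.target) :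
    (ofCoord e v : Jet n Q r).base ∈ e.source := by
  rw [base_ofCoord]; exact e.map_target hv

theorem coord_ofCoord (he : e ∈ charts n Q) {v : JetCoord n r} (hv : v 0 ∈ e.target) :
    coord e (ofCoord e v : Jet n Q r) = v := by
  funext α
  have h := coord_jetAt (r := r) he (contMDiffAt_ofCoord he hv)
    (by rw [jetPoly_zero]; exact e.map_target hv) α
  refine h.trans ?_
  rw [← iteratedDeriv_jetPoly v α]
  apply Filter.EventuallyEq.iteratedDeriv_eq
  have hc : ContinuousAt (jetPoly v) 0 := (contDiff_jetPoly v).continuous.continuousAt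
  filter_upwards [hc.preimage_mem_nhds (e.open_target.mem_nhds (by rwa [jetPoly_zero]))] with t ht
  exact e.right_inv ht

theorem ofCoord_coord (he : e ∈ charts n Q) {x : Jet n Q r} (hx : x.base ∈ e.source) :
    ofCoord e (coord e x) = x := by
  have h0 : coord e x 0 ∈ e.target := by rw [coord_zero]; exact e.map_source hx
  exact coord_injective he (base_ofCoord_mem h0) hx (coord_ofCoord he h0)

theorem base_proj (s : ℕ) (x : Jet n Q r) : (x.proj s).base = x.base := by
  conv_rhs => rw [← Quotient.out_eq (s := jetSetoid n Q r) x]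
  rfl

theorem coord_proj (he : e ∈ charts n Q) {s : ℕ} (hs : s ≤ r) (x : Jet n Q r)
    (hx : x.base ∈ e.source) : coord e (x.proj s) = trunc n r s (coord e x) := by
  have hx' : (Quotient.out x : Germ n Q).1 0 ∈ e.source := by
    rw [← base_proj s x] at hx; exact hx
  refine jet_ext fun a ha => ?_
  rw [cmp_trunc ha, cmp_apply (by omega), cmp_apply (by omega)]
  exact coord_mk he _ hx' ⟨a, by omega⟩

/-- The change of natural coordinates. -/
def trans (e e' : OpenPartialHomeomorph Q (E n)) (r : ℕ) (v : JetCoord n r) : JetCoord n r :=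
  coord e' (ofCoord e v : Jet n Q r)

theorem trans_coord (he : e ∈ charts n Q) {x : Jet n Q r}
    (hx : x.base ∈ e.source) : trans e e' r (coord e x) = coord e' x := by
  rw [trans, ofCoord_coord he hx]

theorem cmp_trans (he : e ∈ charts n Q) (he' : e' ∈ charts n Q) {v : JetCoord n r}
    (hv : v 0 ∈ overlap e e') {α : ℕ} (hα : α ≤ r) :
    cmp n r α (trans e e' r v) = jetMap r (e' ∘ e.symm) α v := by
  rw [mem_overlap] at hv
  rw [cmp_apply (by omega)]
  have := coord_transition he he' (ofCoord e v : Jet n Q r) (base_ofCoord_mem hv.1)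
    (by rw [base_ofCoord]; exact hv.2) ⟨α, by omega⟩
  rwa [coord_ofCoord he hv.1] at this

theorem contDiffOn_trans (he : e ∈ charts n Q) (he' : e' ∈ charts n Q) :
    ContDiffOn ℝ ∞ (trans e e' r) {v | v 0 ∈ overlap e e'} := by
  refine contDiffOn_pi.2 fun α => ?_
  refine (contDiffOn_jetMap isOpen_overlap (contDiffOn_transition he he') α).congr fun v hv => ?_
  rw [← cmp_trans he he' hv (by omega), cmp_apply (by omega)]

theorem trans_zero (v : JetCoord n r) : trans e e' r v 0 = e' (e.symm (v 0)) := by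
  rw [trans, coord_zero, base_ofCoord]

theorem trans_zero_mem {v : JetCoord n r} (hv : v 0 ∈ overlap e e') :
    trans e e' r v 0 ∈ overlap e' e := by
  rw [mem_overlap] at *
  rw [trans_zero, e'.left_inv hv.2]
  exact ⟨e'.map_source hv.2, e.map_target hv.1⟩

theorem trans_trans (he : e ∈ charts n Q) (he' : e' ∈ charts n Q) {v : JetCoord n r}
    (hv : v 0 ∈ overlap e e') : trans e' e r (trans e e' r v) = v := by
  rw [mem_overlap] at hv
  unfold trans
  rw [ofCoord_coord he' (by rw [base_ofCoord]; exact hv.2), coord_ofCoord he hv.1]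

theorem proj_ofCoord (he : e ∈ charts n Q) {s : ℕ} (hs : s ≤ r) {v : JetCoord n r}
    (hv : v 0 ∈ e.target) : (ofCoord e v : Jet n Q r).proj s = ofCoord e (trunc n r s v) := by
  have h0 : (trunc n r s v) 0 = v 0 := trunc_zero v
  have hb := base_ofCoord_mem (e := e) hv
  refine coord_injective he (by rwa [base_proj]) (base_ofCoord_mem (by rwa [h0])) ?_
  rw [coord_proj he hs _ hb, coord_ofCoord he hv, coord_ofCoord he (by rwa [h0])]

theorem trunc_trans (he : e ∈ charts n Q) (he' : e' ∈ charts n Q) {s : ℕ} (hs : s ≤ r)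
    {v : JetCoord n r} (hv : v 0 ∈ overlap e e') :
    trunc n r s (trans e e' r v) = trans e e' s (trunc n r s v) := by
  rw [mem_overlap] at hv
  unfold trans
  rw [← proj_ofCoord he hs hv.1, coord_proj he' hs _ (by rw [base_ofCoord]; exact hv.2)]

end Jet

end Jets

end HOContact

end

noncomputable section

namespace HOContact

/-! ### Jacobi–Ostrogradskii momenta of a local Lagrangian -/

section LocalLagrangian

variable {n k : ℕ}

/-- Natural coordinates of `T^{2k-1}Q × ℝ` over the subset `O` of a chart of `Q`. -/
def lagDom (k : ℕ) (O : Set (E n)) : Set (LagCoord n k) := {x | x.1 0 ∈ O}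

/-- `ℓ` is the expression over `O` of a smooth Lagrangian of order `k`. -/
structure IsLocalLagrangian (O : Set (E n)) (ℓ : LagCoord n k → ℝ) : Prop where
  isOpen : IsOpen O
  smooth : ContDiffOn ℝ ∞ ℓ (lagDom k O)
  inv : InvOn (lagDom k O) (lagKer n (2 * k - 1) k) ℓ

variable {O : Set (E n)} {ℓ : LagCoord n k → ℝ} {G : Type*} [NormedAddCommGroup G]
  [NormedSpace ℝ G] {F : LagCoord n k → G}

theorem isOpen_lagDom (hO : IsOpen O) : IsOpen (lagDom k O) :=
  hO.preimage ((continuous_apply 0).comp continuous_fst)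

theorem add_mem_lagDom {s : ℕ} {x v : LagCoord n k} (hx : x ∈ lagDom k O)
    (hv : v ∈ lagKer n (2 * k - 1) s) : x + v ∈ lagDom k O := by
  have : v.1 0 = 0 := (cmp_zero_apply v.1).symm.trans ((mem_lagKer.1 hv).1 0 (by omega))
  simpa [lagDom, this] using hx

/-- The velocity `(q_1, …, q_{2k-1}, 0; ℓ)` of a holonomic curve with `dz/dt = ℓ`, up to its
component along `q_{2k-1}`. -/
def field (ℓ : LagCoord n k → ℝ) (x : LagCoord n k) : LagCoord n k :=
  (shift n (2 * k - 1) (2 * k - 1) x.1, ℓ x)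

theorem totalD_eq (F : LagCoord n k → G) (x : LagCoord n k) :
    totalD ℓ F x = fderiv ℝ F x (field ℓ x) - dLdz ℓ x • F x := rfl

theorem fderiv_apply_field (F : LagCoord n k → G) (x : LagCoord n k) :
    fderiv ℝ F x (field ℓ x) = totalD ℓ F x + dLdz ℓ x • F x := by
  rw [totalD_eq, sub_add_cancel]

theorem totalD_congr (hO : IsOpen O) {F F' : LagCoord n k → G} (h : Set.EqOn F F' (lagDom k O)) :
    Set.EqOn (totalD ℓ F) (totalD ℓ F') (lagDom k O) := by
  intro x hx
  have : F =ᶠ[𝓝 x] F' := by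
    filter_upwards [(isOpen_lagDom hO).mem_nhds hx] with y hy using h hy
  rw [totalD_eq, totalD_eq, this.fderiv_eq, h hx]

theorem momentum_last (hk : 1 ≤ k) : momentum ℓ (k - 1) = dLdq ℓ k := by
  funext x
  unfold momentum
  rw [show k - (k - 1) = 1 by omega]
  simp [show k - 1 + 1 = k by omega]

namespace IsLocalLagrangian

variable (hℓ : IsLocalLagrangian O ℓ)
include hℓ

theorem isOpen_dom : IsOpen (lagDom k O) := isOpen_lagDom hℓ.isOpen

theorem smooth_fderiv {F : LagCoord n k → G} (hF : ContDiffOn ℝ ∞ F (lagDom k O)) :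
    ContDiffOn ℝ ∞ (fderiv ℝ F) (lagDom k O) :=
  hF.fderiv_of_isOpen hℓ.isOpen_dom le_rfl

theorem differentiableAt {F : LagCoord n k → G} (hF : ContDiffOn ℝ ∞ F (lagDom k O))
    {x : LagCoord n k} (hx : x ∈ lagDom k O) : DifferentiableAt ℝ F x :=
  (hF.contDiffAt (hℓ.isOpen_dom.mem_nhds hx)).differentiableAt (by simp)

theorem smooth_dLdq (α : ℕ) : ContDiffOn ℝ ∞ (dLdq ℓ α) (lagDom k O) :=
  (hℓ.smooth_fderiv hℓ.smooth).clm_comp contDiffOn_const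

theorem smooth_dLdz : ContDiffOn ℝ ∞ (dLdz ℓ) (lagDom k O) :=
  (hℓ.smooth_fderiv hℓ.smooth).clm_apply contDiffOn_const

theorem inv_dLdq (α : ℕ) : InvOn (lagDom k O) (lagKer n (2 * k - 1) k) (dLdq ℓ α) :=
  fun x hx v hv => by unfold dLdq; rw [hℓ.inv.differential hℓ.isOpen_dom x hx v hv]

theorem inv_dLdz : InvOn (lagDom k O) (lagKer n (2 * k - 1) k) (dLdz ℓ) :=
  fun x hx v hv => by unfold dLdz; rw [hℓ.inv.differential hℓ.isOpen_dom x hx v hv]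

theorem smooth_field : ContDiffOn ℝ ∞ (field ℓ) (lagDom k O) :=
  ((shift n _ _).contDiff.comp contDiff_fst).contDiffOn.prodMk hℓ.smooth

theorem smooth_fderiv_field (hF : ContDiffOn ℝ ∞ F (lagDom k O)) :
    ContDiffOn ℝ ∞ (fun x => fderiv ℝ F x (field ℓ x)) (lagDom k O) :=
  (hℓ.smooth_fderiv hF).clm_apply hℓ.smooth_field

theorem smooth_totalD (hF : ContDiffOn ℝ ∞ F (lagDom k O)) :
    ContDiffOn ℝ ∞ (totalD ℓ F) (lagDom k O) :=
  (hℓ.smooth_fderiv_field hF).sub (hℓ.smooth_dLdz.smul hF)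

theorem field_add {s : ℕ} (hs : k ≤ s) {x v : LagCoord n k} (hx : x ∈ lagDom k O)
    (hv : v ∈ lagKer n (2 * k - 1) s) :
    field ℓ (x + v) = field ℓ x + (shift n (2 * k - 1) (2 * k - 1) v.1, 0) := by
  simp [field, hℓ.inv x hx v (lagKer_anti hs hv)]

/-- $D_L$ raises the order by one: since $L$ has order $k\le s$, a vector of `lagKer` at `s + 1`
changes `field ℓ` only by its shift, which lies in `lagKer` at `s`. -/
theorem inv_totalD {s : ℕ} (hs : k ≤ s) (hF : InvOn (lagDom k O) (lagKer n (2 * k - 1) s) F) :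
    InvOn (lagDom k O) (lagKer n (2 * k - 1) (s + 1)) (totalD ℓ F) := by
  have h1 := hF.differential_field hℓ.isOpen_dom (K' := lagKer n (2 * k - 1) (s + 1))
    (X := field ℓ) (lagKer_anti (by omega)) (by
      intro x hx v hv
      rw [hℓ.field_add (by omega) hx hv, add_sub_cancel_left]
      exact mem_lagKer.2 ⟨shift_mem_jetKer (mem_lagKer.1 hv).1, rfl⟩)
  intro x hx v hv
  rw [totalD_eq, totalD_eq, hℓ.inv_dLdz x hx v (lagKer_anti (by omega) hv),
    hF x hx v (lagKer_anti (by omega) hv)]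
  congr 1
  exact h1 x hx v hv

/-- For `F` of order `s` this is $\partial(D_LF)/\partial q_{s+1}=\partial F/\partial q_s$: the
other contributions to $D_LF$ have order at most `s`. -/
theorem fderiv_totalD {s : ℕ} (hs : k ≤ s) (hF : InvOn (lagDom k O) (lagKer n (2 * k - 1) s) F)
    (hsm : ContDiffOn ℝ ∞ F (lagDom k O)) {x v : LagCoord n k} (hx : x ∈ lagDom k O)
    (hv : v ∈ lagKer n (2 * k - 1) s) :
    fderiv ℝ (totalD ℓ F) x v = fderiv ℝ F x (shift n (2 * k - 1) (2 * k - 1) v.1, 0) := by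
  have hd1 := hℓ.differentiableAt (hℓ.smooth_fderiv_field hsm) hx
  have hd2 := hℓ.differentiableAt (hℓ.smooth_dLdz.smul hsm) hx
  have h1 := hF.differential_fderiv_field hℓ.isOpen_dom (X := field ℓ) hx hv
    (w := (shift n (2 * k - 1) (2 * k - 1) v.1, 0)) (by
      intro t
      rw [hℓ.field_add hs hx (Submodule.smul_mem _ t hv)]
      simp) hd1
  have h2 : InvOn (lagDom k O) (lagKer n (2 * k - 1) s) (dLdz ℓ • F) := by
    intro y hy w hw
    simp only [Pi.smul_apply', hℓ.inv_dLdz y hy w (lagKer_anti hs hw), hF y hy w hw]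
  have h3 : totalD ℓ F = (fun y => fderiv ℝ F y (field ℓ y)) - dLdz ℓ • F := rfl
  rw [h3, fderiv_sub hd1 hd2, sub_apply, h1, h2.differential_apply hx hv,
    sub_zero]

theorem smooth_iterate_totalD (hF : ContDiffOn ℝ ∞ F (lagDom k O)) (a : ℕ) :
    ContDiffOn ℝ ∞ ((totalD ℓ)^[a] F) (lagDom k O) := by
  induction a with
  | zero => exact hF
  | succ a ih =>
    rw [Function.iterate_succ_apply']
    exact hℓ.smooth_totalD ih

theorem smooth_momentum (r : ℕ) : ContDiffOn ℝ ∞ (momentum ℓ r) (lagDom k O) :=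
  ContDiffOn.sum fun a _ =>
    (hℓ.smooth_iterate_totalD (hℓ.smooth_dLdq (r + 1 + a)) a).const_smul _

/-- The recursion `p̂^r = ∂ℓ/∂q_{r+1} - D_L p̂^{r+1}`. -/
theorem momentum_eq {r : ℕ} (hr : r < k) {x : LagCoord n k} (hx : x ∈ lagDom k O) :
    momentum ℓ r x = dLdq ℓ (r + 1) x - totalD ℓ (momentum ℓ (r + 1)) x := by
  have hd : ∀ a, DifferentiableAt ℝ ((totalD ℓ)^[a] (dLdq ℓ (r + 1 + 1 + a))) x := fun a =>
    hℓ.differentiableAt (hℓ.smooth_iterate_totalD (hℓ.smooth_dLdq _) a) hx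
  have h1 : totalD ℓ (momentum ℓ (r + 1)) x = ∑ a ∈ Finset.range (k - (r + 1)),
      (-1 : ℝ) ^ a • totalD ℓ ((totalD ℓ)^[a] (dLdq ℓ (r + 1 + 1 + a))) x := by
    have h2 : momentum ℓ (r + 1) = fun y => ∑ a ∈ Finset.range (k - (r + 1)),
        (-1 : ℝ) ^ a • (totalD ℓ)^[a] (dLdq ℓ (r + 1 + 1 + a)) y := rfl
    rw [totalD_eq, h2, fderiv_fun_sum (fun a _ => (hd a).fun_const_smul _),
      sum_apply, Finset.smul_sum, ← Finset.sum_sub_distrib]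
    refine Finset.sum_congr rfl fun a _ => ?_
    rw [fderiv_fun_const_smul (hd a), totalD_eq, smul_sub, smul_comm (dLdz ℓ x)]
    rfl
  rw [h1]
  unfold momentum
  rw [show k - r = (k - (r + 1)) + 1 by omega, Finset.sum_range_succ', sub_eq_add_neg, add_comm,
    ← Finset.sum_neg_distrib]
  congr 1
  · simp
  · refine Finset.sum_congr rfl fun a _ => ?_
    rw [Function.iterate_succ_apply', show r + 1 + (a + 1) = r + 1 + 1 + a by omega, pow_succ,
      mul_neg_one]
    exact neg_smul ((-1 : ℝ) ^ a) (_ : E n →L[ℝ] ℝ)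

/-- Going down from $\hat p^{\,k-1}=\partial L/\partial q_k$, of order $k$, each step of the
recursion `momentum_eq` applies $D_L$ once and costs one order. -/
theorem inv_momentum {j : ℕ} (hj : j < k) :
    InvOn (lagDom k O) (lagKer n (2 * k - 1) (k + j)) (momentum ℓ (k - 1 - j)) := by
  induction j with
  | zero =>
    rw [Nat.sub_zero, momentum_last (by omega)]
    exact hℓ.inv_dLdq k
  | succ j ih =>
    have h1 := hℓ.inv_totalD (by omega) (ih (by omega))
    intro x hx v hv
    rw [hℓ.momentum_eq (by omega) hx, hℓ.momentum_eq (by omega) (add_mem_lagDom hx hv),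
      hℓ.inv_dLdq _ x hx v (lagKer_anti (by omega) hv),
      show k - 1 - (j + 1) + 1 = k - 1 - j by omega, h1 x hx v hv]

/-- The derivative of `p̂^r` with respect to `q_{2k-1-r}` is, up to sign, the Hessian of `ℓ`. -/
theorem fderiv_momentum_top {j : ℕ} (hj : j < k) {x v : LagCoord n k} (hx : x ∈ lagDom k O)
    (hv : v ∈ lagKer n (2 * k - 1) (k + j - 1)) :
    fderiv ℝ (momentum ℓ (k - 1 - j)) x v = (-1 : ℝ) ^ j •
      fderiv ℝ (dLdq ℓ k) x (ins n (2 * k - 1) k (cmp n (2 * k - 1) (k + j) v.1), 0) := by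
  induction j generalizing v with
  | zero =>
    rw [Nat.sub_zero, momentum_last (by omega), pow_zero, one_smul]
    refine (hℓ.inv_dLdq k).differential_congr hx (mem_lagKer.2 ⟨fun a ha => ?_, ?_⟩)
    · rw [Prod.fst_sub, map_sub]
      rcases Nat.lt_or_ge a k with h | h
      · rw [(mem_lagKer.1 hv).1 a (by omega), cmp_ins_ne (by omega), sub_zero]
      · have h' : a = k := by omega
        rw [h', cmp_ins_self (by omega)]
        exact sub_self _
    · simp [(mem_lagKer.1 hv).2]
  | succ j ih =>
    have h0 : momentum ℓ (k - 1 - (j + 1)) =ᶠ[𝓝 x]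
        dLdq ℓ (k - 1 - j) - totalD ℓ (momentum ℓ (k - 1 - j)) := by
      filter_upwards [hℓ.isOpen_dom.mem_nhds hx] with y hy
      rw [hℓ.momentum_eq (by omega) hy, show k - 1 - (j + 1) + 1 = k - 1 - j by omega]
      rfl
    have hv' : v ∈ lagKer n (2 * k - 1) (k + j) := hv
    -- The term $\partial L/\partial q$ has order $k$ and does not see `v`; `fderiv_totalD` replaces
    -- `v` by its shift in the other term, and the induction hypothesis applies with one more sign.
    rw [h0.fderiv_eq, fderiv_sub (hℓ.differentiableAt (hℓ.smooth_dLdq _) hx)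
      (hℓ.differentiableAt (hℓ.smooth_totalD (hℓ.smooth_momentum _)) hx),
      sub_apply,
      (hℓ.inv_dLdq _).differential_apply hx (lagKer_anti (by omega) hv'),
      hℓ.fderiv_totalD (by omega) (hℓ.inv_momentum (by omega)) (hℓ.smooth_momentum _) hx hv',
      ih (by omega) (mem_lagKer.2 ⟨shift_mem_jetKer (jetKer_anti (by omega) (mem_lagKer.1 hv').1),
        rfl⟩)]
    simp only
    rw [cmp_shift (by omega), pow_succ, zero_sub, mul_neg_one, add_assoc]
    exact (neg_smul _ _).symm

/-- The system is triangular: once the components of `v` below $k+m$ vanish, the derivative of $\hat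
p^{\,k-1-m}$ along `v` is plus or minus the Hessian applied to the component $k+m$. It serves both
for holonomy and for the injectivity of $d\mathcal{FL}$. -/
theorem mem_lagKer_of_fderiv_momentum {x : LagCoord n k} (hx : x ∈ lagDom k O)
    (hreg : ∀ u : E n, (∀ v, fderiv ℝ (dLdq ℓ k) x (ins n (2 * k - 1) k u, 0) v = 0) → u = 0)
    {v : LagCoord n k} (hv : v ∈ lagKer n (2 * k - 1) (k - 1)) {m : ℕ} (hm : m ≤ k)
    (h : ∀ j < m, fderiv ℝ (momentum ℓ (k - 1 - j)) x v = 0) :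
    v ∈ lagKer n (2 * k - 1) (k - 1 + m) := by
  induction m with
  | zero => exact hv
  | succ m ih =>
    have h1 := ih (by omega) fun j hj => h j (by omega)
    refine mem_lagKer.2 ⟨fun a ha => ?_, (mem_lagKer.1 h1).2⟩
    rcases Nat.lt_or_ge a (k + m) with h2 | h2
    · exact (mem_lagKer.1 h1).1 a (by omega)
    · obtain rfl : a = k + m := by omega
      refine hreg _ fun u => ?_
      have h3 := hℓ.fderiv_momentum_top (by omega) hx
        (v := v) (j := m) (by rwa [show k + m - 1 = k - 1 + m by omega])
      rw [h m (by omega)] at h3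
      have h4 := (smul_eq_zero.1 h3.symm).resolve_left (by simp)
      rw [h4]; rfl

theorem smooth_momenta : ContDiffOn ℝ ∞ (momenta ℓ) (lagDom k O) :=
  ContDiffOn.sum fun r _ => (hℓ.smooth_momentum r).clm_comp contDiffOn_const

theorem smooth_legLoc : ContDiffOn ℝ ∞ (legLoc ℓ) (lagDom k O) :=
  ((trunc n _ _).contDiff.comp contDiff_fst).contDiffOn.prodMk
    (hℓ.smooth_momenta.prodMk contDiff_snd.contDiffOn)

theorem smooth_energyLoc : ContDiffOn ℝ ∞ (energyLoc ℓ) (lagDom k O) :=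
  (ContDiffOn.sum fun r _ => (hℓ.smooth_momentum r).clm_apply
    ((cmp n _ _).contDiff.comp contDiff_fst).contDiffOn).sub hℓ.smooth

end IsLocalLagrangian

theorem momenta_apply (x : LagCoord n k) (v : JetCoord n (k - 1)) :
    momenta ℓ x v = ∑ r ∈ Finset.range k, momentum ℓ r x (cmp n (k - 1) r v) := by
  simp [momenta]

theorem momenta_comp_ins {r : ℕ} (hr : r < k) (x : LagCoord n k) :
    (momenta ℓ x).comp (ins n (k - 1) r) = momentum ℓ r x := by
  ext1 u
  rw [ContinuousLinearMap.comp_apply, momenta_apply, Finset.sum_eq_single_of_mem r (by simpa)]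
  · rw [cmp_ins_self (by omega)]
  · intro s _ hs
    rw [cmp_ins_ne hs, map_zero]

theorem fderiv_momentum {r : ℕ} (hr : r < k) {x : LagCoord n k}
    (hd : DifferentiableAt ℝ (momenta ℓ) x) (v : LagCoord n k) :
    fderiv ℝ (momentum ℓ r) x v = (fderiv ℝ (momenta ℓ) x v).comp (ins n (k - 1) r) := by
  have : momentum ℓ r = fun y => (momenta ℓ y).comp (ins n (k - 1) r) :=
    funext fun y => (momenta_comp_ins hr y).symm
  rw [this]
  have h := hd.hasFDerivAt.clm_comp (hasFDerivAt_const (ins n (k - 1) r) x)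
  rw [h.fderiv]
  ext1 u
  simp

theorem energyLoc_eq (x : LagCoord n k) :
    energyLoc ℓ x = momenta ℓ x (shift n (2 * k - 1) (k - 1) x.1) - ℓ x := by
  rw [energyLoc, momenta_apply]
  congr 1
  refine Finset.sum_congr rfl fun r hr => ?_
  rw [cmp_shift (by simp at hr; omega)]

end LocalLagrangian

end HOContact

end

noncomputable section

namespace HOContact

/-! ### The momenta under changes of natural coordinates -/

section Covariance

variable {n r : ℕ} {O O' : Set (E n)} {τ : JetCoord n r → JetCoord n r}

/-- `τ` is a prolonged change of coordinates from `O` to `O'`. -/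
structure IsJetTransition (O O' : Set (E n)) (τ : JetCoord n r → JetCoord n r) : Prop where
  isOpen : IsOpen O
  smooth : ContDiffOn ℝ ∞ τ {v | v 0 ∈ O}
  mapsTo : ∀ v, v 0 ∈ O → τ v 0 ∈ O'
  inv : ∀ s, InvOn {v | v 0 ∈ O} (jetKer n r s) (fun v => cmp n r s (τ v))
  fderiv_shift : ∀ v, v 0 ∈ O → ∀ s < r,
    fderiv ℝ (fun v => cmp n r s (τ v)) v (shift n r r v) = cmp n r (s + 1) (τ v)

namespace IsJetTransition

variable (hτ : IsJetTransition O O' τ)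
include hτ

theorem contDiffAt {v : JetCoord n r} (hv : v 0 ∈ O) : ContDiffAt ℝ ∞ τ v :=
  hτ.smooth.contDiffAt ((isOpen_jetDom hτ.isOpen).mem_nhds hv)

theorem hasFDerivAt {v : JetCoord n r} (hv : v 0 ∈ O) : HasFDerivAt τ (fderiv ℝ τ v) v :=
  ((hτ.contDiffAt hv).differentiableAt (by simp)).hasFDerivAt

theorem contDiffAt_cmp (s : ℕ) {v : JetCoord n r} (hv : v 0 ∈ O) :
    ContDiffAt ℝ ∞ (fun v => cmp n r s (τ v)) v :=
  (cmp n r s).contDiff.contDiffAt.comp v (hτ.contDiffAt hv)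

theorem fderiv_cmp (s : ℕ) {v : JetCoord n r} (hv : v 0 ∈ O) (w : JetCoord n r) :
    fderiv ℝ (fun v => cmp n r s (τ v)) v w = cmp n r s (fderiv ℝ τ v w) := by
  exact congrArg (fun A => A w) ((cmp n r s).hasFDerivAt.comp v (hτ.hasFDerivAt hv)).fderiv

/-- The commutator of the total derivative and the partial derivatives. -/
theorem fderiv_fderiv_shift {v : JetCoord n r} (hv : v 0 ∈ O) {s : ℕ} (hs : s < r)
    (w : JetCoord n r) :
    fderiv ℝ (fderiv ℝ fun v => cmp n r s (τ v)) v (shift n r r v) w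
      = fderiv ℝ (fun v => cmp n r (s + 1) (τ v)) v w
        - fderiv ℝ (fun v => cmp n r s (τ v)) v (shift n r r w) := by
  have h1 : (fun v => cmp n r (s + 1) (τ v)) =ᶠ[𝓝 v]
      fun v => fderiv ℝ (fun v => cmp n r s (τ v)) v (shift n r r v) := by
    filter_upwards [(isOpen_jetDom hτ.isOpen).mem_nhds hv] with u hu
    exact (hτ.fderiv_shift u hu s hs).symm
  have h2 : DifferentiableAt ℝ (fderiv ℝ fun v => cmp n r s (τ v)) v :=
    ((hτ.contDiffAt_cmp s hv).fderiv_right (m := ∞) le_rfl).differentiableAt (by simp)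
  have h3 := (h2.hasFDerivAt.clm_apply (shift n r r).hasFDerivAt).fderiv
  -- Symmetry of the second derivative exchanges the total and the partial derivative; the remaining
  -- first-order term comes from differentiating the field `shift` itself.
  have h4 : IsSymmSndFDerivAt ℝ (fun v => cmp n r s (τ v)) v :=
    (hτ.contDiffAt_cmp s hv).isSymmSndFDerivAt (by
      rw [minSmoothness_of_isRCLikeNormedField]
      exact WithTop.coe_le_coe.2 (le_top : (2 : ℕ∞) ≤ ⊤))
  rw [h1.fderiv_eq, h3, h4 (shift n r r v) w]
  simp

end IsJetTransition

theorem isJetTransition_trans {Q : Type*} [TopologicalSpace Q] [ChartedSpace (E n) Q]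
    {e e' : OpenPartialHomeomorph Q (E n)} (he : e ∈ charts n Q) (he' : e' ∈ charts n Q) (r : ℕ) :
    IsJetTransition (overlap e e') (overlap e' e) (Jet.trans e e' r) where
  isOpen := isOpen_overlap
  smooth := Jet.contDiffOn_trans he he'
  mapsTo _ hv := Jet.trans_zero_mem hv
  inv s x hx v hv := by
    simp only
    rcases Nat.lt_or_ge r s with h | h
    · rw [cmp_eq_zero h]; rfl
    · have hv0 : v 0 = 0 := (cmp_zero_apply v).symm.trans (hv 0 (by omega))
      rw [Jet.cmp_trans he he' hx h, Jet.cmp_trans he he' (by simpa [hv0] using hx) h]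
      exact invOn_jetMap isOpen_overlap s x hx v hv
  fderiv_shift v hv s hs := by
    have : (fun v => cmp n r s (Jet.trans e e' r v)) =ᶠ[𝓝 v] jetMap r (e' ∘ e.symm) s := by
      filter_upwards [(isOpen_jetDom isOpen_overlap).mem_nhds hv] with u hu
      exact Jet.cmp_trans he he' hu hs.le
    rw [this.fderiv_eq, Jet.cmp_trans he he' hv hs, jetMap_succ]

variable {k : ℕ} {τ : JetCoord n (2 * k - 1) → JetCoord n (2 * k - 1)} {ℓ ℓ' : LagCoord n k → ℝ}

/-- The pull-back by `τ` of the Cartan form of `ℓ'`. -/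
def pullTheta (τ : JetCoord n (2 * k - 1) → JetCoord n (2 * k - 1)) (ℓ' : LagCoord n k → ℝ)
    (x : LagCoord n k) : JetCoord n (2 * k - 1) →L[ℝ] ℝ :=
  ∑ s ∈ Finset.range k, (momentum ℓ' s (τ x.1, x.2)).comp
    (fderiv ℝ (fun v => cmp n (2 * k - 1) s (τ v)) x.1)

namespace IsJetTransition

variable (hτ : IsJetTransition O O' τ) (hℓ : IsLocalLagrangian O ℓ) (hℓ' : IsLocalLagrangian O' ℓ')
  (h : ∀ x ∈ lagDom k O, ℓ x = ℓ' (τ x.1, x.2))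

include hτ

theorem hasFDerivAt_prod {x : LagCoord n k} (hx : x ∈ lagDom k O) :
    HasFDerivAt (fun x : LagCoord n k => ((τ x.1, x.2) : LagCoord n k))
      (((fderiv ℝ τ x.1).comp (ContinuousLinearMap.fst ℝ _ _)).prod
        (ContinuousLinearMap.snd ℝ _ _)) x :=
  ((hτ.hasFDerivAt hx).comp x hasFDerivAt_fst).prodMk hasFDerivAt_snd

include hℓ'

theorem hasFDerivAt_comp {G : Type*} [NormedAddCommGroup G] [NormedSpace ℝ G]
    {F : LagCoord n k → G} (hF : ContDiffOn ℝ ∞ F (lagDom k O')) {x : LagCoord n k}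
    (hx : x ∈ lagDom k O) :
    HasFDerivAt (fun x : LagCoord n k => F (τ x.1, x.2))
      ((fderiv ℝ F (τ x.1, x.2)).comp (((fderiv ℝ τ x.1).comp (ContinuousLinearMap.fst ℝ _ _)).prod
        (ContinuousLinearMap.snd ℝ _ _))) x :=
  (hℓ'.differentiableAt hF (x := (τ x.1, x.2)) (hτ.mapsTo x.1 hx)).hasFDerivAt.comp x
    (hτ.hasFDerivAt_prod hx)

include hℓ h

theorem fderiv_eq {x : LagCoord n k} (hx : x ∈ lagDom k O) (w : LagCoord n k) :
    fderiv ℝ ℓ x w = fderiv ℝ ℓ' (τ x.1, x.2) (fderiv ℝ τ x.1 w.1, w.2) := by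
  have : ℓ =ᶠ[𝓝 x] fun x => ℓ' (τ x.1, x.2) := by
    filter_upwards [hℓ.isOpen_dom.mem_nhds hx] with y hy using h y hy
  rw [this.fderiv_eq, (hτ.hasFDerivAt_comp hℓ' hℓ'.smooth hx).fderiv]
  rfl

theorem dLdz_eq {x : LagCoord n k} (hx : x ∈ lagDom k O) : dLdz ℓ x = dLdz ℓ' (τ x.1, x.2) := by
  rw [dLdz, hτ.fderiv_eq hℓ hℓ' h hx, map_zero]
  rfl

/-- The differential of `τ` carries `field ℓ` to `field ℓ'` except along $q_{2k-1}$. For `s ≠ 0` the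
momentum $\hat p^{\,s}$ has order at most $2k-2$; $\hat p^{\,0}$ may depend on $q_{2k-1}$ and has to
be excluded. -/
theorem fderiv_momentum_field {s : ℕ} (hs : s < k) (hs0 : s ≠ 0) {x : LagCoord n k}
    (hx : x ∈ lagDom k O) :
    fderiv ℝ (momentum ℓ' s) (τ x.1, x.2) (fderiv ℝ τ x.1 (shift n _ (2 * k - 1) x.1), ℓ x)
      = totalD ℓ' (momentum ℓ' s) (τ x.1, x.2)
        + dLdz ℓ x • momentum ℓ' s (τ x.1, x.2) := by
  rw [hτ.dLdz_eq hℓ hℓ' h hx, ← fderiv_apply_field]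
  have h1 := hℓ'.inv_momentum (j := k - 1 - s) (by omega)
  rw [show k - 1 - (k - 1 - s) = s by omega] at h1
  refine h1.differential_congr (hτ.mapsTo x.1 hx) (mem_lagKer.2 ⟨fun a ha => ?_, ?_⟩)
  · rw [Prod.fst_sub, map_sub, ← hτ.fderiv_cmp a hx, hτ.fderiv_shift _ hx a (by omega)]
    simp only [field]
    rw [cmp_shift (by omega), sub_self]
  · simp [field, h x hx]

/-- Leibniz rule for $\sum_s\hat p'^{\,s}\,dq'_s$: the momenta contribute $D_{L'}\hat
p'^{\,s}+L_z\hat p'^{\,s}$, and the differentials contribute $dq'_{s+1}(w)-dq'_s(\mathrm{shift}\,w)$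
by the commutator. The assumption $dq'_0(w)=0$ removes the derivative of $\hat p'^{\,0}$, not
covered by `fderiv_momentum_field`. -/
theorem fderiv_pullTheta_field {x : LagCoord n k} (hx : x ∈ lagDom k O) {w : JetCoord n (2 * k - 1)}
    (hw : cmp n (2 * k - 1) 0 (fderiv ℝ τ x.1 w) = 0) :
    fderiv ℝ (pullTheta τ ℓ') x (field ℓ x) w = dLdz ℓ x * pullTheta τ ℓ' x w
      - pullTheta τ ℓ' x (shift n _ _ w) + ∑ s ∈ Finset.range k,
        (totalD ℓ' (momentum ℓ' s) (τ x.1, x.2) (cmp n (2 * k - 1) s (fderiv ℝ τ x.1 w)) +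
          momentum ℓ' s (τ x.1, x.2) (cmp n (2 * k - 1) (s + 1) (fderiv ℝ τ x.1 w))) := by
  have hd : ∀ s, HasFDerivAt (fun x : LagCoord n k => fderiv ℝ
      (fun v => cmp n (2 * k - 1) s (τ v)) x.1)
      ((fderiv ℝ (fderiv ℝ fun v => cmp n (2 * k - 1) s (τ v)) x.1).comp
        (ContinuousLinearMap.fst ℝ _ _)) x := fun s =>
    HasFDerivAt.comp x (((hτ.contDiffAt_cmp s hx).fderiv_right (m := ∞) le_rfl).differentiableAt
      (by simp)).hasFDerivAt hasFDerivAt_fst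
  have h1 : HasFDerivAt (pullTheta τ ℓ') _ x := HasFDerivAt.fun_sum fun s _ =>
    (hτ.hasFDerivAt_comp hℓ' (hℓ'.smooth_momentum s) hx).clm_comp (hd s)
  rw [h1.fderiv]
  simp only [pullTheta, sum_apply, Finset.mul_sum, ← Finset.sum_sub_distrib,
    ← Finset.sum_add_distrib]
  refine Finset.sum_congr rfl fun s hs => ?_
  have hs : s < k := by simpa using hs
  simp only [add_apply, ContinuousLinearMap.comp_apply, ContinuousLinearMap.compL_apply,
    ContinuousLinearMap.flip_apply, ContinuousLinearMap.prod_apply, ContinuousLinearMap.coe_fst',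
    ContinuousLinearMap.coe_snd', field]
  rw [hτ.fderiv_fderiv_shift hx (by omega), hτ.fderiv_cmp _ hx, hτ.fderiv_cmp _ hx, map_sub]
  rcases Nat.eq_zero_or_pos s with rfl | hs0
  · simp only [hτ.fderiv_cmp _ hx, hw, map_zero]
    ring
  · rw [hτ.fderiv_momentum_field hℓ hℓ' h hs (by omega) hx]
    simp only [add_apply, smul_apply, smul_eq_mul, hτ.fderiv_cmp _ hx]
    ring

/-- By the recursion for the momenta the sum telescopes to $\sum_s(\partial L'/\partial
q'_{s+1})\,dq'_{s+1}(w)$. The boundary terms vanish since $\hat p'^{\,k}$ is an empty sum and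
$dq'_0(w)=0$; components beyond $k$ do not matter to $L'$. -/
theorem fderiv_vertical {x : LagCoord n k} (hx : x ∈ lagDom k O) {w : JetCoord n (2 * k - 1)}
    (hw : cmp n (2 * k - 1) 0 (fderiv ℝ τ x.1 w) = 0) :
    fderiv ℝ ℓ x (w, 0) = ∑ s ∈ Finset.range k,
        (totalD ℓ' (momentum ℓ' s) (τ x.1, x.2) (cmp n (2 * k - 1) s (fderiv ℝ τ x.1 w)) +
          momentum ℓ' s (τ x.1, x.2) (cmp n (2 * k - 1) (s + 1) (fderiv ℝ τ x.1 w))) := by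
  have hx' : (τ x.1, x.2) ∈ lagDom k O' := hτ.mapsTo x.1 hx
  have h0 : totalD ℓ' (momentum ℓ' k) (τ x.1, x.2) = 0 := by
    have : momentum ℓ' k = fun _ => 0 := by funext y; simp [momentum]
    rw [totalD_eq, this]
    simp
  have h1 : ∀ s ∈ Finset.range k,
      (totalD ℓ' (momentum ℓ' s) (τ x.1, x.2) (cmp n (2 * k - 1) s (fderiv ℝ τ x.1 w)) +
        momentum ℓ' s (τ x.1, x.2) (cmp n (2 * k - 1) (s + 1) (fderiv ℝ τ x.1 w)))
      = dLdq ℓ' (s + 1) (τ x.1, x.2) (cmp n (2 * k - 1) (s + 1) (fderiv ℝ τ x.1 w)) -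
        (totalD ℓ' (momentum ℓ' (s + 1)) (τ x.1, x.2)
            (cmp n (2 * k - 1) (s + 1) (fderiv ℝ τ x.1 w)) -
          totalD ℓ' (momentum ℓ' s) (τ x.1, x.2)
            (cmp n (2 * k - 1) s (fderiv ℝ τ x.1 w))) := by
    intro s hs
    rw [hℓ'.momentum_eq (by simpa using hs) hx']
    simp only [sub_apply]
    ring
  rw [Finset.sum_congr rfl h1, Finset.sum_sub_distrib, Finset.sum_range_sub (fun s =>
    totalD ℓ' (momentum ℓ' s) (τ x.1, x.2) (cmp n (2 * k - 1) s (fderiv ℝ τ x.1 w))), h0, hw,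
    map_zero, zero_apply, sub_zero, sub_zero, hτ.fderiv_eq hℓ hℓ' h hx]
  have h2 : ∑ s ∈ Finset.range k, dLdq ℓ' (s + 1) (τ x.1, x.2)
      (cmp n (2 * k - 1) (s + 1) (fderiv ℝ τ x.1 w)) = fderiv ℝ ℓ' (τ x.1, x.2)
      (∑ s ∈ Finset.range k, (ins n (2 * k - 1) (s + 1)
        (cmp n (2 * k - 1) (s + 1) (fderiv ℝ τ x.1 w)), 0)) := by
    rw [map_sum]
    rfl
  rw [h2]
  refine hℓ'.inv.differential_congr hx' (mem_lagKer.2 ⟨fun a ha => ?_, ?_⟩)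
  · rw [Prod.fst_sub, Prod.fst_sum, map_sub, map_sum]
    rcases Nat.eq_zero_or_pos a with rfl | ha0
    · rw [hw, Finset.sum_eq_zero fun s _ => cmp_ins_ne (by omega) _, sub_zero]
    · rw [Finset.sum_eq_single_of_mem (a - 1) (by simp; omega),
        show a - 1 + 1 = a by omega, cmp_ins_self (by omega), sub_self]
      intro b _ hb
      exact cmp_ins_ne (by omega) _
  · simp [Prod.snd_sum]

/-- Descending induction from the index $k$, where both sides vanish. With $\theta$ the pulled-back
Cartan form, the two preceding lemmas give $D_L(\theta(\partial_{q_{r+1}}))=\partial L/\partial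
q_{r+1}-\theta(\partial_{q_r})$, which is the recursion satisfied by the momenta of `ℓ`. -/
theorem momentum_eq_pullTheta {j : ℕ} (hj : j ≤ k) {x : LagCoord n k} (hx : x ∈ lagDom k O) :
    momentum ℓ (k - j) x = (pullTheta τ ℓ' x).comp (ins n (2 * k - 1) (k - j)) := by
  have hins : ∀ s b, s < b → ∀ x ∈ lagDom k O, ∀ u : E n,
      cmp n (2 * k - 1) s (fderiv ℝ τ x.1 (ins n (2 * k - 1) b u)) = 0 := fun s b hsb x hx u => by
    rw [← hτ.fderiv_cmp s hx]
    exact (hτ.inv s).differential_apply hx (ins_mem_jetKer hsb u)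
  induction j generalizing x with
  | zero =>
    ext1 u
    rw [Nat.sub_zero]
    simp only [pullTheta, ContinuousLinearMap.comp_apply, sum_apply]
    rw [Finset.sum_eq_zero]
    · simp [momentum]
    · intro s hs
      rw [hτ.fderiv_cmp _ hx, hins s k (by simpa using hs) x hx, map_zero]
  | succ j ih =>
    have hd : DifferentiableAt ℝ (pullTheta τ ℓ') x := by
      unfold pullTheta
      refine DifferentiableAt.fun_sum fun s _ => DifferentiableAt.clm_comp
        (hτ.hasFDerivAt_comp hℓ' (hℓ'.smooth_momentum s) hx).differentiableAt ?_
      exact DifferentiableAt.comp x (((hτ.contDiffAt_cmp s hx).fderiv_right (m := ∞)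
        le_rfl).differentiableAt (by simp)) differentiableAt_fst
    rw [hℓ.momentum_eq (by omega) hx, show k - (j + 1) + 1 = k - j by omega,
      totalD_congr hℓ.isOpen (fun y hy => ih (by omega) hy) hx, totalD_eq]
    have h1 := (hd.hasFDerivAt.clm_comp
      (hasFDerivAt_const (ins n (2 * k - 1) (k - j)) x)).fderiv
    rw [h1]
    ext1 u
    have hw := hins 0 (k - j) (by omega) x hx u
    have h2 := hτ.fderiv_pullTheta_field hℓ hℓ' h hx hw
    rw [← hτ.fderiv_vertical hℓ hℓ' h hx hw, show k - j = k - (j + 1) + 1 by omega,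
      shift_ins (by omega)] at h2
    have h3 : dLdq ℓ (k - j) x u = fderiv ℝ ℓ x (ins n (2 * k - 1) (k - j) u, 0) := rfl
    rw [show k - j = k - (j + 1) + 1 by omega] at h3 ⊢
    simp only [sub_apply, add_apply, smul_apply, ContinuousLinearMap.comp_apply,
      ContinuousLinearMap.compL_apply, ContinuousLinearMap.flip_apply, zero_apply, map_zero,
      smul_eq_mul, h2, h3]
    ring

variable {τ' : JetCoord n (k - 1) → JetCoord n (k - 1)} (hτ' : IsJetTransition O O' τ')
  (hc : ∀ v : JetCoord n (2 * k - 1), v 0 ∈ O → trunc n _ (k - 1) (τ v) = τ' (trunc n _ _ v))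

omit hℓ h hℓ' in
include hτ' hc in
theorem trunc_fderiv {v : JetCoord n (2 * k - 1)} (hv : v 0 ∈ O) (w : JetCoord n (2 * k - 1)) :
    trunc n _ (k - 1) (fderiv ℝ τ v w) = fderiv ℝ τ' (trunc n _ _ v) (trunc n _ _ w) := by
  have h1 := (trunc n (2 * k - 1) (k - 1)).hasFDerivAt.comp v (hτ.hasFDerivAt hv)
  have h2 := (hτ'.hasFDerivAt (v := trunc n _ _ v) (by rwa [trunc_zero])).comp v
    (trunc n (2 * k - 1) (k - 1)).hasFDerivAt
  have h3 : (trunc n (2 * k - 1) (k - 1)) ∘ τ =ᶠ[𝓝 v] τ' ∘ trunc n (2 * k - 1) (k - 1) := by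
    filter_upwards [(isOpen_jetDom hτ.isOpen).mem_nhds hv] with u hu using hc u hu
  have h4 := h1.unique (h2.congr_of_eventuallyEq h3)
  exact congrArg (fun A => A w) h4

include hτ' hc in
/-- The momenta are the components of a one-form. -/
theorem momenta_eq (hk : 1 ≤ k) {x : LagCoord n k} (hx : x ∈ lagDom k O) :
    momenta ℓ x = (momenta ℓ' (τ x.1, x.2)).comp (fderiv ℝ τ' (trunc n _ (k - 1) x.1)) := by
  ext1 w
  -- `w` is extended by zeros to order $2k-1$, where `momentum_eq_pullTheta` lives.
  let w' : JetCoord n (2 * k - 1) := ∑ r ∈ Finset.range k, ins n _ r (cmp n (k - 1) r w)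
  have hw' : trunc n _ (k - 1) w' = w := by
    have h1 := sum_ins_cmp w
    rw [show Finset.range (k - 1 + 1) = Finset.range k by congr 1; omega] at h1
    refine Eq.trans ?_ h1
    rw [map_sum]
    exact Finset.sum_congr rfl fun r hr => trunc_ins (by simp at hr; omega) _
  rw [ContinuousLinearMap.comp_apply]
  conv_rhs => rw [← hw']
  rw [← hτ.trunc_fderiv hτ' hc hx, momenta_apply, momenta_apply]
  have h1 : ∀ r ∈ Finset.range k, momentum ℓ r x (cmp n (k - 1) r w)
      = pullTheta τ ℓ' x (ins n _ r (cmp n (k - 1) r w)) := by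
    intro r hr
    have hr : r < k := by simpa using hr
    have h2 := hτ.momentum_eq_pullTheta hℓ hℓ' h (j := k - r) (by omega) hx
    rw [show k - (k - r) = r by omega] at h2
    rw [h2]; rfl
  rw [Finset.sum_congr rfl h1, ← map_sum]
  simp only [pullTheta, sum_apply]
  refine Finset.sum_congr rfl fun s hs => ?_
  have hs : s < k := by simpa using hs
  rw [ContinuousLinearMap.comp_apply, hτ.fderiv_cmp s hx, cmp_trunc (by omega)]

include hτ' hc in
-- The truncation to order $k-1$ of the total derivative field is intrinsic: the differential of the
-- transition takes $(q_1,\dots,q_k)$ to $(q'_1,\dots,q'_k)$, and the momenta pair with it as a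
-- one-form.
theorem energyLoc_eq (hk : 1 ≤ k) {x : LagCoord n k} (hx : x ∈ lagDom k O) :
    energyLoc ℓ x = energyLoc ℓ' (τ x.1, x.2) := by
  rw [HOContact.energyLoc_eq, HOContact.energyLoc_eq, h x hx,
    hτ.momenta_eq hℓ hℓ' h hτ' hc hk hx, ContinuousLinearMap.comp_apply]
  have h1 : shift n (2 * k - 1) (k - 1) x.1
      = trunc n _ _ (shift n (2 * k - 1) (2 * k - 1) x.1) := jet_ext fun a ha => by
    rw [cmp_trunc ha, cmp_shift ha, cmp_shift (by omega)]
  rw [h1, ← hτ.trunc_fderiv hτ' hc hx]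
  congr 2
  refine jet_ext fun a ha => ?_
  rw [cmp_trunc ha, ← hτ.fderiv_cmp a hx, hτ.fderiv_shift _ hx a (by omega), cmp_shift ha]

end IsJetTransition

end Covariance

end HOContact

end

noncomputable section

namespace HOContact

/-! ### Chart independence of the Legendre map and the energy -/

section Global

variable {n k : ℕ} {Q : Type*} [TopologicalSpace Q] [ChartedSpace (E n) Q]
  {e e' : OpenPartialHomeomorph Q (E n)} {L : Jet n Q k × ℝ → ℝ}

theorem IsLocalLagrangian.mono {O O' : Set (E n)} {ℓ : LagCoord n k → ℝ}
    (h : IsLocalLagrangian O' ℓ) (hO : IsOpen O) (hOO : O ⊆ O') : IsLocalLagrangian O ℓ where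
  isOpen := hO
  smooth := h.smooth.mono fun _ hx => hOO hx
  inv x hx v hv := h.inv x (hOO hx) v hv

theorem contDiffOn_locL (hL : IsSmoothLagrangian L) (he : e ∈ charts n Q) :
    ContDiffOn ℝ ∞ (locL L e) (lagDom k e.target) := by
  have h1 : ContDiff ℝ ∞ fun x : LagCoord n k =>
      ((trunc n (2 * k - 1) k x.1, x.2) : JetCoord n k × ℝ) :=
    ((trunc n _ k).contDiff.comp contDiff_fst).prodMk contDiff_snd
  have h2 : Set.MapsTo (fun x : LagCoord n k =>
      ((trunc n (2 * k - 1) k x.1, x.2) : JetCoord n k × ℝ)) (lagDom k e.target)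
      {x | x.1 0 ∈ e.target} := by
    intro x hx
    simp only [Set.mem_ofPred_eq, trunc_zero]
    exact hx
  have h3 := (hL e he).comp h1.contDiffOn h2
  have h4 : ∀ x, locL L e x = ((fun x : JetCoord n k × ℝ => L (Jet.ofCoord e x.1, x.2)) ∘
      fun x : LagCoord n k => ((trunc n (2 * k - 1) k x.1, x.2) : JetCoord n k × ℝ)) x :=
    fun x => by rw [locL, Function.comp_apply]
  exact h3.congr fun x _ => h4 x

theorem invOn_locL (e : OpenPartialHomeomorph Q (E n)) (D : Set (LagCoord n k)) :
    InvOn D (lagKer n (2 * k - 1) k) (locL L e) := by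
  intro x _ v hv
  obtain ⟨hv1, hv2⟩ := mem_lagKer.1 hv
  have h1 : trunc n (2 * k - 1) k v.1 = 0 := jet_ext fun a ha => by
    rw [cmp_trunc ha, hv1 a ha, map_zero]
  unfold locL
  rw [Prod.fst_add, Prod.snd_add, map_add, h1, hv2, add_zero, add_zero]

theorem isLocalLagrangian_locL (hL : IsSmoothLagrangian L) (he : e ∈ charts n Q) :
    IsLocalLagrangian e.target (locL L e) :=
  ⟨e.open_target, contDiffOn_locL hL he, invOn_locL e _⟩

theorem locL_trans (hk : 1 ≤ k) (he : e ∈ charts n Q) (he' : e' ∈ charts n Q) (x : LagCoord n k)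
    (hx : x ∈ lagDom k (overlap e e')) :
    locL L e x = locL L e' (Jet.trans e e' _ x.1, x.2) := by
  have hx0 : (trunc n (2 * k - 1) k x.1) 0 ∈ overlap e e' := by rw [trunc_zero]; exact hx
  have h2 := mem_overlap.1 hx0
  unfold locL
  simp only
  rw [Jet.trunc_trans he he' (by omega) hx]
  unfold Jet.trans
  rw [Jet.ofCoord_coord he' (by rw [Jet.base_ofCoord]; exact h2.2)]

theorem coord_mem_overlap {r : ℕ} {x : Jet n Q r} (hx : x.base ∈ e.source)
    (hx' : x.base ∈ e'.source) : x.coord e 0 ∈ overlap e e' := by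
  rw [mem_overlap, Jet.base_eq x hx, Jet.coord_zero]
  exact ⟨e.map_source hx, hx'⟩

theorem coord_mem_target {r : ℕ} {x : Jet n Q r} (hx : x.base ∈ e.source) :
    x.coord e 0 ∈ e.target := by
  rw [Jet.coord_zero]; exact e.map_source hx

theorem base_Leg (x : LagSpace n Q k) : (Leg L x).1.pt.base = x.1.base := Jet.base_proj _ _

theorem coordL_injective (he : e ∈ charts n Q) {x y : LagSpace n Q k} (hx : x.1.base ∈ e.source)
    (hy : y.1.base ∈ e.source) (h : coordL e x = coordL e y) : x = y :=
  Prod.ext (Jet.coord_injective he hx hy (congrArg (fun v => v.1) h))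
    (congrArg (fun v : LagCoord n k => v.2) h)

variable [IsManifold 𝓘(ℝ, E n) ∞ Q]

/-- `Leg` stores its covector in the preferred chart at the base point; `momenta_eq` for the
transition from `e` to that chart turns it into the momenta computed in `e`. -/
theorem coord_Leg (hk : 1 ≤ k) (hL : IsSmoothLagrangian L) (he : e ∈ charts n Q)
    (x : LagSpace n Q k) (hx : x.1.base ∈ e.source) :
    CotJet.coord e (Leg L x).1 = momenta (locL L e) (coordL e x) := by
  have he' : chartAt (E n) x.1.base ∈ charts n Q := IsManifold.chart_mem_maximalAtlas _
  have hx' : x.1.base ∈ (chartAt (E n) x.1.base).source := mem_chart_source _ _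
  have h1 := (isJetTransition_trans he he' (2 * k - 1)).momenta_eq
    ((isLocalLagrangian_locL hL he).mono isOpen_overlap overlap_subset)
    ((isLocalLagrangian_locL hL he').mono isOpen_overlap overlap_subset)
    (locL_trans hk he he') (isJetTransition_trans he he' (k - 1))
    (fun v hv => Jet.trunc_trans he he' (by omega) hv) hk (x := coordL e x)
    (coord_mem_overlap hx hx')
  have h2 : ((x.1.proj (k - 1) : Jet n Q (k - 1))).base ∈ e.source := by rwa [Jet.base_proj]
  rw [h1]
  simp only [CotJet.coord, Leg, Jet.base_proj,
    Jet.coord_proj he (by omega : k - 1 ≤ 2 * k - 1) _ hx]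
  simp only [coordL, Jet.trans_coord he hx]
  rfl

theorem coordH_Leg (hk : 1 ≤ k) (hL : IsSmoothLagrangian L) (he : e ∈ charts n Q)
    (x : LagSpace n Q k) (hx : x.1.base ∈ e.source) :
    coordH e (Leg L x) = legLoc (locL L e) (coordL e x) := by
  unfold coordH legLoc
  rw [coord_Leg hk hL he x hx]
  have h := Jet.coord_proj he (by omega : k - 1 ≤ 2 * k - 1) x.1 hx
  exact congrArg (fun v => (v, _)) h

theorem energy_eq (hk : 1 ≤ k) (hL : IsSmoothLagrangian L) (he : e ∈ charts n Q)
    (x : LagSpace n Q k) (hx : x.1.base ∈ e.source) :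
    energy L x = energyLoc (locL L e) (coordL e x) := by
  have he' : chartAt (E n) x.1.base ∈ charts n Q := IsManifold.chart_mem_maximalAtlas _
  have hx' : x.1.base ∈ (chartAt (E n) x.1.base).source := mem_chart_source _ _
  have h1 := (isJetTransition_trans he he' (2 * k - 1)).energyLoc_eq
    ((isLocalLagrangian_locL hL he).mono isOpen_overlap overlap_subset)
    ((isLocalLagrangian_locL hL he').mono isOpen_overlap overlap_subset)
    (locL_trans hk he he') (isJetTransition_trans he he' (k - 1))
    (fun v hv => Jet.trunc_trans he he' (by omega) hv) hk (x := coordL e x)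
    (coord_mem_overlap hx hx')
  rw [h1]
  simp only [coordL, Jet.trans_coord he hx, energy]

/-- The Jacobian relating the momentum coordinates in `e` to the stored covector is invertible, with
inverse the Jacobian of the opposite transition. -/
theorem coordH_injective (he : e ∈ charts n Q) {x y : HamSpace n Q k}
    (hx : x.1.pt.base ∈ e.source) (hy : y.1.pt.base ∈ e.source) (h : coordH e x = coordH e y) :
    x = y := by
  obtain ⟨⟨p, ξ⟩, z⟩ := x
  obtain ⟨⟨p', ξ'⟩, z'⟩ := y
  have hp : p = p' := Jet.coord_injective he hx hy (congrArg Prod.fst h)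
  have hz : z = z' := congrArg (fun v => v.2.2) h
  subst hp hz
  have hξ : CotJet.coord e ⟨p, ξ⟩ = CotJet.coord e ⟨p, ξ'⟩ := congrArg (fun v => v.2.1) h
  have he' : chartAt (E n) p.base ∈ charts n Q := IsManifold.chart_mem_maximalAtlas _
  have hp' : p.base ∈ (chartAt (E n) p.base).source := mem_chart_source _ _
  have hT := isJetTransition_trans he he' (k - 1)
  have hT' := isJetTransition_trans he' he (k - 1)
  have ho := coord_mem_overlap (x := p) hx hp'
  have ho' := coord_mem_overlap (x := p) hp' hx
  have h1 := hT.hasFDerivAt ho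
  have h2 := hT'.hasFDerivAt ho'
  have h3 : (Jet.trans e (chartAt (E n) p.base) (k - 1)) ∘ (Jet.trans (chartAt (E n) p.base) e (k - 1))
      =ᶠ[𝓝 (p.coord (chartAt (E n) p.base))] id := by
    filter_upwards [(isOpen_jetDom isOpen_overlap).mem_nhds ho'] with v hv
    exact Jet.trans_trans he' he hv
  have h4 : Jet.trans (chartAt (E n) p.base) e (k - 1) (p.coord (chartAt (E n) p.base))
      = p.coord e := Jet.trans_coord he' hp'
  rw [← h4] at h1
  have h5 := (h1.comp _ h2).unique ((hasFDerivAt_id _).congr_of_eventuallyEq h3)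
  rw [h4] at h5
  have h6 : ξ = ξ' := by
    have h7 := congrArg (fun A => ContinuousLinearMap.comp A (fderiv ℝ
      (Jet.trans (chartAt (E n) p.base) e (k - 1)) (p.coord (chartAt (E n) p.base)))) hξ
    simp only [CotJet.coord, ContinuousLinearMap.comp_assoc] at h7
    change ξ.comp (_ ∘SL _) = ξ'.comp (_ ∘SL _) at h7
    have h8 : (fderiv ℝ (fun v => Jet.coord (chartAt (E n) p.base) (Jet.ofCoord e v))
        (Jet.coord e p)) ∘SL (fderiv ℝ (Jet.trans (chartAt (E n) p.base) e (k - 1))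
        (p.coord (chartAt (E n) p.base))) = ContinuousLinearMap.id ℝ _ := h5
    rw [h8] at h7
    exact h7
  rw [h6]

theorem coordW_graphPt (hk : 1 ≤ k) (hL : IsSmoothLagrangian L) (he : e ∈ charts n Q)
    (x : LagSpace n Q k) (hx : x.1.base ∈ e.source) :
    coordW e (graphPt L x)
      = ((coordL e x).1, momenta (locL L e) (coordL e x), (coordL e x).2) := by
  rw [← coord_Leg hk hL he x hx]
  rfl

end Global

end HOContact

end

noncomputable section

namespace HOContact

/-! ### The contact equations at a point -/

section ContactCalculus

variable {n k : ℕ}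

theorem dForm_swap {V : Type*} [NormedAddCommGroup V] [NormedSpace ℝ V] (η : V → V →L[ℝ] ℝ)
    (x u v : V) : dForm η x u v = -dForm η x v u := by
  unfold dForm; ring

theorem etaH_apply (y u : HamCoord n k) : etaH y u = u.2.2 - y.2.1 u.1 := rfl

theorem dForm_etaH (y a b : HamCoord n k) : dForm etaH y a b = b.2.1 a.1 - a.2.1 b.1 := by
  have h : HasFDerivAt (fun y : HamCoord n k => y.2.1) ((ContinuousLinearMap.fst ℝ
      (JetCoord n (k - 1) →L[ℝ] ℝ) ℝ).comp (ContinuousLinearMap.snd ℝ (JetCoord n (k - 1)) _)) y :=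
    ContinuousLinearMap.hasFDerivAt ((ContinuousLinearMap.fst ℝ
      (JetCoord n (k - 1) →L[ℝ] ℝ) ℝ).comp (ContinuousLinearMap.snd ℝ (JetCoord n (k - 1)) _))
  have h2 := (h.clm_comp (hasFDerivAt_const (ContinuousLinearMap.fst ℝ (JetCoord n (k - 1))
    ((JetCoord n (k - 1) →L[ℝ] ℝ) × ℝ)) y)).const_sub
    ((ContinuousLinearMap.snd ℝ (JetCoord n (k - 1) →L[ℝ] ℝ) ℝ).comp
      (ContinuousLinearMap.snd ℝ (JetCoord n (k - 1)) _))
  have h3 : fderiv ℝ etaH y = _ := h2.fderiv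
  rw [dForm, h3]
  simp
  ring

theorem etaW_apply (w u : UniCoord n k) :
    etaW w u = u.2.2 - w.2.1 (trunc n _ (k - 1) u.1) := rfl

theorem dForm_etaW (w a b : UniCoord n k) : dForm etaW w a b
    = b.2.1 (trunc n _ (k - 1) a.1) - a.2.1 (trunc n _ (k - 1) b.1) := by
  have h : HasFDerivAt (fun w : UniCoord n k => w.2.1) ((ContinuousLinearMap.fst ℝ
      (JetCoord n (k - 1) →L[ℝ] ℝ) ℝ).comp
      (ContinuousLinearMap.snd ℝ (JetCoord n (2 * k - 1)) _)) w :=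
    ContinuousLinearMap.hasFDerivAt ((ContinuousLinearMap.fst ℝ
      (JetCoord n (k - 1) →L[ℝ] ℝ) ℝ).comp (ContinuousLinearMap.snd ℝ (JetCoord n (2 * k - 1)) _))
  have h2 := (h.clm_comp (hasFDerivAt_const ((trunc n (2 * k - 1) (k - 1)).comp
    (ContinuousLinearMap.fst ℝ (JetCoord n (2 * k - 1))
    ((JetCoord n (k - 1) →L[ℝ] ℝ) × ℝ))) w)).const_sub
    ((ContinuousLinearMap.snd ℝ (JetCoord n (k - 1) →L[ℝ] ℝ) ℝ).comp
      (ContinuousLinearMap.snd ℝ (JetCoord n (2 * k - 1)) _))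
  have h4 : (etaW : UniCoord n k → _) = fun w => (ContinuousLinearMap.snd ℝ
      (JetCoord n (k - 1) →L[ℝ] ℝ) ℝ).comp (ContinuousLinearMap.snd ℝ (JetCoord n (2 * k - 1)) _)
      - w.2.1.comp ((trunc n (2 * k - 1) (k - 1)).comp (ContinuousLinearMap.fst ℝ
        (JetCoord n (2 * k - 1)) ((JetCoord n (k - 1) →L[ℝ] ℝ) × ℝ))) := by
    funext w
    exact ContinuousLinearMap.ext fun u => rfl
  rw [dForm, h4, h2.fderiv]
  simp
  ring

theorem exists_reeb_etaW (w : UniCoord n k) : ∃ R, IsReeb etaW w R :=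
  ⟨(0, 0, 1), fun u => by rw [dForm_etaW]; simp, by rw [etaW_apply]; simp⟩

variable {O : Set (E n)} {ℓ : LagCoord n k → ℝ}

theorem etaL_apply (x u : LagCoord n k) :
    etaL ℓ x u = u.2 - momenta ℓ x (trunc n _ (k - 1) u.1) := rfl

theorem fderiv_hamW {w : UniCoord n k} (hd : DifferentiableAt ℝ ℓ (w.1, w.2.2))
    (u : UniCoord n k) :
    fderiv ℝ (hamW ℓ) w u = u.2.1 (shift n _ (k - 1) w.1) + w.2.1 (shift n _ (k - 1) u.1)
      - fderiv ℝ ℓ (w.1, w.2.2) (u.1, u.2.2) := by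
  have h1 : HasFDerivAt (fun w : UniCoord n k => w.2.1) ((ContinuousLinearMap.fst ℝ
      (JetCoord n (k - 1) →L[ℝ] ℝ) ℝ).comp
      (ContinuousLinearMap.snd ℝ (JetCoord n (2 * k - 1)) _)) w :=
    ContinuousLinearMap.hasFDerivAt ((ContinuousLinearMap.fst ℝ
      (JetCoord n (k - 1) →L[ℝ] ℝ) ℝ).comp
      (ContinuousLinearMap.snd ℝ (JetCoord n (2 * k - 1)) _))
  have h2 : HasFDerivAt (fun w : UniCoord n k => shift n (2 * k - 1) (k - 1) w.1)
      ((shift n (2 * k - 1) (k - 1)).comp (ContinuousLinearMap.fst ℝ (JetCoord n (2 * k - 1))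
        ((JetCoord n (k - 1) →L[ℝ] ℝ) × ℝ))) w :=
    ContinuousLinearMap.hasFDerivAt ((shift n (2 * k - 1) (k - 1)).comp (ContinuousLinearMap.fst ℝ (JetCoord n (2 * k - 1))
        ((JetCoord n (k - 1) →L[ℝ] ℝ) × ℝ)))
  have h3 : HasFDerivAt (fun w : UniCoord n k => ((w.1, w.2.2) : LagCoord n k))
      ((ContinuousLinearMap.fst ℝ (JetCoord n (2 * k - 1))
        ((JetCoord n (k - 1) →L[ℝ] ℝ) × ℝ)).prod
        ((ContinuousLinearMap.snd ℝ (JetCoord n (k - 1) →L[ℝ] ℝ) ℝ).comp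
      (ContinuousLinearMap.snd ℝ (JetCoord n (2 * k - 1)) _))) w :=
    ContinuousLinearMap.hasFDerivAt ((ContinuousLinearMap.fst ℝ (JetCoord n (2 * k - 1))
        ((JetCoord n (k - 1) →L[ℝ] ℝ) × ℝ)).prod
        ((ContinuousLinearMap.snd ℝ (JetCoord n (k - 1) →L[ℝ] ℝ) ℝ).comp
      (ContinuousLinearMap.snd ℝ (JetCoord n (2 * k - 1)) _)))
  have h4 := (h1.clm_apply h2).sub (hd.hasFDerivAt.comp w h3)
  have h5 : fderiv ℝ (hamW ℓ) w = _ := h4.fderiv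
  rw [h5]
  simp
  ring

/-- The velocities `a` at the point `x` of `T^{2k-1}Q × ℝ` for which the velocity of the lift to
the graph of the Legendre map solves the unified equations. -/
def GraphEq (ℓ : LagCoord n k → ℝ) (x a : LagCoord n k) : Prop :=
  trunc n _ (k - 1) a.1 = shift n _ (k - 1) x.1 ∧ a.2 = ℓ x ∧
    ∀ v, fderiv ℝ (momenta ℓ) x a (trunc n _ (k - 1) v) = fderiv ℝ ℓ x (v, 0)
      - momenta ℓ x (shift n _ (k - 1) v) + dLdz ℓ x * momenta ℓ x (trunc n _ (k - 1) v)

theorem mem_jetKer_of_trunc {v : JetCoord n (2 * k - 1)} (h : trunc n _ (k - 1) v = 0) :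
    v ∈ jetKer n (2 * k - 1) (k - 1) := fun a ha => by
  rw [← cmp_trunc (s := k - 1) ha, h, map_zero]

theorem fderiv_eq_add_dLdz (x u : LagCoord n k) :
    fderiv ℝ ℓ x u = fderiv ℝ ℓ x (u.1, 0) + dLdz ℓ x * u.2 := by
  have : u = (u.1, 0) + u.2 • ((0, 1) : LagCoord n k) := by
    ext1 <;> simp
  conv_lhs => rw [this]
  rw [map_add, map_smul, smul_eq_mul]
  exact congrArg _ (mul_comm _ _)

namespace IsLocalLagrangian

variable (hℓ : IsLocalLagrangian O ℓ) {x : LagCoord n k} (hx : x ∈ lagDom k O)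
include hℓ hx

theorem differentiableAt_self : DifferentiableAt ℝ ℓ x := hℓ.differentiableAt hℓ.smooth hx

theorem hasFDerivAt_momenta : HasFDerivAt (momenta ℓ) (fderiv ℝ (momenta ℓ) x) x :=
  (hℓ.differentiableAt hℓ.smooth_momenta hx).hasFDerivAt

theorem fderiv_legLoc (u : LagCoord n k) :
    fderiv ℝ (legLoc ℓ) x u = (trunc n _ (k - 1) u.1, fderiv ℝ (momenta ℓ) x u, u.2) := by
  have h1 : HasFDerivAt (fun x : LagCoord n k => trunc n (2 * k - 1) (k - 1) x.1)
      ((trunc n (2 * k - 1) (k - 1)).comp (ContinuousLinearMap.fst ℝ _ ℝ)) x :=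
    ContinuousLinearMap.hasFDerivAt ((trunc n (2 * k - 1) (k - 1)).comp (ContinuousLinearMap.fst ℝ _ ℝ))
  have h2 : fderiv ℝ (legLoc ℓ) x = _ :=
    (h1.prodMk ((hℓ.hasFDerivAt_momenta hx).prodMk hasFDerivAt_snd)).fderiv
  rw [h2]
  rfl

theorem etaL_eq_etaH (u : LagCoord n k) :
    etaL ℓ x u = etaH (legLoc ℓ x) (fderiv ℝ (legLoc ℓ) x u) := by
  rw [hℓ.fderiv_legLoc hx]
  rfl

theorem dForm_etaL (a b : LagCoord n k) : dForm (etaL ℓ) x a b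
    = fderiv ℝ (momenta ℓ) x b (trunc n _ (k - 1) a.1)
      - fderiv ℝ (momenta ℓ) x a (trunc n _ (k - 1) b.1) := by
  have h := ((hℓ.hasFDerivAt_momenta hx).clm_comp (hasFDerivAt_const
    ((trunc n (2 * k - 1) (k - 1)).comp (ContinuousLinearMap.fst ℝ _ ℝ)) x)).const_sub
    (ContinuousLinearMap.snd ℝ (JetCoord n (2 * k - 1)) ℝ)
  have h3 : fderiv ℝ (etaL ℓ) x = _ := h.fderiv
  rw [dForm, h3]
  simp
  ring

theorem dForm_etaL_eq_etaH (a b : LagCoord n k) : dForm (etaL ℓ) x a b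
    = dForm etaH (legLoc ℓ x) (fderiv ℝ (legLoc ℓ) x a) (fderiv ℝ (legLoc ℓ) x b) := by
  rw [hℓ.dForm_etaL hx, dForm_etaH, hℓ.fderiv_legLoc hx, hℓ.fderiv_legLoc hx]

theorem fderiv_energyLoc (u : LagCoord n k) :
    fderiv ℝ (energyLoc ℓ) x u = fderiv ℝ (momenta ℓ) x u (shift n _ (k - 1) x.1)
      + momenta ℓ x (shift n _ (k - 1) u.1) - fderiv ℝ ℓ x u := by
  have h1 : HasFDerivAt (fun x : LagCoord n k => shift n (2 * k - 1) (k - 1) x.1)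
      ((shift n (2 * k - 1) (k - 1)).comp (ContinuousLinearMap.fst ℝ _ ℝ)) x :=
    ContinuousLinearMap.hasFDerivAt ((shift n (2 * k - 1) (k - 1)).comp (ContinuousLinearMap.fst ℝ _ ℝ))
  have h2 := ((hℓ.hasFDerivAt_momenta hx).clm_apply h1).sub
    (hℓ.differentiableAt_self hx).hasFDerivAt
  have h3 : energyLoc ℓ = _ := funext (energyLoc_eq (ℓ := ℓ))
  have h4 : fderiv ℝ (energyLoc ℓ) x = _ := (h2.congr_of_eventuallyEq h3.eventuallyEq).fderiv
  rw [h4]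
  simp
  ring

/-- For a vector without components below $k$, both sides reduce to $\partial L/\partial q_k$
applied to the component $k$, since $\hat p^{\,k-1}=\partial L/\partial q_k$. Hence on the graph
$d\mathcal H$ annihilates the kernel directions of $\eta_{\mathcal W}$. -/
theorem fderiv_eq_momenta_shift (hk : 1 ≤ k) {v : JetCoord n (2 * k - 1)}
    (hv : v ∈ jetKer n (2 * k - 1) (k - 1)) :
    fderiv ℝ ℓ x (v, 0) = momenta ℓ x (shift n _ (k - 1) v) := by
  rw [momenta_apply, Finset.sum_eq_single_of_mem (k - 1) (by simp; omega), momentum_last hk,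
    cmp_shift le_rfl, show k - 1 + 1 = k by omega]
  · refine hℓ.inv.differential_congr (v := (ins n _ k (cmp n _ k v), 0)) hx
      (mem_lagKer.2 ⟨fun a ha => ?_, by simp⟩)
    rw [Prod.fst_sub, map_sub]
    rcases Nat.lt_or_ge a k with h | h
    · rw [hv a (by omega), cmp_ins_ne (by omega), sub_zero]
    · have h' : a = k := by omega
      rw [h', cmp_ins_self (by omega), sub_self]
  · intro r hr hr'
    have hr : r < k := by simpa using hr
    rw [cmp_shift (by omega), hv _ (by omega), map_zero]

/-- Every Reeb vector is $\partial/\partial z$ plus a vector along $q_k,\dots,q_{2k-1}$, which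
$d\mathcal H$ annihilates on the graph. This makes the unified equations independent of the choice.
-/
theorem fderiv_hamW_reeb (hk : 1 ≤ k) {R : UniCoord n k}
    (hR : IsReeb etaW (x.1, momenta ℓ x, x.2) R) :
    fderiv ℝ (hamW ℓ) (x.1, momenta ℓ x, x.2) R = -dLdz ℓ x := by
  obtain ⟨h1, h2⟩ := hR
  simp only [dForm_etaW] at h1
  have h3 : trunc n _ (k - 1) R.1 = 0 := by
    rw [SeparatingDual.eq_zero_iff_forall_dual_eq_zero (R := ℝ)]
    intro g
    simpa using h1 (0, g, 0)
  have h4 : R.2.1 = 0 := by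
    ext1 v
    -- Here `trunc` goes to a higher order and extends `v` by zeros.
    have h5 := h1 (trunc n _ (2 * k - 1) v, 0, 0)
    rw [trunc_trunc_of_le (by omega)] at h5
    simpa using h5
  have h5 : R.2.2 = 1 := by
    rw [etaW_apply, h3, map_zero, sub_zero] at h2
    exact h2
  rw [fderiv_hamW (hℓ.differentiableAt_self hx), fderiv_eq_add_dLdz,
    hℓ.fderiv_eq_momenta_shift hx hk (mem_jetKer_of_trunc h3), h4, h5]
  simp

/-- Testing with covectors gives $\dot q_\alpha=q_{\alpha+1}$ for $\alpha\le k-1$, testing with jets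
gives the momentum equations, and the contraction with $\eta_{\mathcal W}$ gives $\dot z=L$. The
$\partial/\partial z$ direction is then automatic because $\mathcal R(\mathcal H)=-L_z$. -/
theorem contactEq_etaW_iff (hk : 1 ≤ k) {R : UniCoord n k}
    (hR : IsReeb etaW (x.1, momenta ℓ x, x.2) R) (a : LagCoord n k) :
    ContactEq etaW (hamW ℓ) R (x.1, momenta ℓ x, x.2) (a.1, fderiv ℝ (momenta ℓ) x a, a.2)
      ↔ GraphEq ℓ x a := by
  unfold ContactEq GraphEq
  rw [hℓ.fderiv_hamW_reeb hx hk hR]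
  simp only [dForm_etaW, fderiv_hamW (w := (x.1, momenta ℓ x, x.2)) (hℓ.differentiableAt_self hx),
    etaW_apply]
  constructor
  · rintro ⟨h1, h2⟩
    have h3 : trunc n _ (k - 1) a.1 = shift n _ (k - 1) x.1 := by
      rw [SeparatingDual.eq_iff_forall_dual_eq (R := ℝ)]
      intro g
      have h4 := h1 (0, g, 0)
      simp only [map_zero, Prod.mk_zero_zero] at h4
      simpa using h4
    refine ⟨h3, ?_, fun v => ?_⟩
    · rw [h3, hamW] at h2
      simp only at h2
      linarith
    · have h4 := h1 (v, 0, 0)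
      simp only [zero_apply] at h4
      linarith
  · rintro ⟨h1, h2, h3⟩
    refine ⟨fun u => ?_, ?_⟩
    · rw [h1, h3, fderiv_eq_add_dLdz x (u.1, u.2.2)]
      ring
    · rw [h1, h2, hamW]
      ring

theorem contactEq_etaL (a R : LagCoord n k) (h : GraphEq ℓ x a) (hR : IsReeb (etaL ℓ) x R) :
    ContactEq (etaL ℓ) (energyLoc ℓ) R x a := by
  obtain ⟨h1, h2, h3⟩ := h
  have key : ∀ u, dForm (etaL ℓ) x a u = fderiv ℝ (energyLoc ℓ) x u + dLdz ℓ x * etaL ℓ x u := by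
    intro u
    rw [hℓ.dForm_etaL hx, h1, h3, hℓ.fderiv_energyLoc hx, etaL_apply, fderiv_eq_add_dLdz x u]
    ring
  have h4 := key R
  -- Evaluating on the Reeb vector forces $\mathcal R(E_L)=-L_z$, whichever one is used.
  rw [dForm_swap, hR.1, hR.2] at h4
  refine ⟨fun u => ?_, ?_⟩
  · rw [key, show fderiv ℝ (energyLoc ℓ) x R = -dLdz ℓ x by linarith]
    ring
  · rw [etaL_apply, energyLoc_eq, h1, h2]
    ring

theorem graphEq_of_contactEq {a R : LagCoord n k} (h : ContactEq (etaL ℓ) (energyLoc ℓ) R x a)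
    (h1 : trunc n _ (k - 1) a.1 = shift n _ (k - 1) x.1) : GraphEq ℓ x a := by
  obtain ⟨h2, h3⟩ := h
  rw [etaL_apply, energyLoc_eq, h1] at h3
  refine ⟨h1, by linarith, fun v => ?_⟩
  have h4 : ∀ u : LagCoord n k, _ := fun u => h2 u
  simp only [hℓ.dForm_etaL hx, h1, hℓ.fderiv_energyLoc hx _, etaL_apply] at h4
  -- The $\partial/\partial z$ direction determines $\mathcal R(E_L)=-L_z$; the jet directions `(v,
  -- 0)` then give the momentum equations.
  have h5 := h4 (0, 1)
  have h6 := h4 (v, 0)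
  have h7 : fderiv ℝ ℓ x (0, 1) = dLdz ℓ x := rfl
  simp only [map_zero, h7] at h5
  simp only at h6
  have h8 : fderiv ℝ (momenta ℓ) x R (shift n _ (k - 1) x.1) + momenta ℓ x (shift n _ (k - 1) R.1)
      - fderiv ℝ ℓ x R = -dLdz ℓ x := by linarith
  rw [h8] at h6
  linarith

/-- Along `a` and along `field ℓ` the momenta $\hat p^{\,1},\dots,\hat p^{\,k-1}$ have the same
derivative, by the equations of motion on one side and the recursion on the other. The triangular
system then kills the components of the difference up to $2k-2$. -/
theorem graphEq_holonomic (hk : 1 ≤ k)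
    (hreg : ∀ u : E n, (∀ v, fderiv ℝ (dLdq ℓ k) x (ins n (2 * k - 1) k u, 0) v = 0) → u = 0)
    {a : LagCoord n k} (h : GraphEq ℓ x a) :
    ∀ α ≤ 2 * k - 2, cmp n (2 * k - 1) α a.1 = cmp n (2 * k - 1) (α + 1) x.1 := by
  obtain ⟨h1, h2, h3⟩ := h
  have h4 : a - field ℓ x ∈ lagKer n (2 * k - 1) (k - 1) := by
    refine mem_lagKer.2 ⟨fun α hα => ?_, by simp [field, h2]⟩
    rw [Prod.fst_sub, map_sub, field]
    simp only
    rw [cmp_shift (by omega), ← cmp_trunc (s := k - 1) hα, h1, cmp_shift hα, sub_self]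
  -- Only $k-1$ momenta are used: $\hat p^{\,0}$ would concern $\dot q_{2k-1}$, which holonomy
  -- leaves free.
  have h5 := hℓ.mem_lagKer_of_fderiv_momentum hx hreg h4 (m := k - 1) (by omega) (by
    intro j hj
    rw [map_sub, sub_eq_zero, fderiv_apply_field,
      fderiv_momentum (by omega) (hℓ.hasFDerivAt_momenta hx).differentiableAt]
    ext1 u
    have h6 := h3 (ins n _ (k - 1 - j) u)
    have h7 := hℓ.momentum_eq (r := k - 1 - j - 1) (by omega) hx
    have h7' := congrArg (fun A => A u) h7
    have h8 : k - 1 - j - 1 + 1 = k - 1 - j := by omega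
    have h9 : shift n (2 * k - 1) (k - 1) (ins n (2 * k - 1) (k - 1 - j) u)
        = ins n _ (k - 1 - j - 1) u := by
      conv_lhs => rw [← h8]
      rw [shift_ins (by omega)]
    simp only [sub_apply, h8] at h7'
    rw [trunc_ins (by omega), h9] at h6
    have h10 : ∀ r < k, momenta ℓ x (ins n (k - 1) r u) = momentum ℓ r x u := fun r hr => by
      rw [← momenta_comp_ins hr]; rfl
    rw [h10 _ (by omega), h10 _ (by omega)] at h6
    have h11 : dLdq ℓ (k - 1 - j) x u = fderiv ℝ ℓ x (ins n (2 * k - 1) (k - 1 - j) u, 0) := rfl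
    simp only [ContinuousLinearMap.comp_apply, add_apply, smul_apply, smul_eq_mul]
    rw [h6]
    linarith)
  intro α hα
  have h6 := (mem_lagKer.1 h5).1 α (by omega)
  rw [Prod.fst_sub, map_sub, field] at h6
  simp only at h6
  rw [cmp_shift (by omega)] at h6
  exact sub_eq_zero.1 h6

/-- All $k$ momenta enter here, so the triangular system also reaches the component $2k-1$. -/
theorem fderiv_legLoc_injective
    (hreg : ∀ u : E n, (∀ v, fderiv ℝ (dLdq ℓ k) x (ins n (2 * k - 1) k u, 0) v = 0) → u = 0) :
    Function.Injective (fderiv ℝ (legLoc ℓ) x) := by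
  rw [injective_iff_map_eq_zero]
  intro v hv
  rw [hℓ.fderiv_legLoc hx, Prod.mk_eq_zero, Prod.mk_eq_zero] at hv
  obtain ⟨h1, h2, h3⟩ := hv
  have h4 := hℓ.mem_lagKer_of_fderiv_momentum hx hreg
    (mem_lagKer.2 ⟨mem_jetKer_of_trunc h1, h3⟩) (m := k) le_rfl (by
      intro j hj
      rw [fderiv_momentum (by omega) (hℓ.hasFDerivAt_momenta hx).differentiableAt, h2,
        ContinuousLinearMap.zero_comp])
  refine Prod.ext (jet_ext fun α hα => ?_) h3
  rw [(mem_lagKer.1 h4).1 α (by omega)]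
  exact (map_zero _).symm

end IsLocalLagrangian

theorem finrank_jetDual (r : ℕ) : FiniteDimensional ℝ (JetCoord n r →L[ℝ] ℝ) ∧
    Module.finrank ℝ (JetCoord n r →L[ℝ] ℝ) = (r + 1) * n := by
  have e : (JetCoord n r →ₗ[ℝ] ℝ) ≃ₗ[ℝ] (JetCoord n r →L[ℝ] ℝ) := LinearMap.toContinuousLinearMap
  refine ⟨e.finiteDimensional, ?_⟩
  rw [← e.finrank_eq]
  refine (Subspace.dual_finrank_eq (K := ℝ) (V := JetCoord n r)).trans ?_
  rw [Module.finrank_pi_fintype]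
  simp

instance finiteDimensional_jetDual (r : ℕ) : FiniteDimensional ℝ (JetCoord n r →L[ℝ] ℝ) :=
  (finrank_jetDual r).1

theorem finrank_lagCoord (hk : 1 ≤ k) :
    Module.finrank ℝ (LagCoord n k) = Module.finrank ℝ (HamCoord n k) := by
  rw [Module.finrank_prod, Module.finrank_prod, Module.finrank_prod, (finrank_jetDual _).2,
    Module.finrank_pi_fintype, Module.finrank_pi_fintype]
  simp only [finrank_euclideanSpace, Fintype.card_fin, Finset.sum_const, Finset.card_univ,
    smul_eq_mul, Module.finrank_self]
  rw [show 2 * k - 1 + 1 = k + k by omega, show k - 1 + 1 = k by omega]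
  ring

/-- Since $\eta_L$ and $d\eta_L$ are pull-backs by $\mathcal{FL}$, any preimage of
$\partial/\partial z$ is a Reeb vector. -/
theorem IsLocalLagrangian.exists_reeb_etaL (hℓ : IsLocalLagrangian O ℓ) {x : LagCoord n k}
    (hx : x ∈ lagDom k O) (hs : Function.Surjective (fderiv ℝ (legLoc ℓ) x)) :
    ∃ R, IsReeb (etaL ℓ) x R := by
  obtain ⟨R, hR⟩ := hs (0, 0, 1)
  refine ⟨R, fun u => ?_, ?_⟩
  · rw [hℓ.dForm_etaL_eq_etaH hx, hR, dForm_etaH]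
    simp
  · rw [hℓ.etaL_eq_etaH hx, hR, etaH_apply]
    simp

end ContactCalculus

end HOContact

end

noncomputable section

namespace HOContact

/-! ### Natural charts and the topology of jet spaces -/

section Topology

variable {n k r : ℕ} {Q : Type*} [TopologicalSpace Q] [ChartedSpace (E n) Q]
  {e e' : OpenPartialHomeomorph Q (E n)}

theorem Jet.isOpen_chart (he : e ∈ charts n Q) {S : Set (JetCoord n r)} (hS : IsOpen S) :
    IsOpen {x : Jet n Q r | x.base ∈ e.source ∧ x.coord e ∈ S} := by
  refine isOpen_iSup_iff.2 fun e' => isOpen_iSup_iff.2 fun he' => isOpen_coinduced.2 ?_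
  have h1 : IsOpen ({v : JetCoord n r | v 0 ∈ overlap e' e} ∩ Jet.trans e' e r ⁻¹' S) :=
    (Jet.contDiffOn_trans he' he).continuousOn.isOpen_inter_preimage
      (isOpen_jetDom isOpen_overlap) hS
  convert h1.preimage (continuous_subtype_val (p := fun v : JetCoord n r => v 0 ∈ e'.target))
    using 1
  ext ⟨v, hv⟩
  change (Jet.ofCoord e' v : Jet n Q r).base ∈ e.source ∧ _ ↔ v 0 ∈ overlap e' e ∧ _
  rw [mem_overlap, Jet.base_ofCoord]
  exact ⟨fun h => ⟨⟨hv, h.1⟩, h.2⟩, fun h => ⟨h.1.2, h.2⟩⟩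

theorem Jet.continuousOn_ofCoord (he : e ∈ charts n Q) :
    ContinuousOn (Jet.ofCoord e : JetCoord n r → Jet n Q r) {v | v 0 ∈ e.target} := by
  rw [continuousOn_iff_continuous_domRestrict]
  exact continuous_iff_coinduced_le.2 (le_iSup₂_of_le e he le_rfl)

theorem Jet.continuousOn_coord (he : e ∈ charts n Q) :
    ContinuousOn (Jet.coord e : Jet n Q r → JetCoord n r) {x | x.base ∈ e.source} := by
  have h0 : IsOpen {x : Jet n Q r | x.base ∈ e.source} := by
    simpa using Jet.isOpen_chart (r := r) he isOpen_univ
  rw [continuousOn_open_iff h0]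
  exact fun S hS => Jet.isOpen_chart he hS

theorem isOpen_chartL (he : e ∈ charts n Q) {S : Set (LagCoord n k)} (hS : IsOpen S) :
    IsOpen {x : LagSpace n Q k | x.1.base ∈ e.source ∧ coordL e x ∈ S} := by
  have h0 : IsOpen {x : Jet n Q (2 * k - 1) | x.base ∈ e.source} := by
    simpa using Jet.isOpen_chart (r := 2 * k - 1) he isOpen_univ
  have h1 : ContinuousOn (coordL e : LagSpace n Q k → LagCoord n k)
      (Prod.fst ⁻¹' {x | x.base ∈ e.source}) :=
    ((Jet.continuousOn_coord he).comp continuous_fst.continuousOn fun _ h => h).prodMk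
      continuous_snd.continuousOn
  exact h1.isOpen_inter_preimage (h0.preimage continuous_fst) hS

/-- The inverse of `coordL e`. -/
def pointL (e : OpenPartialHomeomorph Q (E n)) (v : LagCoord n k) : LagSpace n Q k :=
  (Jet.ofCoord e v.1, v.2)

theorem coordL_mem {x : LagSpace n Q k} (hx : x.1.base ∈ e.source) :
    coordL e x ∈ lagDom k e.target := coord_mem_target hx

theorem coordL_pointL (he : e ∈ charts n Q) {v : LagCoord n k} (hv : v ∈ lagDom k e.target) :
    coordL e (pointL e v : LagSpace n Q k) = v :=
  Prod.ext (Jet.coord_ofCoord he hv) rfl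

theorem pointL_coordL (he : e ∈ charts n Q) {x : LagSpace n Q k} (hx : x.1.base ∈ e.source) :
    pointL e (coordL e x) = x :=
  Prod.ext (Jet.ofCoord_coord he hx) rfl

theorem base_pointL {v : LagCoord n k} (hv : v ∈ lagDom k e.target) :
    (pointL e v : LagSpace n Q k).1.base ∈ e.source := Jet.base_ofCoord_mem hv

theorem eventually_pointL_mem (he : e ∈ charts n Q) {U : Set (LagSpace n Q k)} (hU : IsOpen U)
    {x : LagSpace n Q k} (hxU : x ∈ U) (hx : x.1.base ∈ e.source) :
    ∀ᶠ v in 𝓝 (coordL e x), v ∈ lagDom k e.target ∧ (pointL e v : LagSpace n Q k) ∈ U := by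
  have h1 : ContinuousOn (pointL e : LagCoord n k → LagSpace n Q k) (lagDom k e.target) :=
    ((Jet.continuousOn_ofCoord he).comp continuous_fst.continuousOn fun _ h => h).prodMk
      continuous_snd.continuousOn
  have h2 := h1.isOpen_inter_preimage (isOpen_lagDom e.open_target) hU
  exact h2.mem_nhds ⟨coordL_mem hx, by rw [Set.mem_preimage, pointL_coordL he hx]; exact hxU⟩

end Topology

/-! ### Smooth curves, holonomy and prolongations -/

section Curves

variable {n k : ℕ} {Q : Type*} [TopologicalSpace Q] [ChartedSpace (E n) Q]
  {e : OpenPartialHomeomorph Q (E n)} {I : Set ℝ}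

/-- `σ` is a smooth curve in `T^{2k-1}Q × ℝ`. -/
def IsSmoothCurveL (I : Set ℝ) (σ : ℝ → LagSpace n Q k) : Prop :=
  SmoothOn I (fun t => (σ t).1.base) (fun e t => coordL e (σ t))

theorem IsSmoothCurve.projL {σ : ℝ → UniSpace n Q k} (h : IsSmoothCurve I σ) :
    IsSmoothCurveL I (fun t => projL (σ t)) := by
  refine ⟨h.1, fun e he => ?_⟩
  have h1 : ContDiff ℝ ∞ fun w : UniCoord n k => ((w.1, w.2.2) : LagCoord n k) :=
    contDiff_fst.prodMk (contDiff_snd.comp contDiff_snd)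
  exact h1.comp_contDiffOn (h.2 e he)

namespace IsSmoothCurveL

variable {σ : ℝ → LagSpace n Q k} (hσ : IsSmoothCurveL I σ) (hI : IsOpen I) {t : ℝ} (ht : t ∈ I)
  (hte : (σ t).1.base ∈ e.source)
include hσ hI ht hte

theorem eventually : ∀ᶠ s in 𝓝 t, s ∈ I ∧ (σ s).1.base ∈ e.source :=
  (hσ.1.isOpen_inter_preimage hI e.open_source).mem_nhds ⟨ht, hte⟩

theorem contDiffAt (he : e ∈ charts n Q) : ContDiffAt ℝ ∞ (fun s => coordL e (σ s)) t :=
  (hσ.2 e he).contDiffAt ((hσ.1.isOpen_inter_preimage hI e.open_source).mem_nhds ⟨ht, hte⟩)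

theorem hasDerivAt (he : e ∈ charts n Q) : HasDerivAt (fun s => coordL e (σ s))
    (deriv (fun s => coordL e (σ s)) t) t :=
  ((hσ.contDiffAt hI ht hte he).differentiableAt (by simp)).hasDerivAt

end IsSmoothCurveL

/-- Inductively, $q_\alpha$ is the derivative of order $\alpha$ of the base curve read in the chart,
so the curve and the prolongation have equal coordinates. -/
theorem IsSmoothCurveL.isHolonomic {σ : ℝ → LagSpace n Q k} (hσ : IsSmoothCurveL I σ)
    (hI : IsOpen I) [IsManifold 𝓘(ℝ, E n) ∞ Q]
    (h : ∀ t ∈ I, ∀ e ∈ charts n Q, (σ t).1.base ∈ e.source → ∀ α ≤ 2 * k - 2,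
      cmp n (2 * k - 1) α (deriv (fun s => coordL e (σ s)) t).1
        = cmp n (2 * k - 1) (α + 1) (coordL e (σ t)).1) : IsHolonomic I σ := by
  have hc : ∀ t ∈ I, ∀ e ∈ charts n Q, (σ t).1.base ∈ e.source → ∀ α (hα : α < 2 * k - 1 + 1),
      iteratedDeriv α (e ∘ fun s => (σ s).1.base) t = (coordL e (σ t)).1 ⟨α, hα⟩ := by
    intro t ht e he hte α
    induction α generalizing t with
    | zero =>
      intro hα
      rw [iteratedDeriv_zero]
      exact (Jet.coord_zero _).symm
    | succ α ih =>
      intro hα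
      have h1 : iteratedDeriv α (e ∘ fun s => (σ s).1.base) =ᶠ[𝓝 t]
          fun s => cmp n (2 * k - 1) α (coordL e (σ s)).1 := by
        filter_upwards [hσ.eventually hI ht hte] with s hs
        rw [ih s hs.1 hs.2 (by omega), cmp_apply]
      have h2 : HasDerivAt (fun s => cmp n (2 * k - 1) α (coordL e (σ s)).1)
          (cmp n (2 * k - 1) α (deriv (fun s => coordL e (σ s)) t).1) t :=
        ((cmp n (2 * k - 1) α).comp (ContinuousLinearMap.fst ℝ _ ℝ)).hasFDerivAt.comp_hasDerivAt t
          (hσ.hasDerivAt hI ht hte he)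
      rw [iteratedDeriv_succ, h1.deriv_eq, h2.deriv, h t ht e he hte α (by omega),
        cmp_apply hα]
  have hb : ∀ t ∈ I, ContMDiffAt 𝓘(ℝ, ℝ) 𝓘(ℝ, E n) ∞ (fun t => (σ t).1.base) t := by
    intro t ht
    have he : chartAt (E n) (σ t).1.base ∈ charts n Q := IsManifold.chart_mem_maximalAtlas _
    have hte : (σ t).1.base ∈ (chartAt (E n) (σ t).1.base).source := mem_chart_source _ _
    refine contMDiffAt_of_chart_comp he (hσ.1.continuousAt (hI.mem_nhds ht)) hte ?_
    have h1 := (((ContinuousLinearMap.proj (R := ℝ) (φ := fun _ : Fin (2 * k - 1 + 1) => E n) 0).comp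
      (ContinuousLinearMap.fst ℝ _ ℝ)).contDiff (n := ∞)).contDiffAt.comp t
        (hσ.contDiffAt hI ht hte he)
    refine h1.congr_of_eventuallyEq (Filter.Eventually.of_forall fun s => ?_)
    exact (Jet.coord_zero _).symm
  refine ⟨fun t ht => (hb t ht).contMDiffWithinAt, fun t ht => ?_, fun t ht => ?_⟩
  · have he : chartAt (E n) (σ t).1.base ∈ charts n Q := IsManifold.chart_mem_maximalAtlas _
    exact (contDiff_snd.contDiffAt.comp t
      (hσ.contDiffAt hI ht (mem_chart_source _ _) he)).contDiffWithinAt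
  · have he : chartAt (E n) (σ t).1.base ∈ charts n Q := IsManifold.chart_mem_maximalAtlas _
    have hte : (σ t).1.base ∈ (chartAt (E n) (σ t).1.base).source := mem_chart_source _ _
    refine coordL_injective he hte ?_ (Prod.ext (funext fun α => ?_) rfl)
    · rw [prolong, Jet.base_jetAt]; exact hte
    · exact (hc t ht _ he hte α α.2).symm.trans (Jet.coord_jetAt he (hb t ht) hte α).symm

section Prolong

variable {c : ℝ → Q} {z : ℝ → ℝ} (hI : IsOpen I)
  (hc : ContMDiffOn 𝓘(ℝ, ℝ) 𝓘(ℝ, E n) ∞ c I) (hz : ContDiffOn ℝ ∞ z I)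

theorem base_prolong (t : ℝ) : (prolong k c z t : LagSpace n Q k).1.base = c t :=
  Jet.base_jetAt c t

include hI hc

theorem coordL_prolong (he : e ∈ charts n Q) {t : ℝ} (ht : t ∈ I) (hte : c t ∈ e.source) :
    coordL e (prolong k c z t : LagSpace n Q k)
      = (fun α : Fin (2 * k - 1 + 1) => iteratedDeriv α (e ∘ c) t, z t) :=
  Prod.ext (funext fun α => Jet.coord_jetAt he (hc.contMDiffAt (hI.mem_nhds ht)) hte α) rfl

theorem contDiffAt_iteratedDeriv_chart (he : e ∈ charts n Q) {t : ℝ} (ht : t ∈ I)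
    (hte : c t ∈ e.source) (α : ℕ) : ContDiffAt ℝ ∞ (iteratedDeriv α (e ∘ c)) t :=
  contDiffAt_iteratedDeriv (m := ⊤)
    (contDiffAt_chart_comp he (hc.contMDiffAt (hI.mem_nhds ht)) hte)

theorem isOpen_chart_curve (e : OpenPartialHomeomorph Q (E n)) : IsOpen (I ∩ c ⁻¹' e.source) :=
  hc.continuousOn.isOpen_inter_preimage hI e.open_source

include hz in
theorem isSmoothCurveL_prolong : IsSmoothCurveL I (prolong k c z : ℝ → LagSpace n Q k) := by
  have hb : (fun t => (prolong k c z t : LagSpace n Q k).1.base) = c := funext base_prolong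
  unfold IsSmoothCurveL
  rw [hb]
  refine ⟨hc.continuousOn, fun e he => ?_⟩
  have h1 : ContDiffOn ℝ ∞ (fun t => ((fun α : Fin (2 * k - 1 + 1) => iteratedDeriv α (e ∘ c) t,
      z t) : LagCoord n k)) (I ∩ c ⁻¹' e.source) := by
    refine ContDiffOn.prodMk (contDiffOn_pi.2 fun α => ?_) (hz.mono Set.inter_subset_left)
    exact fun t ht => (contDiffAt_iteratedDeriv_chart hI hc he ht.1 ht.2 α).contDiffWithinAt
  exact h1.congr fun t ht => coordL_prolong hI hc he ht.1 ht.2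

theorem cmp_deriv_prolong (hz : ContDiffOn ℝ ∞ z I) (he : e ∈ charts n Q) {t : ℝ} (ht : t ∈ I)
    (hte : c t ∈ e.source) {α : ℕ} (hα : α + 1 ≤ 2 * k - 1) :
    cmp n (2 * k - 1) α (deriv (fun s => coordL e (prolong k c z s : LagSpace n Q k)) t).1
      = cmp n (2 * k - 1) (α + 1) (coordL e (prolong k c z t : LagSpace n Q k)).1 := by
  have h0 := (isSmoothCurveL_prolong (k := k) hI hc hz).hasDerivAt (e := e) hI ht
    (by rwa [base_prolong]) he
  have h2 : HasDerivAt (fun s => cmp n (2 * k - 1) α (coordL e (prolong k c z s : LagSpace n Q k)).1)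
      (cmp n (2 * k - 1) α (deriv (fun s => coordL e (prolong k c z s : LagSpace n Q k)) t).1) t :=
    ((cmp n (2 * k - 1) α).comp (ContinuousLinearMap.fst ℝ _ ℝ)).hasFDerivAt.comp_hasDerivAt t h0
  have h3 : (fun s => cmp n (2 * k - 1) α (coordL e (prolong k c z s : LagSpace n Q k)).1)
      =ᶠ[𝓝 t] iteratedDeriv α (e ∘ c) := by
    filter_upwards [(isOpen_chart_curve hI hc e).mem_nhds ⟨ht, hte⟩] with s hs
    rw [coordL_prolong hI hc he hs.1 hs.2, cmp_apply (by omega)]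
  rw [← h2.deriv, h3.deriv_eq, ← iteratedDeriv_succ, coordL_prolong hI hc he ht hte,
    cmp_apply (by omega)]

end Prolong

end Curves

/-! ### Equivalence of the unified and Herglotz equations along curves -/

section Equations

variable {n k : ℕ} {Q : Type*} [TopologicalSpace Q] [ChartedSpace (E n) Q]
  [IsManifold 𝓘(ℝ, E n) ∞ Q] {I : Set ℝ} {L : Jet n Q k × ℝ → ℝ}

/-- `GraphEq` along a curve in `T^{2k-1}Q × ℝ`, in all natural charts. -/
def SolvesGraph (L : Jet n Q k × ℝ → ℝ) (I : Set ℝ) (σ : ℝ → LagSpace n Q k) : Prop :=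
  ∀ t ∈ I, ∀ e ∈ charts n Q, (σ t).1.base ∈ e.source →
    GraphEq (locL L e) (coordL e (σ t)) (deriv (fun s => coordL e (σ s)) t)

variable (hk : 1 ≤ k) (hL : IsSmoothLagrangian L) (hI : IsOpen I)
include hk hL hI

omit hI in
theorem isSmoothCurve_graphPt {σ : ℝ → LagSpace n Q k} (hσ : IsSmoothCurveL I σ) :
    IsSmoothCurve I (fun t => graphPt L (σ t)) := by
  refine ⟨hσ.1, fun e he => ?_⟩
  have hℓ := isLocalLagrangian_locL hL he
  have h1 := hσ.2 e he
  have h2 : ContDiffOn ℝ ∞ (fun t => momenta (locL L e) (coordL e (σ t)))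
      (I ∩ (fun t => (σ t).1.base) ⁻¹' e.source) :=
    hℓ.smooth_momenta.comp h1 fun t ht => coordL_mem ht.2
  refine ContDiffOn.congr ((contDiff_fst.comp_contDiffOn h1).prodMk
    (h2.prodMk (contDiff_snd.comp_contDiffOn h1))) fun t ht => ?_
  exact coordW_graphPt hk hL he _ ht.2

theorem deriv_coordW {w : ℝ → UniSpace n Q k} (hσ : IsSmoothCurveL I fun t => projL (w t))
    (hw : ∀ t ∈ I, w t = graphPt L (projL (w t))) {t : ℝ} (ht : t ∈ I)
    {e : OpenPartialHomeomorph Q (E n)} (he : e ∈ charts n Q) (hte : (projL (w t)).1.base ∈ e.source) :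
    deriv (fun s => coordW e (w s)) t = ((deriv (fun s => coordL e (projL (w s))) t).1,
      fderiv ℝ (momenta (locL L e)) (coordL e (projL (w t)))
        (deriv (fun s => coordL e (projL (w s))) t),
      (deriv (fun s => coordL e (projL (w s))) t).2) := by
  have hℓ := isLocalLagrangian_locL hL he
  have h0 := hσ.hasDerivAt hI ht hte he
  have h1 := (hℓ.hasFDerivAt_momenta (coordL_mem hte)).comp_hasDerivAt t h0
  have h2 := (hasFDerivAt_fst (𝕜 := ℝ) (p := coordL e (projL (w t)))).comp_hasDerivAt t h0
  have h3 := (hasFDerivAt_snd (𝕜 := ℝ) (p := coordL e (projL (w t)))).comp_hasDerivAt t h0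
  refine HasDerivAt.deriv ((h2.prodMk (h1.prodMk h3)).congr_of_eventuallyEq ?_)
  filter_upwards [hσ.eventually hI ht hte] with s hs
  conv_lhs => rw [hw s hs.1]
  exact coordW_graphPt hk hL he _ hs.2

theorem SolvesUnified.solvesGraph {w : ℝ → UniSpace n Q k} (hs : IsSmoothCurve I w)
    (hw : ∀ t ∈ I, w t = graphPt L (projL (w t))) (h : SolvesUnified L I w) :
    SolvesGraph L I (fun t => projL (w t)) := by
  intro t ht e he hte
  obtain ⟨R, hR, hc⟩ := h t ht e he hte
  have hW : coordW e (w t) = _ :=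
    (congrArg (coordW e) (hw t ht)).trans (coordW_graphPt hk hL he _ hte)
  rw [hW] at hR
  rw [hW, deriv_coordW hk hL hI hs.projL hw ht he hte] at hc
  exact ((isLocalLagrangian_locL hL he).contactEq_etaW_iff (coordL_mem hte) hk hR _).1 hc

theorem SolvesGraph.solvesUnifiedAll {σ : ℝ → LagSpace n Q k} (hσ : IsSmoothCurveL I σ)
    (h : SolvesGraph L I σ) : SolvesUnifiedAll L I (fun t => graphPt L (σ t)) := by
  intro t ht e he hte
  have h1 := deriv_coordW (w := fun t => graphPt L (σ t)) hk hL hI hσ (fun _ _ => rfl) ht he hte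
  refine ⟨exists_reeb_etaW _, fun R hR => ?_⟩
  rw [coordW_graphPt hk hL he _ hte] at hR ⊢
  rw [h1]
  exact ((isLocalLagrangian_locL hL he).contactEq_etaW_iff (coordL_mem hte) hk hR _).2
    (h t ht e he hte)

omit hk hI [IsManifold 𝓘(ℝ, E n) ∞ Q] in
theorem SolvesGraph.solvesHerglotzAll {σ : ℝ → LagSpace n Q k} (h : SolvesGraph L I σ)
    (hR : ∀ t ∈ I, HasReeb L (σ t)) : SolvesHerglotzAll L I σ := fun t ht e he hte =>
  ⟨hR t ht e he hte, fun R hR' => (isLocalLagrangian_locL hL he).contactEq_etaL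
    (coordL_mem hte) _ R (h t ht e he hte) hR'⟩

omit [IsManifold 𝓘(ℝ, E n) ∞ Q] in
theorem SolvesHerglotz.solvesGraph {c : ℝ → Q} {z : ℝ → ℝ}
    (hc : ContMDiffOn 𝓘(ℝ, ℝ) 𝓘(ℝ, E n) ∞ c I) (hz : ContDiffOn ℝ ∞ z I)
    (h : SolvesHerglotz L I (prolong k c z)) : SolvesGraph L I (prolong k c z) := by
  intro t ht e he hte
  obtain ⟨R, _, hE⟩ := h t ht e he hte
  refine (isLocalLagrangian_locL hL he).graphEq_of_contactEq (coordL_mem hte) hE ?_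
  refine jet_ext fun α hα => ?_
  rw [cmp_trunc hα, cmp_shift hα]
  exact cmp_deriv_prolong hI hc hz he ht (by rwa [base_prolong] at hte) (by omega)

omit hk hI [IsManifold 𝓘(ℝ, E n) ∞ Q] in
theorem IsRegularLagrangian.bijective_fderiv_legLoc (hk : 1 ≤ k) (hreg : IsRegularLagrangian L)
    {e : OpenPartialHomeomorph Q (E n)} (he : e ∈ charts n Q) {x : LagCoord n k}
    (hx : x ∈ lagDom k e.target) : Function.Bijective (fderiv ℝ (legLoc (locL L e)) x) := by
  have h := (isLocalLagrangian_locL hL he).fderiv_legLoc_injective hx (hreg e he x hx)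
  exact ⟨h, (LinearMap.injective_iff_surjective_of_finrank_eq_finrank
    (f := (fderiv ℝ (legLoc (locL L e)) x).toLinearMap) (finrank_lagCoord hk)).1 h⟩

omit hI [IsManifold 𝓘(ℝ, E n) ∞ Q] in
theorem IsRegularLagrangian.hasReeb (hreg : IsRegularLagrangian L) (x : LagSpace n Q k) :
    HasReeb L x := fun _ he hx =>
  (isLocalLagrangian_locL hL he).exists_reeb_etaL (coordL_mem hx)
    (hreg.bijective_fderiv_legLoc hL hk he (coordL_mem hx)).2

theorem SolvesGraph.isHolonomic_of_regular {σ : ℝ → LagSpace n Q k} (hσ : IsSmoothCurveL I σ)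
    (hreg : IsRegularLagrangian L) (h : SolvesGraph L I σ) : IsHolonomic I σ :=
  hσ.isHolonomic hI fun t ht e he hte => (isLocalLagrangian_locL hL he).graphEq_holonomic
    (coordL_mem hte) hk (hreg e he _ (coordL_mem hte)) (h t ht e he hte)

omit hL hk in
-- Without regularity `GraphEq` gives holonomy only below order $k$; the remaining orders are
-- assumed.
theorem SolvesGraph.isHolonomic_of_upper {σ : ℝ → LagSpace n Q k} (hσ : IsSmoothCurveL I σ)
    (hup : UpperHolonomic I σ) (h : SolvesGraph L I σ) : IsHolonomic I σ := by
  refine hσ.isHolonomic hI fun t ht e he hte α hα => ?_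
  rcases Nat.lt_or_ge α k with hαk | hαk
  · have h1 := (h t ht e he hte).1
    rw [← cmp_trunc (s := k - 1) (by omega), h1, cmp_shift (by omega)]
  · have h2 : HasDerivAt (fun s => cmp n (2 * k - 1) α (coordL e (σ s)).1)
        (cmp n (2 * k - 1) α (deriv (fun s => coordL e (σ s)) t).1) t :=
      ((cmp n (2 * k - 1) α).comp (ContinuousLinearMap.fst ℝ _ ℝ)).hasFDerivAt.comp_hasDerivAt t
        (hσ.hasDerivAt hI ht hte he)
    rw [← h2.deriv]
    exact hup t ht e he hte α hαk hα

end Equations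

end HOContact

end

noncomputable section

namespace HOContact

/-! ### Local structure of submersions -/

section Submersion

variable {X G : Type*} [NormedAddCommGroup X] [NormedSpace ℝ X] [FiniteDimensional ℝ X]
  [NormedAddCommGroup G] [NormedSpace ℝ G] [FiniteDimensional ℝ G] {g : X → G} {x : X}

/-- A submersion is a projection in suitable coordinates. -/
theorem exists_submersion_chart (hg : ContDiffAt ℝ ∞ g x)
    (hs : Function.Surjective (fderiv ℝ g x)) :
    ∃ Ψ : OpenPartialHomeomorph X (G × (fderiv ℝ g x).ker), x ∈ Ψ.source ∧
      (∀ x', (Ψ x').1 = g x') ∧ ContDiffAt ℝ ∞ Ψ.symm (Ψ x) := by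
  have : CompleteSpace X := FiniteDimensional.complete ℝ X
  have : CompleteSpace G := FiniteDimensional.complete ℝ G
  -- Completing `g` by a linear projection `p` onto the kernel of its differential makes `(g, p)` a
  -- local diffeomorphism by the inverse function theorem.
  obtain ⟨p, hp⟩ := Submodule.ClosedComplemented.of_finiteDimensional (fderiv ℝ g x).ker
  have hinj : ((fderiv ℝ g x).prod p).ker = ⊥ := by
    refine (Submodule.eq_bot_iff _).2 fun u hu => ?_
    have h1 : fderiv ℝ g x u = 0 := congrArg Prod.fst (LinearMap.mem_ker.1 hu)
    have h2 : p u = 0 := congrArg Prod.snd (LinearMap.mem_ker.1 hu)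
    have h3 := hp ⟨u, h1⟩
    exact congrArg Subtype.val (h3.symm.trans h2)
  have hsurj : ((fderiv ℝ g x).prod p).range = ⊤ := by
    refine LinearMap.range_eq_top.2 fun ⟨y, v⟩ => ?_
    obtain ⟨u, rfl⟩ := hs y
    refine ⟨u - p u + v, ?_⟩
    have h1 : fderiv ℝ g x (p u) = 0 := (p u).2
    have h2 : fderiv ℝ g x v = 0 := v.2
    refine Prod.ext ?_ ?_
    · simp [h1, h2]
    · simp [hp]
  let T : X ≃L[ℝ] G × (fderiv ℝ g x).ker :=
    ContinuousLinearEquiv.ofBijective ((fderiv ℝ g x).prod p) hinj hsurj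
  have hd : HasFDerivAt (fun x' => (g x', p x')) (T : X →L[ℝ] G × (fderiv ℝ g x).ker) x :=
    (hg.differentiableAt (by simp)).hasFDerivAt.prodMk p.hasFDerivAt
  have hc : ContDiffAt ℝ ∞ (fun x' => (g x', p x')) x := hg.prodMk p.contDiff.contDiffAt
  exact ⟨hc.toOpenPartialHomeomorph _ hd (by simp), hc.mem_toOpenPartialHomeomorph_source hd _,
    fun _ => rfl, hc.to_localInverse hd (by simp)⟩

theorem exists_isOpen_injOn (hg : ContDiffAt ℝ ∞ g x)
    (hb : Function.Bijective (fderiv ℝ g x)) :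
    ∃ S : Set X, IsOpen S ∧ x ∈ S ∧ Set.InjOn g S := by
  obtain ⟨Ψ, hx, h1, _⟩ := exists_submersion_chart hg hb.2
  refine ⟨Ψ.source, Ψ.open_source, hx, fun a ha b hb' hab => Ψ.injOn ha hb' (Prod.ext ?_ ?_)⟩
  · rw [h1, h1, hab]
  · have h2 : ∀ v : (fderiv ℝ g x).ker, v = 0 := fun v =>
      Subtype.ext (hb.1 ((LinearMap.mem_ker.1 v.2).trans (map_zero (fderiv ℝ g x)).symm))
    rw [h2 (Ψ a).2, h2 (Ψ b).2]

/-- In submersion coordinates the section freezes the kernel coordinate at its value at `x`. -/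
theorem exists_local_section (hg : ContDiffAt ℝ ∞ g x) (hs : Function.Surjective (fderiv ℝ g x)) :
    ∃ s : G → X, ContDiffAt ℝ ∞ s (g x) ∧ s (g x) = x ∧ ∀ᶠ y in 𝓝 (g x), g (s y) = y := by
  obtain ⟨Ψ, hx, h1, h2⟩ := exists_submersion_chart hg hs
  have h3 : (g x, (Ψ x).2) = Ψ x := Prod.ext (h1 x).symm rfl
  refine ⟨fun y => Ψ.symm (y, (Ψ x).2), ?_, ?_, ?_⟩
  · rw [← h3] at h2
    exact h2.comp (g x) (contDiffAt_id.prodMk contDiffAt_const)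
  · simp only [h3]
    exact Ψ.left_inv hx
  · have h4 : Filter.Tendsto (fun y => (y, (Ψ x).2)) (𝓝 (g x)) (𝓝 (Ψ x)) := by
      rw [← h3]
      exact (continuous_id.prodMk continuous_const).tendsto _
    filter_upwards [h4.eventually (Ψ.open_target.mem_nhds (Ψ.map_source hx))] with y hy
    rw [← h1, Ψ.right_inv hy]

/-- A function with zero derivative along the fibres of a submersion is locally constant on the
fibres. -/
theorem eventually_const_on_fibre (hg : ContDiffAt ℝ ∞ g x)
    (hs : Function.Surjective (fderiv ℝ g x)) {F : X → ℝ}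
    (hF : ∀ᶠ x' in 𝓝 x, DifferentiableAt ℝ F x' ∧
      ∀ v, fderiv ℝ g x' v = 0 → fderiv ℝ F x' v = 0) :
    ∀ᶠ x' in 𝓝 x, g x' = g x → F x' = F x := by
  obtain ⟨Ψ, hx, h1, h2⟩ := exists_submersion_chart hg hs
  have h3 : (g x, (Ψ x).2) = Ψ x := Prod.ext (h1 x).symm rfl
  have hΨ : Ψ.symm (Ψ x) = x := Ψ.left_inv hx
  have hgd : ∀ᶠ x' in 𝓝 x, DifferentiableAt ℝ g x' :=
    ((hg.of_le (m := 1) (by exact_mod_cast le_top)).eventually (by simp)).mono fun _ h => h.differentiableAt (by simp)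
  have h2d : ∀ᶠ y in 𝓝 (Ψ x), DifferentiableAt ℝ Ψ.symm y :=
    ((h2.of_le (m := 1) (by exact_mod_cast le_top)).eventually (by simp)).mono fun _ h => h.differentiableAt (by simp)
  have h5 : Filter.Tendsto Ψ.symm (𝓝 (Ψ x)) (𝓝 x) := by
    have := h2.continuousAt.tendsto
    rwa [hΨ] at this
  have h6 : ∀ᶠ y in 𝓝 (Ψ x), y ∈ Ψ.target ∧ DifferentiableAt ℝ Ψ.symm y ∧
      DifferentiableAt ℝ g (Ψ.symm y) ∧ DifferentiableAt ℝ F (Ψ.symm y) ∧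
      ∀ v, fderiv ℝ g (Ψ.symm y) v = 0 → fderiv ℝ F (Ψ.symm y) v = 0 := by
    filter_upwards [Ψ.open_target.mem_nhds (Ψ.map_source hx), h2d, h5.eventually hgd,
      h5.eventually hF] with y a b c d using ⟨a, b, c, d⟩
  have h7 : Filter.Tendsto (fun v => (g x, v)) (𝓝 (Ψ x).2) (𝓝 (Ψ x)) := by
    conv => rhs; rw [← h3]
    exact (continuous_const.prodMk continuous_id).tendsto _
  obtain ⟨ε, hε, hball⟩ := Metric.eventually_nhds_iff_ball.1 (h7.eventually h6)
  have hder : ∀ v ∈ Metric.ball (Ψ x).2 ε, HasFDerivAt (fun v => F (Ψ.symm (g x, v)))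
      (0 : (fderiv ℝ g x).ker →L[ℝ] ℝ) v := by
    intro v hv
    obtain ⟨a, b, c, d, e⟩ := hball v hv
    have h8 : HasFDerivAt (fun v => (g x, v)) (ContinuousLinearMap.inr ℝ G _) v :=
      (hasFDerivAt_const (g x) v).prodMk (hasFDerivAt_id v)
    have h9 := b.hasFDerivAt.comp v h8
    have h10 := c.hasFDerivAt.comp v h9
    -- `g` is constant on the slice, so directions along the slice lie in the kernel of its
    -- differential, where that of `F` vanishes too.
    have h11 : HasFDerivAt (fun v => g (Ψ.symm (g x, v)))
        (0 : (fderiv ℝ g x).ker →L[ℝ] G) v := by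
      refine (hasFDerivAt_const (g x) v).congr_of_eventuallyEq ?_
      filter_upwards [Metric.isOpen_ball.mem_nhds hv] with w hw
      rw [← h1, Ψ.right_inv (hball w hw).1]
    have h12 := d.hasFDerivAt.comp v h9
    exact (ContinuousLinearMap.ext fun u => e _ (DFunLike.congr_fun (h10.unique h11) u) :
      (fderiv ℝ F (Ψ.symm (g x, v))).comp _ = 0) ▸ h12
  have hcont : ∀ᶠ x' in 𝓝 x, x' ∈ Ψ.source ∧ (Ψ x').2 ∈ Metric.ball (Ψ x).2 ε := by
    filter_upwards [Ψ.open_source.mem_nhds hx, (continuous_snd.continuousAt.comp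
      (Ψ.continuousAt hx)).eventually (Metric.ball_mem_nhds _ hε)] with x' a b using ⟨a, b⟩
  filter_upwards [hcont] with x' ⟨hx', hb⟩ hgx
  have h13 := Metric.isOpen_ball.is_const_of_fderiv_eq_zero
    (convex_ball (Ψ x).2 ε).isPreconnected
    (fun v hv => (hder v hv).differentiableAt.differentiableWithinAt)
    (fun v hv => (hder v hv).fderiv) hb (Metric.mem_ball_self hε)
  have h14 : (g x, (Ψ x').2) = Ψ x' := Prod.ext (hgx.symm.trans (h1 x').symm) rfl
  simpa only [h14, h3, Ψ.left_inv hx', hΨ] using h13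

end Submersion

end HOContact

end

/-! ### The Hamiltonian side: descent along the Legendre map -/

noncomputable section

namespace HOContact

theorem fderiv_comp_apply_eq {X Y G : Type*} [NormedAddCommGroup X] [NormedSpace ℝ X]
    [NormedAddCommGroup Y] [NormedSpace ℝ Y] [NormedAddCommGroup G] [NormedSpace ℝ G]
    {f : X → Y} {p : Y → G} {f' : X →L[ℝ] Y} {x v : X} {y w : Y} {u : G}
    (hp : DifferentiableAt ℝ p y) (hy : y = f x) (hf : HasFDerivAt f f' x) (hv : f' v = w)
    (hw : fderiv ℝ p y w = u) : fderiv ℝ (p ∘ f) x v = u := by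
  subst hy
  rw [(hp.hasFDerivAt.comp x hf).fderiv, ContinuousLinearMap.comp_apply, hv, hw]

/-- The projection onto a linear subspace that straightens a submanifold near `y`. -/
theorem exists_proj_straightening {V : Type*} [NormedAddCommGroup V] [NormedSpace ℝ V]
    [FiniteDimensional ℝ V] {F : Submodule ℝ V} {Φ : OpenPartialHomeomorph V V} {y : V}
    (hy : y ∈ Φ.source) (hΦ : ContDiffOn ℝ ∞ Φ Φ.source) (hΦ' : ContDiffOn ℝ ∞ Φ.symm Φ.target)
    (hF : Φ y ∈ F) :
    ∃ q : V → F, (∀ v, v ∈ F → (q v : V) = v) ∧ ContDiffAt ℝ ∞ (fun v => q (Φ v)) y ∧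
      (∀ u : F, fderiv ℝ (fun v => q (Φ v)) y (fderiv ℝ Φ.symm (Φ y) u) = u) ∧
      ∀ᶠ u in 𝓝 (q (Φ y)), DifferentiableAt ℝ (fun u : F => Φ.symm u) u := by
  obtain ⟨q, hq⟩ := Submodule.ClosedComplemented.of_finiteDimensional F
  have hΦy : ContDiffAt ℝ ∞ Φ y := hΦ.contDiffAt (Φ.open_source.mem_nhds hy)
  have hΦy' : ContDiffAt ℝ ∞ Φ.symm (Φ y) :=
    hΦ'.contDiffAt (Φ.open_target.mem_nhds (Φ.map_source hy))
  have hp : ContDiffAt ℝ ∞ (fun v => q (Φ v)) y := q.contDiff.contDiffAt.comp _ hΦy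
  refine ⟨q, fun v hv => congrArg Subtype.val (hq ⟨v, hv⟩), hp, fun u => ?_, ?_⟩
  · have h1 := (hp.differentiableAt (by simp)).hasFDerivAt
    conv at h1 => rw [← Φ.left_inv hy]
    have h2 := h1.comp _ (hΦy'.differentiableAt (by simp)).hasFDerivAt
    have h3 := (q.hasFDerivAt (x := Φ y)).congr_of_eventuallyEq
      (f₁ := (fun v => q (Φ v)) ∘ Φ.symm) <| by
        filter_upwards [Φ.open_target.mem_nhds (Φ.map_source hy)] with w hw
        simp [Φ.right_inv hw]
    have h4 := DFunLike.congr_fun (h2.unique h3) (u : V)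
    rw [Φ.left_inv hy] at h4
    exact h4.trans (hq u)
  · have h1 : ((q (Φ y) : F) : V) = Φ y := congrArg Subtype.val (hq ⟨_, hF⟩)
    have h2 : Filter.Tendsto (fun u : F => (u : V)) (𝓝 (q (Φ y))) (𝓝 (Φ y)) := by
      have := (continuous_subtype_val (p := fun v => v ∈ F)).tendsto (q (Φ y))
      rwa [h1] at this
    filter_upwards [h2.eventually (Φ.open_target.mem_nhds (Φ.map_source hy))] with u hu
    exact ((hΦ'.contDiffAt (Φ.open_target.mem_nhds hu)).differentiableAt (by simp)).comp u
      F.subtypeL.differentiableAt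

theorem fderiv_eq_zero_of_factorization {X Y G : Type*} [NormedAddCommGroup X] [NormedSpace ℝ X]
    [NormedAddCommGroup Y] [NormedSpace ℝ Y] [NormedAddCommGroup G] [NormedSpace ℝ G]
    {f : X → Y} {g : X → G} {j : G → Y} {v u : X} (hj : DifferentiableAt ℝ j (g v))
    (hg : DifferentiableAt ℝ g v) (hf : f =ᶠ[𝓝 v] j ∘ g) (hu : fderiv ℝ g v u = 0) :
    fderiv ℝ f v u = 0 := by
  rw [((hj.hasFDerivAt.comp v hg.hasFDerivAt).congr_of_eventuallyEq hf).fderiv,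
    ContinuousLinearMap.comp_apply, hu, map_zero]

/-- On $\ker d\mathcal{FL}$ the differential of the energy is $\hat p(\mathrm{shift}\,u)-dL(u)$,
which vanishes by `fderiv_eq_momenta_shift`. This is the infinitesimal form of the descent of $E_L$
to the image. -/
theorem IsLocalLagrangian.fderiv_energyLoc_of_fderiv_legLoc {n k : ℕ} {O : Set (E n)}
    {ℓ : LagCoord n k → ℝ} (hℓ : IsLocalLagrangian O ℓ) {x : LagCoord n k} (hx : x ∈ lagDom k O)
    (hk : 1 ≤ k) {u : LagCoord n k} (hu : fderiv ℝ (legLoc ℓ) x u = 0) :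
    fderiv ℝ (energyLoc ℓ) x u = 0 := by
  rw [hℓ.fderiv_legLoc hx, Prod.mk_eq_zero, Prod.mk_eq_zero] at hu
  obtain ⟨h1, h2, h3⟩ := hu
  rw [hℓ.fderiv_energyLoc hx, h2, fderiv_eq_add_dLdz, h3,
    hℓ.fderiv_eq_momenta_shift hx hk (mem_jetKer_of_trunc h1)]
  simp

section Hamilton

variable {n k : ℕ} {Q : Type*} [TopologicalSpace Q] [ChartedSpace (E n) Q]
  [IsManifold 𝓘(ℝ, E n) ∞ Q] {L : Jet n Q k × ℝ → ℝ} {e : OpenPartialHomeomorph Q (E n)}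

omit [IsManifold 𝓘(ℝ, E n) ∞ Q] in
theorem IsCurveIn.hasDerivAt {P : Set (HamSpace n Q k)} {y : HamSpace n Q k}
    {γ : ℝ → HamSpace n Q k} (h : IsCurveIn P e y γ) : HasDerivAt (fun s => coordH e (γ s))
      (deriv (fun s => coordH e (γ s)) 0) 0 :=
  (h.2.2.differentiableAt (by simp)).hasDerivAt

omit [IsManifold 𝓘(ℝ, E n) ∞ Q] in
theorem contDiffAt_legLoc (hL : IsSmoothLagrangian L) (he : e ∈ charts n Q) {x : LagCoord n k}
    (hx : x ∈ lagDom k e.target) : ContDiffAt ℝ ∞ (legLoc (locL L e)) x :=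
  (isLocalLagrangian_locL hL he).smooth_legLoc.contDiffAt
    ((isLocalLagrangian_locL hL he).isOpen_dom.mem_nhds hx)

omit [IsManifold 𝓘(ℝ, E n) ∞ Q] in
theorem hasFDerivAt_legLoc (hL : IsSmoothLagrangian L) (he : e ∈ charts n Q) {x : LagCoord n k}
    (hx : x ∈ lagDom k e.target) :
    HasFDerivAt (legLoc (locL L e)) (fderiv ℝ (legLoc (locL L e)) x) x :=
  ((contDiffAt_legLoc hL he hx).differentiableAt (by simp)).hasFDerivAt

variable (hk : 1 ≤ k) (hL : IsSmoothLagrangian L) (he : e ∈ charts n Q)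
include hk hL he

theorem coordH_Leg_pointL {v : LagCoord n k} (hv : v ∈ lagDom k e.target) :
    coordH e (Leg L (pointL e v : LagSpace n Q k)) = legLoc (locL L e) v := by
  rw [coordH_Leg hk hL he _ (base_pointL hv), coordL_pointL he hv]

theorem fderiv_legLoc_mem_tangentTo {U : Set (LagSpace n Q k)} (hU : IsOpen U)
    {x : LagSpace n Q k} (hxU : x ∈ U) (hx : x.1.base ∈ e.source) (u : LagCoord n k) :
    fderiv ℝ (legLoc (locL L e)) (coordL e x) u ∈ tangentTo (Leg L '' U) e (Leg L x) := by
  have hline : HasDerivAt (fun r : ℝ => coordL e x + r • u) u 0 := by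
    simpa using ((hasDerivAt_id (0 : ℝ)).smul_const u).const_add (coordL e x)
  have hlim : Filter.Tendsto (fun r : ℝ => coordL e x + r • u) (𝓝 0) (𝓝 (coordL e x)) := by
    simpa using hline.continuousAt.tendsto
  have hev := hlim.eventually (eventually_pointL_mem he hU hxU hx)
  have heq : (fun r : ℝ => coordH e (Leg L (pointL e (coordL e x + r • u) : LagSpace n Q k)))
      =ᶠ[𝓝 0] fun r => legLoc (locL L e) (coordL e x + r • u) :=
    hev.mono fun r hr => coordH_Leg_pointL hk hL he hr.1
  have h0 : coordL e x + (0 : ℝ) • u = coordL e x := by simp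
  refine ⟨fun r => Leg L (pointL e (coordL e x + r • u)), ⟨?_, ?_, ?_⟩, ?_⟩
  · change Leg L (pointL e (coordL e x + (0 : ℝ) • u)) = _
    rw [h0, pointL_coordL he hx]
  · filter_upwards [hev] with r hr
    refine ⟨⟨_, hr.2, rfl⟩, ?_⟩
    rw [base_Leg]
    exact base_pointL hr.1
  · refine ContDiffAt.congr_of_eventuallyEq ?_ heq
    have h1 : ContDiff ℝ ∞ fun r : ℝ => coordL e x + r • u := by fun_prop
    refine ContDiffAt.comp (0 : ℝ) (contDiffAt_legLoc hL he ?_) h1.contDiffAt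
    rw [h0]
    exact coordL_mem hx
  · rw [heq.deriv_eq]
    have h1 := hasFDerivAt_legLoc hL he (coordL_mem hx)
    rw [← h0] at h1
    have h2 := (h1.comp_hasDerivAt (0 : ℝ) hline).deriv
    rw [h0] at h2
    exact h2

theorem deriv_coordH_Leg {I : Set ℝ} (hI : IsOpen I) {σ : ℝ → LagSpace n Q k}
    (hσ : IsSmoothCurveL I σ) {t : ℝ} (ht : t ∈ I) (hte : (σ t).1.base ∈ e.source) :
    deriv (fun s => coordH e (Leg L (σ s))) t = fderiv ℝ (legLoc (locL L e)) (coordL e (σ t))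
      (deriv (fun s => coordL e (σ s)) t) := by
  have h1 := (hasFDerivAt_legLoc hL he (coordL_mem hte)).comp_hasDerivAt t
    (hσ.hasDerivAt hI ht hte he)
  refine (h1.congr_of_eventuallyEq ?_).deriv
  filter_upwards [hσ.eventually hI ht hte] with s hs
  exact coordH_Leg hk hL he _ hs.2

section Section

variable {U : Set (LagSpace n Q k)} (hU : IsOpen U) {x : LagSpace n Q k} (hxU : x ∈ U)
  (hx : x.1.base ∈ e.source) {s : HamCoord n k → LagCoord n k}
  (hs : DifferentiableAt ℝ s (coordH e (Leg L x))) (hs0 : s (coordH e (Leg L x)) = coordL e x)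
  (hsec : ∀ᶠ v in 𝓝 (coordH e (Leg L x)), (∃ y ∈ Leg L '' U, y.1.pt.base ∈ e.source ∧
    coordH e y = v) → legLoc (locL L e) (s v) = v)
include hU hxU hx hs hs0 hsec

theorem IsCurveIn.eventually_section {γ : ℝ → HamSpace n Q k}
    (hγ : IsCurveIn (Leg L '' U) e (Leg L x) γ) :
    ∀ᶠ r in 𝓝 0, s (coordH e (γ r)) ∈ lagDom k e.target ∧
      pointL e (s (coordH e (γ r))) ∈ U ∧ Leg L (pointL e (s (coordH e (γ r)))) = γ r ∧
      legLoc (locL L e) (s (coordH e (γ r))) = coordH e (γ r) := by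
  have h1 : Filter.Tendsto (fun r => coordH e (γ r)) (𝓝 0) (𝓝 (coordH e (Leg L x))) := by
    have := hγ.2.2.continuousAt.tendsto
    rwa [hγ.1] at this
  have h2 : Filter.Tendsto s (𝓝 (coordH e (Leg L x))) (𝓝 (coordL e x)) := by
    have := hs.continuousAt.tendsto
    rwa [hs0] at this
  filter_upwards [(h2.comp h1).eventually (eventually_pointL_mem he hU hxU hx),
    h1.eventually hsec, hγ.2.1] with r ha hb hc
  have h3 := hb ⟨γ r, hc.1, hc.2, rfl⟩
  refine ⟨ha.1, ha.2, coordH_injective he ?_ hc.2 ?_, h3⟩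
  · rw [base_Leg]
    exact base_pointL ha.1
  · exact (coordH_Leg_pointL hk hL he ha.1).trans h3

/-- A curve in the image agrees near its starting point with $\mathcal{FL}\circ s$ applied to it;
differentiating shows that $ds$ is a right inverse of $d\mathcal{FL}$ on tangent vectors of the
image. -/
theorem fderiv_legLoc_section {u : HamCoord n k}
    (hu : u ∈ tangentTo (Leg L '' U) e (Leg L x)) :
    fderiv ℝ (legLoc (locL L e)) (coordL e x) (fderiv ℝ s (coordH e (Leg L x)) u) = u := by
  obtain ⟨γ, hγ, rfl⟩ := hu
  have h1 := hγ.hasDerivAt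
  have h2 := hs.hasFDerivAt
  have h3 := hasFDerivAt_legLoc hL he (coordL_mem hx)
  rw [← hs0] at h3
  conv at h2 => rw [← hγ.1]
  conv at h3 => rw [← hγ.1]
  have h4 := h3.comp_hasDerivAt (0 : ℝ) (h2.comp_hasDerivAt (0 : ℝ) h1)
  have h5 := h4.congr_of_eventuallyEq (f₁ := fun r => coordH e (γ r)) <| by
    filter_upwards [hγ.eventually_section hk hL he hU hxU hx hs hs0 hsec] with r hr
    exact hr.2.2.2.symm
  rw [hγ.1, hs0] at h5
  exact h5.unique h1

/-- The differential of `H` along the image is $dE_L\circ ds$. Reeb vectors push forward by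
$d\mathcal{FL}$, and those of the image lift by $ds$ to Reeb vectors of $\eta_L$, for which
`contactEq_etaL` applies. The section need only be valid over the image, so the regular and
almost-regular cases are treated together. -/
theorem solvesOn_of_section {H : HamSpace n Q k → ℝ} (hH : IsHamiltonianOn L U H)
    (hR : ∃ R, IsReeb (etaL (locL L e)) (coordL e x) R) {a : LagCoord n k}
    (ha : GraphEq (locL L e) (coordL e x) a) :
    SolvesOn (Leg L '' U) H e (Leg L x) (fderiv ℝ (legLoc (locL L e)) (coordL e x) a) := by
  have hℓ := isLocalLagrangian_locL hL he
  have hm := coordL_mem (k := k) hx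
  have htan := fderiv_legLoc_mem_tangentTo hk hL he hU hxU hx
  have hsur : ∀ u ∈ tangentTo (Leg L '' U) e (Leg L x), _ = u :=
    fun u hu => fderiv_legLoc_section hk hL he hU hxU hx hs hs0 hsec hu
  have hy := coordH_Leg hk hL he x hx
  refine ⟨htan a, (fderiv ℝ (energyLoc (locL L e)) (coordL e x)).comp
    (fderiv ℝ s (coordH e (Leg L x))), fun γ hγ => ?_, ?_, fun R hR' u hu => ?_, ?_⟩
  · have h1 := hγ.hasDerivAt
    have h2 := hs.hasFDerivAt
    have h3 := (hℓ.differentiableAt hℓ.smooth_energyLoc hm).hasFDerivAt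
    conv at h2 => rw [← hγ.1]
    rw [← hs0, ← hγ.1] at h3
    have h4 := h3.comp_hasDerivAt (0 : ℝ) (h2.comp_hasDerivAt (0 : ℝ) h1)
    have h5 := h4.congr_of_eventuallyEq (f₁ := fun r => H (γ r)) <| by
      filter_upwards [hγ.eventually_section hk hL he hU hxU hx hs hs0 hsec] with r hr
      rw [← hr.2.2.1, hH _ hr.2.1, energy_eq hk hL he _ (base_pointL hr.1),
        coordL_pointL he hr.1]
      rfl
    rw [hγ.1, hs0] at h5
    exact h5
  · obtain ⟨R, hR1, hR2⟩ := hR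
    refine ⟨_, htan R, fun u hu => ?_, ?_⟩
    · rw [← hsur u hu, hy, ← hℓ.dForm_etaL_eq_etaH hm]
      exact hR1 _
    · rw [hy, ← hℓ.etaL_eq_etaH hm]
      exact hR2
  · have h1 : IsReeb (etaL (locL L e)) (coordL e x) (fderiv ℝ s (coordH e (Leg L x)) R) := by
      refine ⟨fun v => ?_, ?_⟩
      · rw [hℓ.dForm_etaL_eq_etaH hm, hsur R hR'.1, ← hy]
        exact hR'.2.1 _ (htan v)
      · rw [hℓ.etaL_eq_etaH hm, hsur R hR'.1, ← hy]
        exact hR'.2.2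
    have h2 := (hℓ.contactEq_etaL hm a _ ha h1).1 (fderiv ℝ s (coordH e (Leg L x)) u)
    rw [hℓ.dForm_etaL_eq_etaH hm, hℓ.etaL_eq_etaH hm, hsur u hu, ← hy] at h2
    exact h2
  · obtain ⟨R, hR⟩ := hR
    have h1 := (hℓ.contactEq_etaL hm a R ha hR).2
    rw [hy, ← hℓ.etaL_eq_etaH hm, h1, hH x hxU, energy_eq hk hL he x hx]

end Section

omit he in
theorem SolvesGraph.solvesHamiltonReg {I : Set ℝ} (hI : IsOpen I) {σ : ℝ → LagSpace n Q k}
    (hσ : IsSmoothCurveL I σ) (hreg : IsRegularLagrangian L) (h : SolvesGraph L I σ) :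
    SolvesHamiltonReg L I σ := by
  have key : ∀ x : LagSpace n Q k, ∀ e ∈ charts n Q, x.1.base ∈ e.source →
      Function.Bijective (fderiv ℝ (legLoc (locL L e)) (coordL e x)) :=
    fun x e he hx => hreg.bijective_fderiv_legLoc hL hk he (coordL_mem hx)
  intro t ht
  constructor
  · have he : chartAt (E n) (σ t).1.base ∈ charts n Q := IsManifold.chart_mem_maximalAtlas _
    have hx := mem_chart_source (E n) (σ t).1.base
    obtain ⟨S, hS, hxS, hinj⟩ := exists_isOpen_injOn
      (contDiffAt_legLoc hL he (coordL_mem hx)) (key _ _ he hx)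
    refine ⟨_, isOpen_chartL he hS, ⟨hx, hxS⟩, fun a ha b hb hab => ?_⟩
    refine coordL_injective he ha.1 hb.1 (hinj ha.2 hb.2 ?_)
    rw [← coordH_Leg hk hL he a ha.1, ← coordH_Leg hk hL he b hb.1, hab]
  · intro U hU hxU hinj
    refine ⟨?_, fun H hH e he hx => ?_⟩
    · classical
      -- The energy of a chosen preimage, unambiguous by injectivity on `U`; the value off the image
      -- is irrelevant.
      refine ⟨fun y => if h : ∃ x ∈ U, Leg L x = y then energy L h.choose else 0, fun x hx => ?_⟩
      have h1 : ∃ x' ∈ U, Leg L x' = Leg L x := ⟨x, hx, rfl⟩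
      beta_reduce
      rw [dif_pos h1, hinj h1.choose_spec.1 hx h1.choose_spec.2]
    · rw [base_Leg] at hx
      have hd := deriv_coordH_Leg hk hL he hI hσ ht hx
      obtain ⟨s, hs, hs0, hsec⟩ := exists_local_section
        (contDiffAt_legLoc hL he (coordL_mem hx)) (key _ _ he hx).2
      rw [← coordH_Leg hk hL he _ hx] at hs hs0 hsec
      rw [hd]
      exact solvesOn_of_section hk hL he hU hxU hx (hs.differentiableAt (by simp)) hs0
        (hsec.mono fun v hv _ => hv) hH (hreg.hasReeb hk hL _ e he hx) (h t ht e he hx)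

omit hk hL he in
/-- Velocities along the linear subspace that straightens `P` are tangent to `P`. -/
theorem fderiv_symm_mem_tangentTo (he : e ∈ charts n Q) {P : Set (HamSpace n Q k)}
    {y : HamSpace n Q k} (hye : y.1.pt.base ∈ e.source)
    {F : Submodule ℝ (HamCoord n k)} {Φ : OpenPartialHomeomorph (HamCoord n k) (HamCoord n k)}
    (hy : coordH e y ∈ Φ.source) (hΦ' : ContDiffAt ℝ ∞ Φ.symm (Φ (coordH e y)))
    (hP : ∀ v ∈ Φ.source,
      (∃ y' ∈ P, y'.1.pt.base ∈ e.source ∧ coordH e y' = v) ↔ Φ v ∈ F)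
    (hyF : Φ (coordH e y) ∈ F) {u : HamCoord n k} (hu : u ∈ F) :
    fderiv ℝ Φ.symm (Φ (coordH e y)) u ∈ tangentTo P e y := by
  have hc : ContDiff ℝ ∞ fun r : ℝ => Φ (coordH e y) + r • u := by fun_prop
  have h0 : Φ (coordH e y) + (0 : ℝ) • u = Φ (coordH e y) := by simp
  have hlim : Filter.Tendsto (fun r : ℝ => Φ (coordH e y) + r • u) (𝓝 0)
      (𝓝 (Φ (coordH e y))) := by
    have := hc.continuous.tendsto 0
    rwa [h0] at this
  have hex : ∀ r : ℝ, Φ (coordH e y) + r • u ∈ Φ.target →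
      ∃ y' ∈ P, y'.1.pt.base ∈ e.source ∧ coordH e y' = Φ.symm (Φ (coordH e y) + r • u) := by
    intro r hr
    refine (hP _ (Φ.map_target hr)).2 ?_
    rw [Φ.right_inv hr]
    exact F.add_mem hyF (F.smul_mem r hu)
  classical
  let γ : ℝ → HamSpace n Q k := fun r =>
    if hr : Φ (coordH e y) + r • u ∈ Φ.target then (hex r hr).choose else y
  have hγ : ∀ᶠ r in 𝓝 (0 : ℝ), γ r ∈ P ∧ (γ r).1.pt.base ∈ e.source ∧
      coordH e (γ r) = Φ.symm (Φ (coordH e y) + r • u) := by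
    filter_upwards [hlim.eventually (Φ.open_target.mem_nhds (Φ.map_source hy))] with r hr
    have : γ r = (hex r hr).choose := dif_pos hr
    rw [this]
    exact (hex r hr).choose_spec
  have hγ' : (fun r => coordH e (γ r)) =ᶠ[𝓝 0] Φ.symm ∘ fun r => Φ (coordH e y) + r • u :=
    hγ.mono fun r hr => hr.2.2
  have hline : HasDerivAt (fun r : ℝ => Φ (coordH e y) + r • u) u 0 := by
    simpa using ((hasDerivAt_id (0 : ℝ)).smul_const u).const_add (Φ (coordH e y))
  have hd1 := (hΦ'.differentiableAt (by simp)).hasFDerivAt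
  conv at hd1 => rw [← h0]
  have hd := hd1.comp_hasDerivAt (0 : ℝ) hline
  rw [h0] at hd
  refine ⟨γ, ⟨?_, hγ.mono fun r hr => ⟨hr.1, hr.2.1⟩, ?_⟩, hγ'.deriv_eq.trans hd.deriv⟩
  · have h1 := hγ.self_of_nhds
    refine coordH_injective he h1.2.1 hye ?_
    rw [h1.2.2, h0, Φ.left_inv hy]
  · refine ContDiffAt.congr_of_eventuallyEq ?_ hγ'
    refine ContDiffAt.comp (0 : ℝ) ?_ hc.contDiffAt
    rwa [h0]

/-- Near a point `x`, the Legendre map of an almost-regular Lagrangian factors through a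
submersion. -/
theorem IsAlmostRegularLagrangian.exists_factorization (hreg : IsAlmostRegularLagrangian L)
    {x : LagSpace n Q k} (hx : x.1.base ∈ e.source) :
    ∃ (F : Submodule ℝ (HamCoord n k)) (p : HamCoord n k → F) (j : F → HamCoord n k),
      ContDiffAt ℝ ∞ p (coordH e (Leg L x)) ∧
      Function.Surjective (fderiv ℝ (p ∘ legLoc (locL L e)) (coordL e x)) ∧
      (∀ᶠ y in 𝓝 (p (coordH e (Leg L x))), DifferentiableAt ℝ j y) ∧
      (∀ᶠ v in 𝓝 (coordL e x), legLoc (locL L e) v = j (p (legLoc (locL L e) v))) ∧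
      ∀ᶠ v in 𝓝 (coordH e (Leg L x)), (∃ y ∈ Set.range (Leg L), y.1.pt.base ∈ e.source ∧
        coordH e y = v) → j (p v) = v := by
  obtain ⟨-, hsub, hsm, -⟩ := hreg
  have hbase : (Leg L x).1.pt.base ∈ e.source := by rwa [base_Leg]
  obtain ⟨F, Φ, hy, hΦ, hΦ', hP⟩ := hsub (Leg L x) ⟨x, rfl⟩ e he hbase
  have hF : Φ (coordH e (Leg L x)) ∈ F := (hP _ hy).2.1 ⟨_, ⟨x, rfl⟩, hbase, rfl⟩
  obtain ⟨q, hq, hp, hpd, hj⟩ := exists_proj_straightening hy hΦ hΦ' hF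
  have hjp : ∀ v ∈ Φ.source, (∃ y ∈ Set.range (Leg L), y.1.pt.base ∈ e.source ∧
      coordH e y = v) → Φ.symm (q (Φ v)) = v := by
    intro v hv hv'
    rw [hq _ ((hP v hv).2.1 hv')]
    exact Φ.left_inv hv
  have hleg := contDiffAt_legLoc hL he (coordL_mem (k := k) hx)
  have hxy := coordH_Leg hk hL he x hx
  refine ⟨F, fun v => q (Φ v), fun y => Φ.symm y, hp, fun y => ?_, hj, ?_, ?_⟩
  · obtain ⟨v, hv⟩ := hsm x e he hx _ (fderiv_symm_mem_tangentTo he hbase hy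
      (hΦ'.contDiffAt (Φ.open_target.mem_nhds (Φ.map_source hy))) (fun v hv => (hP v hv).2)
      hF y.2)
    exact ⟨v, fderiv_comp_apply_eq (hp.differentiableAt (by simp)) hxy
      (hasFDerivAt_legLoc hL he (coordL_mem (k := k) hx)) hv (hpd y)⟩
  · have h1 := hleg.continuousAt.tendsto
    rw [← hxy] at h1
    filter_upwards [h1.eventually (Φ.open_source.mem_nhds hy),
      (isLocalLagrangian_locL hL he).isOpen_dom.mem_nhds (coordL_mem hx)] with v hv hv'
    refine (hjp _ hv ⟨_, ⟨pointL e v, rfl⟩, ?_, coordH_Leg_pointL hk hL he hv'⟩).symm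
    rw [base_Leg]
    exact base_pointL hv'
  · filter_upwards [Φ.open_source.mem_nhds hy] with v hv using hjp v hv

omit he in
-- $E_L$ is locally constant on the fibres of $\mathcal{FL}$, by the factorization through a
-- submersion and the vanishing of $dE_L$ on $\ker d\mathcal{FL}$; connectedness makes it constant
-- on each fibre.
theorem IsAlmostRegularLagrangian.exists_hamiltonian (hreg : IsAlmostRegularLagrangian L) :
    ∃ H, IsHamiltonianOn L Set.univ H := by
  have hloc : ∀ x : LagSpace n Q k, ∀ᶠ x' in 𝓝 x, Leg L x' = Leg L x →
      energy L x' = energy L x := by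
    intro x
    have he : chartAt (E n) x.1.base ∈ charts n Q := IsManifold.chart_mem_maximalAtlas _
    have hx := mem_chart_source (E n) x.1.base
    generalize chartAt (E n) x.1.base = e at he hx
    have hℓ := isLocalLagrangian_locL hL he
    have hm := coordL_mem (k := k) hx
    have hxy := coordH_Leg hk hL he x hx
    obtain ⟨F, p, j, hp, hs, hj, hfac, -⟩ := hreg.exists_factorization hk hL he hx
    have hleg := contDiffAt_legLoc hL he hm
    rw [hxy] at hp hj
    have hg := hp.comp (coordL e x) hleg
    have h1 := eventually_const_on_fibre hg hs (F := energyLoc (locL L e)) ?_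
    · obtain ⟨S, hS, hSo, hxS⟩ := eventually_nhds_iff.1 h1
      filter_upwards [(isOpen_chartL he hSo).mem_nhds ⟨hx, hxS⟩] with x' hx' hLeg
      rw [energy_eq hk hL he x hx, energy_eq hk hL he x' hx'.1]
      refine hS _ hx'.2 ?_
      rw [Function.comp_apply, Function.comp_apply, ← coordH_Leg hk hL he x hx,
        ← coordH_Leg hk hL he x' hx'.1, hLeg]
    · have hgd : ∀ᶠ v in 𝓝 (coordL e x), DifferentiableAt ℝ (p ∘ legLoc (locL L e)) v :=
        ((hg.of_le (m := 1) (by exact_mod_cast le_top)).eventually (by simp)).mono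
          fun _ h => h.differentiableAt (by simp)
      filter_upwards [hgd, hg.continuousAt.eventually hj, eventually_eventually_nhds.2 hfac,
        hℓ.isOpen_dom.mem_nhds hm] with v hv1 hv2 hv3 hv4
      refine ⟨hℓ.differentiableAt hℓ.smooth_energyLoc hv4, fun u hu => ?_⟩
      exact hℓ.fderiv_energyLoc_of_fderiv_legLoc hv4 hk
        (fderiv_eq_zero_of_factorization hv2 hv1 hv3 hu)
  have hconst : ∀ x x' : LagSpace n Q k, Leg L x' = Leg L x → energy L x' = energy L x := by
    intro x x' h
    have hconn := isPreconnected_iff_preconnectedSpace.1 (hreg.2.2.2 x).isPreconnected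
    have hlc : IsLocallyConstant fun w : Leg L ⁻¹' {Leg L x} => energy L w.1 := by
      refine (IsLocallyConstant.iff_eventually_eq _).2 fun w => ?_
      filter_upwards [continuous_subtype_val.continuousAt.eventually (hloc w.1)] with w' hw'
      exact hw' (w'.2.trans w.2.symm)
    exact hlc.apply_eq_of_preconnectedSpace ⟨x', h⟩ ⟨x, rfl⟩
  classical
  refine ⟨fun y => if h : ∃ x, Leg L x = y then energy L h.choose else 0, fun x _ => ?_⟩
  have h1 : ∃ x', Leg L x' = Leg L x := ⟨x, rfl⟩
  beta_reduce
  rw [dif_pos h1]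
  exact hconst _ _ h1.choose_spec

omit he in
theorem SolvesGraph.solvesHamiltonSing {I : Set ℝ} (hI : IsOpen I) {σ : ℝ → LagSpace n Q k}
    (hσ : IsSmoothCurveL I σ) (hreg : IsAlmostRegularLagrangian L)
    (hR : ∀ t ∈ I, HasReeb L (σ t)) (h : SolvesGraph L I σ) :
    SolvesHamiltonSing L I σ := by
  intro t ht
  refine ⟨hreg.exists_hamiltonian hk hL, fun H hH e he hx => ?_⟩
  rw [base_Leg] at hx
  have hxy := coordH_Leg hk hL he _ hx
  obtain ⟨F, p, j, hp, hs, hj, hfac, hj'⟩ := hreg.exists_factorization hk hL he hx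
  have hleg := contDiffAt_legLoc hL he (coordL_mem (k := k) hx)
  have hg : ContDiffAt ℝ ∞ (p ∘ legLoc (locL L e)) (coordL e (σ t)) :=
    (hxy ▸ hp).comp (coordL e (σ t)) hleg
  obtain ⟨s, hsm, hs0, hsec⟩ := exists_local_section hg hs
  rw [Function.comp_apply, ← hxy] at hsm hs0 hsec
  rw [deriv_coordH_Leg hk hL he hI hσ ht hx]
  have hsp : ContDiffAt ℝ ∞ (fun v => s (p v)) (coordH e (Leg L (σ t))) := hsm.comp _ hp
  have hlim : Filter.Tendsto (fun v => s (p v)) (𝓝 (coordH e (Leg L (σ t))))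
      (𝓝 (coordL e (σ t))) := by
    have := hsp.continuousAt.tendsto
    rwa [hs0] at this
  refine solvesOn_of_section hk hL he isOpen_univ (Set.mem_univ _) hx
    (hsp.differentiableAt (by simp)) hs0 ?_ hH (hR t ht e he hx) (h t ht e he hx)
  -- On $P_0$ near the point, $\mathcal{FL}(s(p(v)))=j(p(\mathcal{FL}(s(p(v)))))=j(p(v))=v$; the
  -- last equality needs $v$ to come from $P_0$.
  filter_upwards [hp.continuousAt.eventually hsec, hlim.eventually hfac, hj'] with v h1 h2 h3 h4
  rw [Set.image_univ] at h4
  rw [h2, show p (legLoc (locL L e) (s (p v))) = p v from h1]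
  exact h3 h4

end Hamilton

end HOContact

end

/-! ### The theorem -/

theorem mainTheorem4 (n k : ℕ) (hk : 1 ≤ k)
    (Q : Type*) [TopologicalSpace Q] [ChartedSpace (E n) Q] [IsManifold 𝓘(ℝ, E n) ∞ Q]
    (L : Jet n Q k × ℝ → ℝ) (hL : IsSmoothLagrangian L)
    (I : Set ℝ) (hI : IsOpen I) :
    -- curves in `W_1` are of the form `(σ_L, Leg ∘ σ_L)`
    (∀ σ : ℝ → UniSpace n Q k, (∀ t ∈ I, σ t ∈ W1 L) → ∀ t ∈ I,
      σ t = graphPt L (projL (σ t)) ∧ projH (σ t) = Leg L (projL (σ t)) ∧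
      projH (σ t) ∈ Set.range (Leg L)) ∧
    -- regular Lagrangians
    (IsRegularLagrangian L →
      (∀ σ : ℝ → UniSpace n Q k, IsSmoothCurve I σ → (∀ t ∈ I, σ t ∈ W1 L) →
        SolvesUnified L I σ →
          IsHolonomic I (fun t => projL (σ t)) ∧
          SolvesHerglotzAll L I (fun t => projL (σ t)) ∧
          SolvesHamiltonReg L I (fun t => projL (σ t))) ∧
      (∀ (c : ℝ → Q) (z : ℝ → ℝ), ContMDiffOn 𝓘(ℝ, ℝ) 𝓘(ℝ, E n) ∞ c I → ContDiffOn ℝ ∞ z I →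
        SolvesHerglotz L I (prolong k c z) →
          IsSmoothCurve I (fun t => graphPt L (prolong k c z t)) ∧
          SolvesUnifiedAll L I (fun t => graphPt L (prolong k c z t)) ∧
          SolvesHamiltonReg L I (prolong k c z))) ∧
    -- almost-regular Lagrangians, on the points of a constraint set `W_f`
    (IsAlmostRegularLagrangian L → ∀ Wf : Set (UniSpace n Q k), Wf ⊆ W1 L →
      (∀ x ∈ projL '' Wf, HasReeb L x) →
      Leg L '' (projL '' Wf) = projH '' Wf ∧
      (∀ σ : ℝ → UniSpace n Q k, IsSmoothCurve I σ → (∀ t ∈ I, σ t ∈ Wf) →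
        SolvesUnified L I σ → UpperHolonomic I (fun t => projL (σ t)) →
          IsHolonomic I (fun t => projL (σ t)) ∧
          SolvesHerglotzAll L I (fun t => projL (σ t)) ∧
          (∀ t ∈ I, projL (σ t) ∈ projL '' Wf) ∧
          SolvesHamiltonSing L I (fun t => projL (σ t)) ∧
          (∀ t ∈ I, Leg L (projL (σ t)) ∈ projH '' Wf)) ∧
      (∀ (c : ℝ → Q) (z : ℝ → ℝ), ContMDiffOn 𝓘(ℝ, ℝ) 𝓘(ℝ, E n) ∞ c I → ContDiffOn ℝ ∞ z I →
        (∀ t ∈ I, (prolong k c z t : LagSpace n Q k) ∈ projL '' Wf) →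
        SolvesHerglotz L I (prolong k c z) →
          IsSmoothCurve I (fun t => graphPt L (prolong k c z t)) ∧
          SolvesUnifiedAll L I (fun t => graphPt L (prolong k c z t)) ∧
          (∀ t ∈ I, graphPt L (prolong k c z t) ∈ Wf) ∧
          SolvesHamiltonSing L I (prolong k c z) ∧
          (∀ t ∈ I, Leg L (prolong k c z t) ∈ projH '' Wf))) := by
  have hgraph : ∀ w ∈ W1 L, w = graphPt L (projL w) := by
    rintro _ ⟨x, rfl⟩
    rfl
  have hproj : ∀ w ∈ W1 L, projH w = Leg L (projL w) := by
    rintro _ ⟨x, rfl⟩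
    rfl
  refine ⟨fun σ hσ t ht => ⟨hgraph _ (hσ t ht), hproj _ (hσ t ht), _, (hproj _ (hσ t ht)).symm⟩,
    fun hreg => ⟨fun σ hs hσ h => ?_, fun c z hc hz h => ?_⟩,
    fun hreg Wf hWf hR => ⟨?_, fun σ hs hσ h hup => ?_, fun c z hc hz hS h => ?_⟩⟩
  · have hg := h.solvesGraph hk hL hI hs fun t ht => hgraph _ (hσ t ht)
    exact ⟨hg.isHolonomic_of_regular hk hL hI hs.projL hreg,
      hg.solvesHerglotzAll hL fun t _ => hreg.hasReeb hk hL _,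
      hg.solvesHamiltonReg hk hL hI hs.projL hreg⟩
  · have hσ := isSmoothCurveL_prolong (k := k) hI hc hz
    have hg := h.solvesGraph hk hL hI hc hz
    exact ⟨isSmoothCurve_graphPt hk hL hσ, hg.solvesUnifiedAll hk hL hI hσ,
      hg.solvesHamiltonReg hk hL hI hσ hreg⟩
  · rw [Set.image_image]
    exact Set.image_congr fun w hw => (hproj w (hWf hw)).symm
  · have hg := h.solvesGraph hk hL hI hs fun t ht => hgraph _ (hWf (hσ t ht))
    have hmem : ∀ t ∈ I, projL (σ t) ∈ projL '' Wf := fun t ht => ⟨_, hσ t ht, rfl⟩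
    exact ⟨hg.isHolonomic_of_upper hI hs.projL hup,
      hg.solvesHerglotzAll hL fun t ht => hR _ (hmem t ht), hmem,
      hg.solvesHamiltonSing hk hL hI hs.projL hreg fun t ht => hR _ (hmem t ht),
      fun t ht => ⟨_, hσ t ht, hproj _ (hWf (hσ t ht))⟩⟩
  · have hσ := isSmoothCurveL_prolong (k := k) hI hc hz
    have hg := h.solvesGraph hk hL hI hc hz
    have hmem : ∀ t ∈ I, graphPt L (prolong k c z t) ∈ Wf := by
      intro t ht
      obtain ⟨w, hw, hwt⟩ := hS t ht
      -- A point of the graph is determined by its projection to the jet space, so the given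
      -- preimage in `Wf` is the lifted point itself.
      rw [← hwt, ← hgraph w (hWf hw)]
      exact hw
    exact ⟨isSmoothCurve_graphPt hk hL hσ, hg.solvesUnifiedAll hk hL hI hσ, hmem,
      hg.solvesHamiltonSing hk hL hI hσ hreg fun t ht => hR _ (hS t ht),
      fun t ht => ⟨_, hmem t ht, rfl⟩⟩
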